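/- **Model.** Let $c,\lambda,q>0$, and let $X_t=x+ct-\sum_{i=1}^{N_t}\xi_i$, where $N$ is a Poisson process of rate $\lambda$, independent of the i.i.d. claims $\xi_i>0$. The claims are matrix-exponential of type $(\vec\beta,B)$: $\vec\beta$ is a real row vector of length $n$ with $\vec\beta\,\mathbf 1=1$, $B$ is an invertible real $n\times n$ matrix, $\vec\beta e^{xB}\to 0$ componentwise as $x\to\infty$, and the function $f(z)=\vec\beta e^{zB}(-B)\mathbf 1$ is nonnegative on $[0,\infty)$ (as it is whenever $\vec\beta e^{xB}$ is componentwise decreasing); $f$ is the claim density. Write $\overline F$ for the survival function of the claims, $\kappa(s)=cs+\lambda\int_0^\infty(e^{-sz}-1)f(z)\,dz$ for $s\ge 0$, and $\Phi_q$ for the largest nonnegative root of $\kappa(s)=q$. The scale function $W_q$ is the function that vanishes on $(-\infty,0)$, is continuous on $[0,\infty)$ and satisfies $\int_0^\infty e^{-sx}W_q(x)\,dx=1/(\kappa(s)-q)$ for $s>\Phi_q$. Put $Z_q(x)=1+q\int_0^xW_q(y)\,dy$. Derivatives at $b$ of functions on $[0,\infty)$ are right derivatives if $b=0$. **Policy.**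 Let $a,b\ge 0$ and $k\ge 1$. Under the $(-a,0,b)$ policy, a reserve in $[-a,0)$ is immediately lifted to $0$ by a capital injection; bankruptcy occurs at the first time $T$ when the reserve is below $-a$; and the reserve is kept at or below $b$ by paying dividends (as a lump sum if it starts above $b$, and at rate $c$ while it is at $b$). With $D$ and $I$ the cumulative dividends and injections until bankruptcy, let $$J_x=J_x^{a,b}=\mathbb E_x\Big[\int_{[0,T]}e^{-qt}\,(dD_t-k\,dI_t)\Big].$$ **Functions.** Let $m_a(y)=\int_0^a z f(y+z)\,dz$, $\;G_a(x)=\lambda\int_0^xW_q(x-y)\,m_a(y)\,dy$, $\;S_a(x)=Z_q(x)+\lambda\int_0^xW_q(x-y)\,\overline F(a+y)\,dy$, $\;R_a=S_a-Z_q$, and $$C(x)=\lambda\int_0^xW_q(x-y)e^{yB}\,dy,\qquad \vec C(x)=\vec\beta\,C(x),\qquad M(a)=\int_0^a z e^{zB}(-B)\,dz .$$ For $x,y\ge0$ let $\Psi_q(x,y)=\mathbb E_x[e^{-qT_0};\,T_0<\infty,\ X_{T_0}<-y]$, where $T_0=\inf\{t\ge 0:X_t<0\}$. **Proposition.** 1.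 The function $W_q$ exists, $\Phi_q>0$ and $\kappa(\Phi_q)=q$. Moreover $\overline F(x)=\vec\beta e^{xB}\mathbf 1$ for $x\ge0$, $\;M(a)=-B^{-1}-e^{aB}(aI_n-B^{-1})$, and $m_a(y)=\vec\beta e^{yB}M(a)\mathbf 1$ for $y\ge 0$. For all $x\ge0$, $$G_a(x)=\vec C(x)M(a)\mathbf 1,\qquad R_a(x)=\vec C(x)e^{aB}\mathbf 1 .$$ The row vector $\vec u=\lambda\,(c-q/\Phi_q)^{-1}\int_0^\infty e^{-\Phi_q z}\,\vec\beta e^{zB}\,dz$ satisfies $\vec u\,\mathbf 1=1$, and there are row-vector functions $\vec\Psi_q$ and $\vec Z_q=\vec\Psi_q+W_q\frac q{\Phi_q}\vec u$ such that for all $x,y\ge 0$ $$\Psi_q(x,y)=\vec\Psi_q(x)e^{yB}\mathbf 1,\qquad Z_q(x)=\vec Z_q(x)\mathbf 1,$$ $$\vec C(x)=c\,W_q(x)\,\vec u-\vec Z_q(x)=\Big(c-\frac q{\Phi_q}\Big)W_q(x)\,\vec u-\vec\Psi_q(x).$$ 2. On $[0,\infty)$, $W_q$ is continuously differentiable and $\vec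 C$ is twice continuously differentiable. For every starting reserve, the discounted dividends and injections are a.s. finite and the discounted profit is integrable, and $$J_x=\begin{cases}k\,G_a(x)+J_0\,S_a(x)=k\,G_a(x)+\dfrac{1-k\,G_a'(b)}{S_a'(b)}\,S_a(x),&x\in[0,b],\\[2mm] kx+J_0,&x\in[-a,0],\\ 0,&x<-a,\end{cases}$$ where $S_a'(b)=qW_q(b)+\vec C'(b)e^{aB}\mathbf 1>0$ and $$J_0=\frac{1-k\,\vec C'(b)M(a)\mathbf 1}{q\,W_q(b)+\vec C'(b)e^{aB}\mathbf 1}.$$ 3. For fixed $a$, the function $b\mapsto J_0^{a,b}$ is differentiable on $[0,\infty)$, and for every $b\ge 0$ $$\frac{\partial}{\partial b}J_0^{a,b}=0\iff J_0^{a,b}\,\big(q\,W_q'(b)+\vec C''(b)e^{aB}\mathbf 1\big)=-k\,\vec C''(b)M(a)\mathbf 1 ;$$ that is, whenever $q\,W_q'(b)+\vec C''(b)e^{aB}\mathbf 1\ne0$, $$\frac{\partial}{\partial b}J_0^{a,b}=0\iff J_0^{a,b}=\frac{-k\,\vec C''(b)M(a)\mathbf 1}{q\,W_q'(b)+\vec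 C''(b)e^{aB}\mathbf 1}.$$ -/

import Mathlib

open Set Filter Topology MeasureTheory ProbabilityTheory
open scoped Matrix

noncomputable section

/-- Parameters of a discounted Cramér–Lundberg model with matrix-exponential claims:
premium rate `c`, claim arrival rate `lam`, discount rate `q`, and the row vector `β` and the
matrix `B` that generate the claim density. -/
structure RiskModel (n : ℕ) where
  c : ℝ
  lam : ℝ
  q : ℝ
  β : Fin n → ℝ
  B : Matrix (Fin n) (Fin n) ℝ

namespace RiskModel

variable {n : ℕ}

/-- The matrix exponential `e^{xB}`. -/
def expB (m : RiskModel n) (x : ℝ) : Matrix (Fin n) (Fin n) ℝ :=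
  NormedSpace.exp (x • m.B)

/-- The claim density `f(z) = β e^{zB} (-B) 1`, for `z > 0`. -/
def claimDensity (m : RiskModel n) (z : ℝ) : ℝ :=
  m.β ⬝ᵥ (m.expB z *ᵥ ((-m.B) *ᵥ 1))

/-- Standing assumptions on the parameters: `β` has total mass `1`, `B` is invertible, `β e^{xB}`
tends componentwise to `0`, and the function `f` above is nonnegative, so that it is a probability
density with the survival function `β e^{xB} 1`. If `β e^{xB}` decreases componentwise to `0`, then
`-β e^{xB} B` is componentwise nonnegative and the last condition holds; it also covers the
phase-type laws for which some component of `β e^{xB}` is not monotone (Erlang, for example). -/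
structure Admissible (m : RiskModel n) : Prop where
  c_pos : 0 < m.c
  lam_pos : 0 < m.lam
  q_pos : 0 < m.q
  β_sum : m.β ⬝ᵥ 1 = 1
  B_unit : IsUnit m.B
  tendsto_zero : ∀ i, Tendsto (fun x : ℝ => (m.β ᵥ* m.expB x) i) atTop (𝓝 0)
  density_nonneg : ∀ x, 0 ≤ x → 0 ≤ m.claimDensity x

/-! ### Claim law and scale functions -/

/-- The claim distribution. -/
def claimLaw (m : RiskModel n) : Measure ℝ :=
  (volume.restrict (Ioi (0 : ℝ))).withDensity (fun z => ENNReal.ofReal (m.claimDensity z))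

/-- The survival function of the claims. -/
def survival (m : RiskModel n) (x : ℝ) : ℝ := m.claimLaw.real (Ioi x)

/-- The Laplace exponent `κ(s) = c s + λ ∫ (e^{-sz} - 1) F(dz)` of `X`, for `s ≥ 0`. -/
def laplaceExponent (m : RiskModel n) (s : ℝ) : ℝ :=
  m.c * s + m.lam * ∫ z, (Real.exp (-s * z) - 1) ∂m.claimLaw

/-- `Φ_q`, the largest nonnegative root of `κ(s) = q`. -/
def bigPhi (m : RiskModel n) : ℝ := sSup {s : ℝ | 0 ≤ s ∧ m.laplaceExponent s = m.q}

/-- `W` is the `q`-scale function: it vanishes on the negative half-line, is continuous on the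
nonnegative one, and has Laplace transform `1 / (κ(s) - q)` for `s > Φ_q`. -/
structure IsScaleFunction (m : RiskModel n) (W : ℝ → ℝ) : Prop where
  neg : ∀ x < 0, W x = 0
  cont : ContinuousOn W (Ici 0)
  integrable : ∀ s > m.bigPhi,
    IntegrableOn (fun x : ℝ => Real.exp (-s * x) * W x) (Ioi (0 : ℝ))
  laplace : ∀ s > m.bigPhi,
    ∫ x in Ioi (0 : ℝ), Real.exp (-s * x) * W x = 1 / (m.laplaceExponent s - m.q)

/-- The `q`-scale function `W_q`. -/
def W (m : RiskModel n) : ℝ → ℝ := Classical.epsilon m.IsScaleFunction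

/-- `Z_q(x) = 1 + q ∫₀ˣ W_q(y) dy`. -/
def Z (m : RiskModel n) (x : ℝ) : ℝ := 1 + m.q * ∫ y in (0 : ℝ)..x, m.W y

/-- `m_a(y) = ∫₀ᵃ z f(y+z) dz`. -/
def partialMean (m : RiskModel n) (a y : ℝ) : ℝ :=
  ∫ z in (0 : ℝ)..a, z * m.claimDensity (y + z)

/-- `S_a(x) = Z_q(x) + λ ∫₀ˣ W_q(x-y) F̄(a+y) dy`. -/
def S (m : RiskModel n) (a x : ℝ) : ℝ :=
  m.Z x + m.lam * ∫ y in (0 : ℝ)..x, m.W (x - y) * m.survival (a + y)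

/-- `G_a(x) = λ ∫₀ˣ W_q(x-y) m_a(y) dy`. -/
def G (m : RiskModel n) (a x : ℝ) : ℝ :=
  m.lam * ∫ y in (0 : ℝ)..x, m.W (x - y) * m.partialMean a y

/-! ### Matrix quantities -/

/-- The matrix `C(x) = λ ∫₀ˣ W_q(x-y) e^{yB} dy`, entry by entry. -/
def matC (m : RiskModel n) (x : ℝ) : Matrix (Fin n) (Fin n) ℝ :=
  Matrix.of fun i j => m.lam * ∫ y in (0 : ℝ)..x, m.W (x - y) * m.expB y i j

/-- The row vector `C⃗(x) = β C(x)`. -/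
def vecC (m : RiskModel n) (x : ℝ) : Fin n → ℝ := m.β ᵥ* m.matC x

/-- First derivative of `C⃗` on `[0, ∞)` (the right derivative at `0`). -/
def vecC' (m : RiskModel n) (x : ℝ) : Fin n → ℝ := derivWithin m.vecC (Ici 0) x

/-- Second derivative of `C⃗` on `[0, ∞)` (the right derivative at `0`). -/
def vecC'' (m : RiskModel n) (x : ℝ) : Fin n → ℝ := derivWithin m.vecC' (Ici 0) x

/-- Derivative of `W_q` on `[0, ∞)` (the right derivative at `0`). -/
def W' (m : RiskModel n) (x : ℝ) : ℝ := derivWithin m.W (Ici 0) x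

/-- The matrix `M(a) = ∫₀ᵃ z e^{zB} (-B) dz`, entry by entry. -/
def matM (m : RiskModel n) (a : ℝ) : Matrix (Fin n) (Fin n) ℝ :=
  Matrix.of fun i j => ∫ z in (0 : ℝ)..a, z * (m.expB z * (-m.B)) i j

/-- The row vector `u = λ (c - q/Φ_q)⁻¹ ∫₀^∞ e^{-Φ_q z} β e^{zB} dz`. -/
def vecU (m : RiskModel n) : Fin n → ℝ := fun i =>
  m.lam / (m.c - m.q / m.bigPhi) *
    ∫ z in Ioi (0 : ℝ), Real.exp (-m.bigPhi * z) * (m.β ᵥ* m.expB z) i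

/-! ### The surplus process -/

variable {Ω : Type*} [MeasurableSpace Ω]

/-- `τ i` is the time between the claims number `i` and `i + 1`, and `ξ i` is the size of the
claim number `i + 1`: all independent, the former exponential with rate `λ` (so that claims
arrive along a Poisson process), the latter with the claim law. -/
structure IsClaimModel (m : RiskModel n) (P : Measure Ω) (τ ξ : ℕ → Ω → ℝ) : Prop where
  measurable_τ : ∀ i, Measurable (τ i)
  measurable_ξ : ∀ i, Measurable (ξ i)
  law_τ : ∀ i, P.map (τ i) = expMeasure m.lam
  law_ξ : ∀ i, P.map (ξ i) = m.claimLaw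
  indep : iIndepFun (Sum.elim τ ξ) P

/-- Arrival time of the claim number `j` (and `0` for `j = 0`). -/
def arrival (τ : ℕ → Ω → ℝ) (j : ℕ) (ω : Ω) : ℝ := ∑ i ∈ Finset.range j, τ i ω

/-- The uncontrolled surplus `X_t = x + c t - ∑_{i ≤ N_t} ξ_i`. -/
def surplus (m : RiskModel n) (τ ξ : ℕ → Ω → ℝ) (x t : ℝ) (ω : Ω) : ℝ :=
  x + m.c * t - ∑' j : ℕ, {s : ℝ | arrival τ (j + 1) ω ≤ s}.indicator (fun _ => ξ j ω) t

/-- The ruin time `inf {t ≥ 0 : X_t < 0}` (used only where that set is non-empty). -/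
def ruinTime (m : RiskModel n) (τ ξ : ℕ → Ω → ℝ) (x : ℝ) (ω : Ω) : ℝ :=
  sInf {t : ℝ | 0 ≤ t ∧ m.surplus τ ξ x t ω < 0}

/-- `Ψ_q(x, y) = E_x[e^{-q T}; T < ∞, X_T < -y]` with `T` the ruin time of the uncontrolled
surplus. -/
def ruinTransform (m : RiskModel n) (P : Measure Ω) (τ ξ : ℕ → Ω → ℝ) (x y : ℝ) : ℝ :=
  ∫ ω, {ω' : Ω | (∃ t : ℝ, 0 ≤ t ∧ m.surplus τ ξ x t ω' < 0) ∧
      m.surplus τ ξ x (m.ruinTime τ ξ x ω') ω' < -y}.indicator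
    (fun ω' => Real.exp (-m.q * m.ruinTime τ ξ x ω')) ω ∂P

/-! ### `(-a, 0, b)` policies

At time `0` and at every claim, a level in `[-a, 0)` is lifted to `0` by a capital injection and a
level below `-a` is bankruptcy. A level above `b` (possible at time `0` only) is brought down to
`b` by a lump dividend. Between claims the reserve grows at rate `c` until it reaches `b`, where it
is kept by paying out dividends at rate `c`. -/

/-- The level found at time `0` (for `j = 0`) or just after the claim number `j`, before the
injection or lump dividend of that instant, under the rule above (continued after bankruptcy as if
every deficit were still covered). -/
def level (m : RiskModel n) (b : ℝ) (τ ξ : ℕ → Ω → ℝ) (x : ℝ) : ℕ → Ω → ℝ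
  | 0, _ => x
  | j + 1, ω => min b (max 0 (min b (level m b τ ξ x j ω)) + m.c * τ j ω) - ξ j ω

/-- The reserve right after the intervention at the claim number `j` (or at time `0`). -/
def reserve (m : RiskModel n) (b : ℝ) (τ ξ : ℕ → Ω → ℝ) (x : ℝ) (j : ℕ) (ω : Ω) : ℝ :=
  max 0 (min b (m.level b τ ξ x j ω))

/-- No bankruptcy has occurred up to and including the claim number `j`. -/
def Alive (m : RiskModel n) (a b : ℝ) (τ ξ : ℕ → Ω → ℝ) (x : ℝ) (j : ℕ) (ω : Ω) : Prop :=
  ∀ i ≤ j, -a ≤ m.level b τ ξ x i ω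

/-- The times before bankruptcy at which the controlled reserve is at the barrier `b`. -/
def barrierTimes (m : RiskModel n) (a b : ℝ) (τ ξ : ℕ → Ω → ℝ) (x : ℝ) (ω : Ω) : Set ℝ :=
  {t | ∃ j, m.Alive a b τ ξ x j ω ∧ arrival τ j ω ≤ t ∧ t < arrival τ (j + 1) ω ∧
    min b (m.reserve b τ ξ x j ω + m.c * (t - arrival τ j ω)) = b}

open Classical in
/-- The random measure `dD_t` of dividend payments until bankruptcy. -/
def dividends (m : RiskModel n) (a b : ℝ) (τ ξ : ℕ → Ω → ℝ) (x : ℝ) (ω : Ω) : Measure ℝ :=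
  (if -a ≤ x then ENNReal.ofReal (x - b) • Measure.dirac 0 else 0) +
    ENNReal.ofReal m.c • volume.restrict (m.barrierTimes a b τ ξ x ω)

open Classical in
/-- The random measure `dI_t` of capital injections until bankruptcy. -/
def injections (m : RiskModel n) (a b : ℝ) (τ ξ : ℕ → Ω → ℝ) (x : ℝ) (ω : Ω) : Measure ℝ :=
  Measure.sum fun j : ℕ =>
    if m.Alive a b τ ξ x j ω then
      ENNReal.ofReal (-m.level b τ ξ x j ω) • Measure.dirac (arrival τ j ω)
    else 0

/-- The discounted profit `∫ e^{-qt} (dD_t - k dI_t)` until bankruptcy. -/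
def profit (m : RiskModel n) (k a b : ℝ) (τ ξ : ℕ → Ω → ℝ) (x : ℝ) (ω : Ω) : ℝ :=
  (∫ t, Real.exp (-m.q * t) ∂(m.dividends a b τ ξ x ω)) -
    k * ∫ t, Real.exp (-m.q * t) ∂(m.injections a b τ ξ x ω)

/-- The value `J_x^{a,b}` of the `(-a, 0, b)` policy started from the reserve `x`. -/
def J (m : RiskModel n) (P : Measure Ω) (τ ξ : ℕ → Ω → ℝ) (k a b x : ℝ) : ℝ :=
  ∫ ω, m.profit k a b τ ξ x ω ∂P

end RiskModel

end

/-! Analytic part. The scale function should solve `c w' = (λ+q) w - λ (f * w)` with `w(0) = 1/c`.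
Since `f(z) = β e^{zB}(-B)1`, the convolution is `f * w = -v·(B1)`, where `v(x) = ∫₀ˣ w(x-y) β
e^{yB} dy` satisfies `v' = w β + v B`. So `(w, v)` solves a linear system with constant
coefficients. Taking the matrix exponential of that system as the definition (`scaleFun`,
`scaleVec`) gives smoothness at once, and `C⃗ = λ v`. The integrated form `c w = 1 + w * (q + λ F̄)`
has a nonnegative kernel. It yields `w > 0` and, after the tilt by `e^{-Φx}`, that `e^{-Φx} w(x)` is
nondecreasing (`tiltedScale_deriv_nonneg`) and at most `Φ/q` (`tiltedScale_le`). Hence the Laplace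
transform converges for `s > Φ` and equals `1/(κ(s)-q)`. Uniqueness of Laplace transforms of
continuous functions then identifies `W_q` with `w` on `[0, ∞)` (`W_eq_scaleFun`), and the matrix
identities become linear algebra. Probabilistic part. Observed at claim epochs, both the surplus
until ruin and the controlled reserve are Markov chains driven by the i.i.d. pairs (waiting time,
claim). Because `E e^{-qT_j} = (λ/(λ+q))^j`, a bounded function `H` that satisfies the one-step
equation equals the expected discounted sum of rewards: the expectations telescope and the remainder
vanishes (`integral_tsum_discounted_rewards`). It remains to solve two one-step equations. Functions
built from `w`, `v` and `Z` satisfy `c V' = (λ+q) V - λ (f * V + source)`, which makes the integrand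
over the first waiting time the derivative of `-e^{-(λ+q)t} V(x+ct)`. For ruin, the combination of
`w` and `v` with values in `[0,1]` is `Ψ_q` (`ruin_one_step`). For the policy, `V = k G_a + J_0
S_a`, with `J_0` fixed by `V'(b) = 1`, which accounts for the dividends paid at the barrier
(`policy_one_step`). The optimality equation in `b` is the quotient rule applied to `J_0`, whose
denominator `S_a'(b)` is positive. -/

noncomputable section
namespace RiskModel

variable {n : ℕ}

/-! ### The matrix exponential, the functions `β e^{xB} w`, and the claim law. -/

section Exponential

attribute [local instance] Matrix.linftyOpNormedRing Matrix.linftyOpNormedAlgebra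
  Matrix.linftyOpNormedAddCommGroup Matrix.linftyOpNormedSpace

theorem expB_hasDerivAt (m : RiskModel n) (x : ℝ) :
    HasDerivAt m.expB (m.expB x * m.B) x :=
  hasDerivAt_exp_smul_const m.B x

theorem expB_hasDerivAt' (m : RiskModel n) (x : ℝ) :
    HasDerivAt m.expB (m.B * m.expB x) x :=
  hasDerivAt_exp_smul_const' m.B x

theorem expB_apply_hasDerivAt (m : RiskModel n) (i j : Fin n) (x : ℝ) :
    HasDerivAt (fun x => m.expB x i j) ((m.expB x * m.B) i j) x := by
  have h := m.expB_hasDerivAt x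
  let L : Matrix (Fin n) (Fin n) ℝ →ₗ[ℝ] ℝ :=
    { toFun := fun A => A i j, map_add' := fun _ _ => rfl, map_smul' := fun _ _ => rfl }
  exact (LinearMap.toContinuousLinearMap L).hasFDerivAt.comp_hasDerivAt x h

/-- Both sides are the derivative of `e^{xB}`. -/
theorem B_mul_expB (m : RiskModel n) (x : ℝ) : m.B * m.expB x = m.expB x * m.B :=
  (m.expB_hasDerivAt' x).unique (m.expB_hasDerivAt x)

end Exponential

theorem expB_zero (m : RiskModel n) : m.expB 0 = 1 := by
  simp [expB]

theorem expB_add (m : RiskModel n) (x y : ℝ) : m.expB (x + y) = m.expB x * m.expB y := by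
  rw [expB, add_smul, Matrix.exp_add_of_commute]
  · rfl
  · exact ((Commute.refl m.B).smul_left x).smul_right y

/-- The scalar function `x ↦ β e^{xB} w`. -/
def expTail (m : RiskModel n) (w : Fin n → ℝ) (x : ℝ) : ℝ := m.β ⬝ᵥ (m.expB x *ᵥ w)

theorem claimDensity_eq (m : RiskModel n) : m.claimDensity = m.expTail ((-m.B) *ᵥ 1) := rfl

theorem expTail_eq_sum (m : RiskModel n) (w : Fin n → ℝ) (x : ℝ) :
    m.expTail w x = ∑ i, (m.β ᵥ* m.expB x) i * w i := by
  rw [expTail, Matrix.dotProduct_mulVec]; rfl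

theorem expTail_hasDerivAt (m : RiskModel n) (w : Fin n → ℝ) (x : ℝ) :
    HasDerivAt (m.expTail w) (m.expTail (m.B *ᵥ w) x) x := by
  have : m.expTail (m.B *ᵥ w) x = ∑ i, m.β i * ∑ j, (m.expB x * m.B) i j * w j := by
    rw [expTail, Matrix.mulVec_mulVec]; rfl
  rw [this]
  have h2 : m.expTail w = fun x => ∑ i, m.β i * ∑ j, m.expB x i j * w j := rfl
  rw [h2]
  refine HasDerivAt.fun_sum fun i _ => HasDerivAt.const_mul _ (HasDerivAt.fun_sum fun j _ => ?_)
  exact (m.expB_apply_hasDerivAt i j x).mul_const _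

@[fun_prop]
theorem expTail_continuous (m : RiskModel n) (w : Fin n → ℝ) : Continuous (m.expTail w) :=
  continuous_iff_continuousAt.2 fun x => (m.expTail_hasDerivAt w x).continuousAt

theorem expTail_shift (m : RiskModel n) (w : Fin n → ℝ) (x y : ℝ) :
    m.expTail w (x + y) = m.expTail (m.expB y *ᵥ w) x := by
  rw [expTail, expTail, expB_add, Matrix.mulVec_mulVec]

theorem expTail_zero (m : RiskModel n) (w : Fin n → ℝ) : m.expTail w 0 = m.β ⬝ᵥ w := by
  rw [expTail, expB_zero, Matrix.one_mulVec]

theorem expTail_neg (m : RiskModel n) (w : Fin n → ℝ) (x : ℝ) :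
    m.expTail (-w) x = - m.expTail w x := by
  simp [expTail, Matrix.mulVec_neg]

theorem expTail_sub (m : RiskModel n) (w v : Fin n → ℝ) (x : ℝ) :
    m.expTail (w - v) x = m.expTail w x - m.expTail v x := by
  simp [expTail, Matrix.mulVec_sub]

namespace Admissible

variable {m : RiskModel n}

theorem expTail_tendsto (hm : m.Admissible) (w : Fin n → ℝ) :
    Tendsto (m.expTail w) atTop (𝓝 0) := by
  have h2 : m.expTail w = fun x => ∑ i, (m.β ᵥ* m.expB x) i * w i :=
    funext fun x => m.expTail_eq_sum w x
  rw [h2]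
  have := tendsto_finsetSum (s := Finset.univ) (f := fun i (x : ℝ) => (m.β ᵥ* m.expB x) i * w i)
    (a := fun i => 0 * w i) (x := atTop) fun i _ => (hm.tendsto_zero i).mul_const (w i)
  simpa using this

theorem expTail_bounded (hm : m.Admissible) (w : Fin n → ℝ) :
    ∃ K, 0 ≤ K ∧ ∀ x, 0 ≤ x → |m.expTail w x| ≤ K := by
  have h := hm.expTail_tendsto w
  obtain ⟨A, hA⟩ := (Metric.tendsto_atTop.1 h) 1 one_pos
  obtain ⟨K, hK⟩ := (isCompact_Icc (a := (0 : ℝ)) (b := A)).exists_bound_of_continuousOn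
    (m.expTail_continuous w).continuousOn
  refine ⟨max K 1, le_max_of_le_right zero_le_one, fun x hx => ?_⟩
  rcases le_total x A with h1 | h1
  · exact (hK x ⟨hx, h1⟩).trans (le_max_left _ _)
  · have := hA x h1
    rw [Real.dist_eq, sub_zero] at this
    exact this.le.trans (le_max_right _ _)

theorem expTail_one_hasDerivAt (_ : m.Admissible) (x : ℝ) :
    HasDerivAt (m.expTail 1) (-m.claimDensity x) x := by
  have := m.expTail_hasDerivAt 1 x
  rwa [claimDensity_eq, Matrix.neg_mulVec, expTail_neg, neg_neg]

theorem claimDensity_continuous (_ : m.Admissible) : Continuous m.claimDensity := by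
  rw [claimDensity_eq]; fun_prop

theorem expTail_one_zero (hm : m.Admissible) : m.expTail 1 0 = 1 := by
  rw [expTail_zero, hm.β_sum]

/-- The antiderivative `-expTail 1` has a limit at infinity and the density is nonnegative; no decay
rate of `β e^{xB}` is needed. -/
theorem integrableOn_density (hm : m.Admissible) {x : ℝ} (hx : 0 ≤ x) :
    IntegrableOn m.claimDensity (Ioi x) := by
  refine integrableOn_Ioi_deriv_of_nonneg' (g := fun y => -m.expTail 1 y) (l := -0) ?_ ?_ ?_
  · intro y _
    simpa using (hm.expTail_one_hasDerivAt y).fun_neg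
  · intro y hy; exact hm.density_nonneg y (hx.trans hy.le)
  · exact (hm.expTail_tendsto 1).neg

theorem integral_density (hm : m.Admissible) {x : ℝ} (hx : 0 ≤ x) :
    ∫ y in Ioi x, m.claimDensity y = m.expTail 1 x := by
  have := integral_Ioi_of_hasDerivAt_of_nonneg' (g := fun y => -m.expTail 1 y) (l := -0)
    (g' := m.claimDensity) (a := x) ?_ ?_ ?_
  · simpa using this
  · intro y _
    simpa using (hm.expTail_one_hasDerivAt y).fun_neg
  · intro y hy; exact hm.density_nonneg y (hx.trans hy.le)
  · exact (hm.expTail_tendsto 1).neg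

theorem expTail_one_nonneg (hm : m.Admissible) {x : ℝ} (hx : 0 ≤ x) : 0 ≤ m.expTail 1 x := by
  rw [← hm.integral_density hx]
  exact setIntegral_nonneg measurableSet_Ioi fun y hy => hm.density_nonneg y (hx.trans hy.le)

theorem expTail_one_antitone (hm : m.Admissible) : AntitoneOn (m.expTail 1) (Ici 0) := by
  refine antitoneOn_of_deriv_nonpos (convex_Ici 0) (m.expTail_continuous 1).continuousOn
    (fun x _ => (hm.expTail_one_hasDerivAt x).differentiableAt.differentiableWithinAt) ?_
  intro x hx
  rw [interior_Ici] at hx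
  rw [(hm.expTail_one_hasDerivAt x).deriv, neg_nonpos]
  exact hm.density_nonneg x (le_of_lt hx)

theorem density_ae_nonneg (hm : m.Admissible) {x : ℝ} (hx : 0 ≤ x) :
    0 ≤ᵐ[volume.restrict (Ioi x)] m.claimDensity :=
  (ae_restrict_iff' measurableSet_Ioi).2 (.of_forall fun y hy =>
    hm.density_nonneg y (hx.trans (le_of_lt hy)))

theorem integral_claimLaw (hm : m.Admissible) (φ : ℝ → ℝ) :
    ∫ z, φ z ∂m.claimLaw = ∫ z in Ioi 0, m.claimDensity z * φ z := by
  rw [claimLaw, integral_withDensity_eq_integral_toReal_smul]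
  · refine setIntegral_congr_fun measurableSet_Ioi fun z hz => ?_
    simp only [smul_eq_mul]
    rw [ENNReal.toReal_ofReal (hm.density_nonneg z (le_of_lt hz))]
  · exact hm.claimDensity_continuous.measurable.ennreal_ofReal
  · simp

theorem isProbabilityMeasure_claimLaw (hm : m.Admissible) : IsProbabilityMeasure m.claimLaw := by
  constructor
  rw [claimLaw, withDensity_apply _ MeasurableSet.univ, Measure.restrict_univ,
    ← ofReal_integral_eq_lintegral_ofReal (hm.integrableOn_density le_rfl)
      (hm.density_ae_nonneg le_rfl), hm.integral_density le_rfl, hm.expTail_one_zero,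
    ENNReal.ofReal_one]

theorem claimLaw_ae_pos (_ : m.Admissible) : ∀ᵐ z ∂m.claimLaw, 0 < z := by
  rw [claimLaw]
  exact (withDensity_absolutelyContinuous _ _).ae_le (ae_restrict_mem measurableSet_Ioi)

theorem survival_eq (hm : m.Admissible) {x : ℝ} (hx : 0 ≤ x) :
    m.survival x = m.expTail 1 x := by
  rw [survival, measureReal_def, claimLaw, withDensity_apply _ measurableSet_Ioi,
    Measure.restrict_restrict measurableSet_Ioi, Ioi_inter_Ioi, sup_of_le_left hx,
    ← ofReal_integral_eq_lintegral_ofReal (hm.integrableOn_density hx)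
      (hm.density_ae_nonneg hx), hm.integral_density hx,
    ENNReal.toReal_ofReal (hm.expTail_one_nonneg hx)]

end Admissible

end RiskModel


/-! ### Convolution on the half-line. -/

/-- Convolution `∫₀ˣ f(x-y) g(y) dy` of functions on the half-line. -/
def halfConv (f g : ℝ → ℝ) (x : ℝ) : ℝ := ∫ y in (0 : ℝ)..x, f (x - y) * g y

theorem halfConv_comm (f g : ℝ → ℝ) (x : ℝ) : halfConv f g x = halfConv g f x := by
  have := intervalIntegral.integral_comp_sub_left (fun y => f y * g (x - y)) x (a := 0) (b := x)
  simp only [sub_self, sub_zero, sub_sub_cancel] at this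
  rw [halfConv, halfConv, this]
  simp_rw [mul_comm]

/-- Fubini on the square `(0,x]²` for `φ` times the indicator of the triangle `y ≤ u`; integrability
comes from continuity on the compact square. -/
theorem integral_triangle_swap {φ : ℝ → ℝ → ℝ} (hφ : Continuous (Function.uncurry φ)) {x : ℝ}
    (hx : 0 ≤ x) :
    ∫ u in (0 : ℝ)..x, ∫ y in (0 : ℝ)..u, φ u y = ∫ y in (0 : ℝ)..x, ∫ u in y..x, φ u y := by
  set ψ : ℝ → ℝ → ℝ := fun u y => {p : ℝ × ℝ | p.2 ≤ p.1}.indicator (Function.uncurry φ) (u, y)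
    with hψ
  have h1 : ∫ u in (0 : ℝ)..x, ∫ y in (0 : ℝ)..u, φ u y =
      ∫ u in Ioc 0 x, ∫ y in Ioc 0 x, ψ u y := by
    rw [intervalIntegral.integral_of_le hx]
    refine setIntegral_congr_fun measurableSet_Ioc fun u hu => ?_
    rw [intervalIntegral.integral_of_le hu.1.le, ← integral_indicator measurableSet_Ioc,
      ← integral_indicator measurableSet_Ioc]
    congr 1
    ext y
    simp only [indicator, hψ, mem_Ioc, mem_ofPred_eq, Function.uncurry]
    by_cases h0 : 0 < y <;> by_cases h2 : y ≤ u
    · simp [h0, h2, h2.trans hu.2]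
    · simp [h2]
    · simp [h0]
    · simp [h0]
  have h2 : ∫ y in (0 : ℝ)..x, ∫ u in y..x, φ u y =
      ∫ y in Ioc 0 x, ∫ u in Ioc 0 x, ψ u y := by
    rw [intervalIntegral.integral_of_le hx]
    refine setIntegral_congr_fun measurableSet_Ioc fun y hy => ?_
    rw [intervalIntegral.integral_of_le hy.2, ← integral_Icc_eq_integral_Ioc,
      ← integral_indicator measurableSet_Icc,
      ← integral_indicator measurableSet_Ioc]
    congr 1
    ext u
    simp only [indicator, hψ, mem_Ioc, mem_Icc, mem_ofPred_eq, Function.uncurry]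
    by_cases h2 : y ≤ u <;> by_cases h0 : u ≤ x
    · simp [h0, h2, hy.1.trans_le h2]
    · simp [h0]
    · simp [h2]
    · simp [h2]
  rw [h1, h2]
  refine integral_integral_swap ?_
  have hmeas : MeasurableSet {p : ℝ × ℝ | p.2 ≤ p.1} :=
    measurableSet_le measurable_snd measurable_fst
  have : Function.uncurry ψ = {p : ℝ × ℝ | p.2 ≤ p.1}.indicator (Function.uncurry φ) := by
    ext p; rfl
  rw [this]
  refine Integrable.indicator ?_ hmeas
  rw [Measure.prod_restrict]
  have hK : IntegrableOn (Function.uncurry φ) (Icc 0 x ×ˢ Icc 0 x) (volume.prod volume) :=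
    hφ.continuousOn.integrableOn_compact (isCompact_Icc.prod isCompact_Icc)
  exact hK.mono_set (prod_mono Ioc_subset_Icc_self Ioc_subset_Icc_self)

theorem halfConv_assoc {f g h : ℝ → ℝ} (hf : Continuous f) (hg : Continuous g)
    (hh : Continuous h) {x : ℝ} (hx : 0 ≤ x) :
    halfConv (halfConv f g) h x = halfConv f (halfConv g h) x := by
  have h1 : halfConv f (halfConv g h) x =
      ∫ u in (0 : ℝ)..x, ∫ y in (0 : ℝ)..u, f (x - u) * (g (u - y) * h y) := by
    simp only [halfConv, intervalIntegral.integral_const_mul]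
  rw [h1, integral_triangle_swap (by unfold Function.uncurry; fun_prop) hx]
  unfold halfConv
  congr 1
  ext y
  rw [← intervalIntegral.integral_mul_const]
  have := intervalIntegral.integral_comp_sub_right
    (fun z => f (x - y - z) * g z * h y) y (a := y) (b := x)
  rw [sub_self] at this
  rw [← this]
  congr 1
  ext u
  rw [show x - y - (u - y) = x - u by ring]
  ring

theorem halfConv_add_right {f g h : ℝ → ℝ} (hf : Continuous f) (hg : Continuous g)
    (hh : Continuous h) (x : ℝ) :
    halfConv f (fun y => g y + h y) x = halfConv f g x + halfConv f h x := by
  unfold halfConv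
  rw [← intervalIntegral.integral_add]
  · simp_rw [mul_add]
  · exact Continuous.intervalIntegrable (by fun_prop) _ _
  · exact Continuous.intervalIntegrable (by fun_prop) _ _

theorem halfConv_const_mul_right (f g : ℝ → ℝ) (r x : ℝ) :
    halfConv f (fun y => r * g y) x = r * halfConv f g x := by
  unfold halfConv
  rw [← intervalIntegral.integral_const_mul]
  congr 1; ext y; ring

theorem halfConv_const_mul_left (f g : ℝ → ℝ) (r x : ℝ) :
    halfConv (fun y => r * f y) g x = r * halfConv f g x := by
  rw [halfConv_comm, halfConv_const_mul_right, halfConv_comm]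

theorem halfConv_congr {f g f' g' : ℝ → ℝ} {x : ℝ} (hx : 0 ≤ x) (hf : ∀ y ∈ Icc 0 x, f y = f' y)
    (hg : ∀ y ∈ Icc 0 x, g y = g' y) : halfConv f g x = halfConv f' g' x := by
  unfold halfConv
  refine intervalIntegral.integral_congr fun y hy => ?_
  rw [uIcc_of_le hx] at hy
  rw [hg y hy, hf (x - y) ⟨by linarith [hy.2], by linarith [hy.1]⟩]

theorem halfConv_nonneg {f g : ℝ → ℝ} {x : ℝ} (hx : 0 ≤ x) (hf : ∀ y ∈ Ico 0 x, 0 ≤ f y)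
    (hg : ∀ y ∈ Ioc 0 x, 0 ≤ g y) : 0 ≤ halfConv f g x := by
  unfold halfConv
  rw [intervalIntegral.integral_of_le hx]
  refine setIntegral_nonneg measurableSet_Ioc fun y hy => ?_
  exact mul_nonneg (hf _ ⟨by linarith [hy.2], by linarith [hy.1]⟩) (hg y hy)

/-- A continuous function that is positive wherever it is positive at all earlier points. -/
theorem pos_of_pos_before {f : ℝ → ℝ} (hf : Continuous f)
    (h : ∀ x, 0 ≤ x → (∀ y ∈ Ico 0 x, 0 < f y) → 0 < f x) {x : ℝ} (hx : 0 ≤ x) : 0 < f x := by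
  by_contra hneg
  -- The set of bad points is closed, so it contains its infimum; all earlier points are good, which
  -- contradicts `h` there.
  set s : Set ℝ := Ici 0 ∩ {y | f y ≤ 0}
  have hs : IsClosed s := isClosed_Ici.inter (isClosed_le hf continuous_const)
  have hne : s.Nonempty := ⟨x, hx, not_lt.1 hneg⟩
  have hbd : BddBelow s := ⟨0, fun y hy => hy.1⟩
  have hmem := hs.csInf_mem hne hbd
  refine absurd (h (sInf s) hmem.1 fun y hy => ?_) (not_lt.2 hmem.2)
  by_contra hy'
  exact absurd (csInf_le hbd (⟨hy.1, not_lt.1 hy'⟩ : y ∈ s)) (not_le.2 hy.2)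

/-! ### The scale function as the solution of a linear system. -/

namespace RiskModel

variable {n : ℕ}

/-- The linear system solved by the scale function `w` and by the row vector
`∫₀ˣ w(x-y) β e^{yB} dy`. -/
def scaleSystem (m : RiskModel n) : (ℝ × (Fin n → ℝ)) →L[ℝ] (ℝ × (Fin n → ℝ)) :=
  LinearMap.toContinuousLinearMap
    -- The first component is `c w' = (λ+q) w - λ (f * w)` with `f * w` replaced by `-v·(B1)`; the
    -- second is the derivative of the convolution of `w` with `β e^{yB}`.
    { toFun := fun p => (((m.lam + m.q) * p.1 + m.lam * (p.2 ⬝ᵥ (m.B *ᵥ 1))) / m.c,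
        p.1 • m.β + p.2 ᵥ* m.B)
      map_add' := fun p r => by
        ext
        · simp only [Prod.fst_add, Prod.snd_add, add_dotProduct]; ring
        · simp only [Prod.fst_add, Prod.snd_add, Matrix.add_vecMul, Pi.add_apply, Pi.smul_apply,
            smul_eq_mul]; ring
      map_smul' := fun r p => by
        ext
        · simp only [Prod.smul_fst, Prod.smul_snd, smul_dotProduct, smul_eq_mul,
            RingHom.id_apply]; ring
        · simp only [Prod.smul_fst, Prod.smul_snd, Matrix.smul_vecMul, Pi.add_apply, Pi.smul_apply,
            smul_eq_mul, RingHom.id_apply]; ring }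

/-- The solution of the system `scaleSystem` that starts from `(1/c, 0)`. -/
def scaleSolution (m : RiskModel n) (x : ℝ) : ℝ × (Fin n → ℝ) :=
  NormedSpace.exp (x • m.scaleSystem) (1 / m.c, 0)

/-- A smooth function on the line that agrees with the scale function on `[0, ∞)`. -/
def scaleFun (m : RiskModel n) (x : ℝ) : ℝ := (m.scaleSolution x).1

/-- The row vector `∫₀ˣ w(x-y) β e^{yB} dy`, with `w = scaleFun`. -/
def scaleVec (m : RiskModel n) (x : ℝ) : Fin n → ℝ := (m.scaleSolution x).2

theorem scaleSolution_hasDerivAt (m : RiskModel n) (x : ℝ) :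
    HasDerivAt m.scaleSolution (m.scaleSystem (m.scaleSolution x)) x := by
  have h := hasDerivAt_exp_smul_const' (𝕂 := ℝ) m.scaleSystem x
  exact h.clm_apply (hasDerivAt_const x ((1 / m.c, 0) : ℝ × (Fin n → ℝ))) |>.congr_deriv
    (by simp [scaleSolution])

theorem scaleFun_hasDerivAt_system (m : RiskModel n) (x : ℝ) :
    HasDerivAt m.scaleFun
      (((m.lam + m.q) * m.scaleFun x + m.lam * (m.scaleVec x ⬝ᵥ (m.B *ᵥ 1))) / m.c) x :=
  (ContinuousLinearMap.fst ℝ ℝ (Fin n → ℝ)).hasFDerivAt.comp_hasDerivAt x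
    (m.scaleSolution_hasDerivAt x)

theorem scaleVec_hasDerivAt (m : RiskModel n) (x : ℝ) :
    HasDerivAt m.scaleVec (m.scaleFun x • m.β + m.scaleVec x ᵥ* m.B) x :=
  (ContinuousLinearMap.snd ℝ ℝ (Fin n → ℝ)).hasFDerivAt.comp_hasDerivAt x
    (m.scaleSolution_hasDerivAt x)

theorem scaleFun_zero (m : RiskModel n) : m.scaleFun 0 = 1 / m.c := by
  simp [scaleFun, scaleSolution]

theorem scaleVec_zero (m : RiskModel n) : m.scaleVec 0 = 0 := by
  simp [scaleVec, scaleSolution]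

@[fun_prop]
theorem scaleFun_continuous (m : RiskModel n) : Continuous m.scaleFun :=
  continuous_iff_continuousAt.2 fun x => (m.scaleFun_hasDerivAt_system x).continuousAt

theorem scaleVec_dotProduct_hasDerivAt (m : RiskModel n) (w : Fin n → ℝ) (x : ℝ) :
    HasDerivAt (fun x => m.scaleVec x ⬝ᵥ w)
      (m.scaleFun x * m.β ⬝ᵥ w + m.scaleVec x ⬝ᵥ (m.B *ᵥ w)) x := by
  have : m.scaleFun x * m.β ⬝ᵥ w + m.scaleVec x ⬝ᵥ (m.B *ᵥ w) =
      ∑ i, (m.scaleFun x • m.β + m.scaleVec x ᵥ* m.B) i * w i := by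
    rw [Matrix.dotProduct_mulVec, ← smul_eq_mul, ← smul_dotProduct, ← add_dotProduct]; rfl
  rw [this]
  exact HasDerivAt.fun_sum fun i _ =>
    ((hasDerivAt_pi.1 (m.scaleVec_hasDerivAt x)) i).mul_const (w i)

@[fun_prop]
theorem scaleVec_dotProduct_continuous (m : RiskModel n) (w : Fin n → ℝ) :
    Continuous fun x => m.scaleVec x ⬝ᵥ w :=
  continuous_iff_continuousAt.2 fun x => (m.scaleVec_dotProduct_hasDerivAt w x).continuousAt

/-- Variation of constants: in the derivative of `y ↦ v(x-y)·e^{yB}w` the two terms with `B` cancel,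
leaving `-w(x-y) β e^{yB} w`. Integrate from `0` to `x` and use `v(0) = 0`. -/
theorem scaleVec_dotProduct (m : RiskModel n) (w : Fin n → ℝ) (x : ℝ) :
    m.scaleVec x ⬝ᵥ w = halfConv m.scaleFun (m.expTail w) x := by
  have hd : ∀ y, HasDerivAt (fun y => m.scaleVec (x - y) ⬝ᵥ (m.expB y *ᵥ w))
      (-(m.scaleFun (x - y) * m.expTail w y)) y := by
    intro y
    have h1 : ∀ i, HasDerivAt (fun y => m.scaleVec (x - y) i)
        (-(m.scaleFun (x - y) • m.β + m.scaleVec (x - y) ᵥ* m.B) i) y := fun i => by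
      have h0 := (hasDerivAt_pi.1 (m.scaleVec_hasDerivAt (x - y))) i
      exact (HasDerivAt.comp_const_sub x y h0)
    have h2 : ∀ i, HasDerivAt (fun y => (m.expB y *ᵥ w) i) (((m.B * m.expB y) *ᵥ w) i) y := by
      intro i
      have : ((m.B * m.expB y) *ᵥ w) i = ∑ j, (m.expB y * m.B) i j * w j := by
        rw [B_mul_expB]; rfl
      rw [this]
      have h0 : (fun y => (m.expB y *ᵥ w) i) = fun y => ∑ j, m.expB y i j * w j := rfl
      rw [h0]
      exact HasDerivAt.fun_sum fun j _ => (m.expB_apply_hasDerivAt i j y).mul_const _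
    have h3 := HasDerivAt.fun_sum (u := Finset.univ) fun i _ => (h1 i).mul (h2 i)
    refine h3.congr_deriv ?_
    rw [Finset.sum_add_distrib]
    have e1 : ∑ i, -(m.scaleFun (x - y) • m.β + m.scaleVec (x - y) ᵥ* m.B) i * (m.expB y *ᵥ w) i
        = -((m.scaleFun (x - y) • m.β + m.scaleVec (x - y) ᵥ* m.B) ⬝ᵥ (m.expB y *ᵥ w)) := by
      simp only [dotProduct, neg_mul, Finset.sum_neg_distrib]
    have e2 : ∑ i, m.scaleVec (x - y) i * ((m.B * m.expB y) *ᵥ w) i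
        = (m.scaleVec (x - y) ᵥ* m.B) ⬝ᵥ (m.expB y *ᵥ w) := by
      rw [← Matrix.dotProduct_mulVec, Matrix.mulVec_mulVec]; rfl
    rw [e1, e2, add_dotProduct, smul_dotProduct, smul_eq_mul, expTail]
    ring
  have := intervalIntegral.integral_eq_sub_of_hasDerivAt (a := 0) (b := x) (fun y _ => hd y)
    (Continuous.intervalIntegrable (by fun_prop) _ _)
  rw [intervalIntegral.integral_neg, sub_self, sub_zero, scaleVec_zero, zero_dotProduct, expB_zero,
    Matrix.one_mulVec, zero_sub, neg_inj] at this
  exact this.symm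

/-- The smooth extension of `Z_q`. -/
def scaleZ (m : RiskModel n) (x : ℝ) : ℝ := 1 + m.q * ∫ y in (0 : ℝ)..x, m.scaleFun y

theorem scaleZ_hasDerivAt (m : RiskModel n) (x : ℝ) :
    HasDerivAt m.scaleZ (m.q * m.scaleFun x) x := by
  have := intervalIntegral.integral_hasDerivAt_right
    (m.scaleFun_continuous.intervalIntegrable 0 x)
    (m.scaleFun_continuous.stronglyMeasurableAtFilter _ _) m.scaleFun_continuous.continuousAt
  exact (this.const_mul m.q).const_add 1

theorem scaleZ_zero (m : RiskModel n) : m.scaleZ 0 = 1 := by simp [scaleZ]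

@[fun_prop]
theorem scaleZ_continuous (m : RiskModel n) : Continuous m.scaleZ :=
  continuous_iff_continuousAt.2 fun x => (m.scaleZ_hasDerivAt x).continuousAt

/-- The derivative of `scaleFun`. -/
def scaleFun' (m : RiskModel n) (x : ℝ) : ℝ :=
  ((m.lam + m.q) * m.scaleFun x + m.lam * (m.scaleVec x ⬝ᵥ (m.B *ᵥ 1))) / m.c

@[fun_prop]
theorem scaleFun'_continuous (m : RiskModel n) : Continuous m.scaleFun' := by
  unfold scaleFun'; fun_prop

theorem scaleFun_hasDerivAt (m : RiskModel n) (x : ℝ) :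
    HasDerivAt m.scaleFun (m.scaleFun' x) x := m.scaleFun_hasDerivAt_system x

namespace Admissible

variable {m : RiskModel n}

theorem scaleFun'_eq (hm : m.Admissible) (x : ℝ) :
    m.c * m.scaleFun' x =
      (m.lam + m.q) * m.scaleFun x - m.lam * halfConv m.scaleFun m.claimDensity x := by
  have hc := hm.c_pos.ne'
  rw [claimDensity_eq, ← scaleVec_dotProduct, Matrix.neg_mulVec, dotProduct_neg, scaleFun']
  field_simp
  ring

/-- Because `β·1 = 1`, the term `λ w + λ v·(B1)` of `c w'` is the derivative of `λ v·1`. Both sides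
then have equal derivatives and the value `1` at `0`. -/
theorem c_mul_scaleFun (hm : m.Admissible) (x : ℝ) :
    m.c * m.scaleFun x = m.scaleZ x + m.lam * (m.scaleVec x ⬝ᵥ 1) := by
  have hc := hm.c_pos.ne'
  set d : ℝ → ℝ := fun x => m.c * m.scaleFun x - (m.scaleZ x + m.lam * (m.scaleVec x ⬝ᵥ 1))
  have hd : ∀ x, HasDerivAt d 0 x := by
    intro x
    refine (((m.scaleFun_hasDerivAt x).const_mul m.c).sub ((m.scaleZ_hasDerivAt x).add
      ((m.scaleVec_dotProduct_hasDerivAt 1 x).const_mul m.lam))).congr_deriv ?_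
    rw [hm.β_sum, scaleFun']
    field_simp
    ring
  have := is_const_of_deriv_eq_zero (fun x => (hd x).differentiableAt) (fun x => (hd x).deriv) x 0
  simp only [d, scaleFun_zero, scaleZ_zero, scaleVec_zero, zero_dotProduct, mul_zero, add_zero,
    mul_one_div_cancel hc, sub_self] at this
  linarith

/-- `c w = 1 + q ∫ w + λ F̄ * w`. -/
theorem c_mul_scaleFun_eq_halfConv (hm : m.Admissible) (x : ℝ) :
    m.c * m.scaleFun x =
      1 + halfConv m.scaleFun (fun y => m.q + m.lam * m.expTail 1 y) x := by
  rw [hm.c_mul_scaleFun, scaleVec_dotProduct, halfConv_add_right (by fun_prop) (by fun_prop)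
    (by fun_prop), halfConv_const_mul_right, scaleZ]
  have : halfConv m.scaleFun (fun _ => m.q) x = m.q * ∫ y in (0 : ℝ)..x, m.scaleFun y := by
    rw [halfConv_comm]; simp [halfConv]
  rw [this]; ring

/-- The kernel `q + λ F̄` of the renewal equation is nonnegative, so positivity before `x` forces `c
w(x) ≥ 1`. -/
theorem scaleFun_pos (hm : m.Admissible) {x : ℝ} (hx : 0 ≤ x) : 0 < m.scaleFun x := by
  refine pos_of_pos_before m.scaleFun_continuous (fun x hx h => ?_) hx
  have h1 := hm.c_mul_scaleFun_eq_halfConv x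
  have h2 : 0 ≤ halfConv m.scaleFun (fun y => m.q + m.lam * m.expTail 1 y) x :=
    halfConv_nonneg hx (fun y hy => (h y hy).le) fun y hy =>
      add_nonneg hm.q_pos.le (mul_nonneg hm.lam_pos.le (hm.expTail_one_nonneg hy.1.le))
  have : 0 < m.c * m.scaleFun x := by linarith
  exact pos_of_mul_pos_right this hm.c_pos.le

/-- Integration by parts moves the derivative from `e^{yB}` onto the scale function, with `w(0) =
1/c` as boundary value. The right-hand side is visibly nonnegative when `β e^{yB} w` and `scaleFun'`
are. -/
theorem scaleVec_deriv_ibp (_ : m.Admissible) (w : Fin n → ℝ) (x : ℝ) :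
    m.scaleFun x * m.β ⬝ᵥ w + m.scaleVec x ⬝ᵥ (m.B *ᵥ w) =
      1 / m.c * m.expTail w x + halfConv m.scaleFun' (m.expTail w) x := by
  have hd : ∀ y, HasDerivAt (fun y => m.scaleFun (x - y) * m.expTail w y)
      (-(m.scaleFun' (x - y) * m.expTail w y) + m.scaleFun (x - y) * m.expTail (m.B *ᵥ w) y) y := by
    intro y
    have h1 := HasDerivAt.comp_const_sub x y (m.scaleFun_hasDerivAt (x - y))
    refine (h1.mul (m.expTail_hasDerivAt w y)).congr_deriv ?_
    ring
  have := intervalIntegral.integral_eq_sub_of_hasDerivAt (a := 0) (b := x) (fun y _ => hd y)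
    (Continuous.intervalIntegrable (by fun_prop) _ _)
  rw [intervalIntegral.integral_add (Continuous.intervalIntegrable (by fun_prop) _ _)
    (Continuous.intervalIntegrable (by fun_prop) _ _), intervalIntegral.integral_neg, sub_self,
    sub_zero, scaleFun_zero, expTail_zero] at this
  rw [scaleVec_dotProduct]
  unfold halfConv
  linarith

/-- Insert the equation of `scaleFun'` into the form obtained by parts and reassociate the
convolution. Thus `v·w` obeys the integro-differential equation of the scale function with the extra
source `β e^{xB} w`; different choices of `w` supply the sources of the ruin and dividend problems.
-/
theorem scaleVec_renewal (hm : m.Admissible) (w : Fin n → ℝ) {x : ℝ} (hx : 0 ≤ x) :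
    m.c * (m.scaleFun x * m.β ⬝ᵥ w + m.scaleVec x ⬝ᵥ (m.B *ᵥ w)) =
      m.expTail w x + (m.lam + m.q) * (m.scaleVec x ⬝ᵥ w)
        - m.lam * halfConv m.claimDensity (fun y => m.scaleVec y ⬝ᵥ w) x := by
  have hc := hm.c_pos.ne'
  have hf := hm.claimDensity_continuous
  rw [hm.scaleVec_deriv_ibp, mul_add, ← mul_assoc, mul_one_div_cancel hc, one_mul,
    ← halfConv_const_mul_left]
  have h1 : (fun y => m.c * m.scaleFun' y) = fun y => (m.lam + m.q) * m.scaleFun y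
      + (-m.lam) * halfConv m.claimDensity m.scaleFun y := by
    ext y; rw [hm.scaleFun'_eq, halfConv_comm]; ring
  have h2 : Continuous (halfConv m.claimDensity m.scaleFun) := by
    have : halfConv m.claimDensity m.scaleFun = fun y => m.scaleVec y ⬝ᵥ ((-m.B) *ᵥ 1) := by
      ext y; rw [scaleVec_dotProduct, halfConv_comm]; rfl
    rw [this]; fun_prop
  rw [h1, halfConv_comm, halfConv_add_right (by fun_prop) (by fun_prop) (by fun_prop),
    halfConv_const_mul_right, halfConv_const_mul_right, halfConv_comm, ← scaleVec_dotProduct,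
    halfConv_comm, halfConv_assoc hf (by fun_prop) (by fun_prop) hx]
  have h3 : halfConv m.scaleFun (m.expTail w) = fun y => m.scaleVec y ⬝ᵥ w := by
    ext y; rw [scaleVec_dotProduct]
  rw [h3]; ring

end Admissible

end RiskModel

/-! ### The Laplace exponent and its root `Φ_q`. -/

namespace RiskModel

variable {n : ℕ}

namespace Admissible

variable {m : RiskModel n}

theorem integrableOn_exp_mul_expTail (hm : m.Admissible) (w : Fin n → ℝ) {s : ℝ} (hs : 0 < s) :
    IntegrableOn (fun z => Real.exp (-s * z) * m.expTail w z) (Ioi 0) := by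
  obtain ⟨K, -, hK⟩ := hm.expTail_bounded w
  refine Integrable.mono' ((exp_neg_integrableOn_Ioi 0 hs).mul_const K)
    (Continuous.aestronglyMeasurable (by fun_prop)) ?_
  refine (ae_restrict_iff' measurableSet_Ioi).2 (.of_forall fun z hz => ?_)
  rw [Real.norm_eq_abs, abs_mul, abs_of_pos (Real.exp_pos _)]
  exact mul_le_mul_of_nonneg_left (hK z (le_of_lt hz)) (Real.exp_pos _).le

/-- Integration by parts, passing from the density to the survival function. -/
theorem laplaceExponent_eq (hm : m.Admissible) {s : ℝ} (hs : 0 < s) :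
    m.laplaceExponent s =
      m.c * s - m.lam * (s * ∫ z in Ioi 0, Real.exp (-s * z) * m.expTail 1 z) := by
  have hint1 : IntegrableOn (fun z => m.claimDensity z * (Real.exp (-s * z) - 1)) (Ioi 0) := by
    have := (hm.integrableOn_exp_mul_expTail ((-m.B) *ᵥ 1) hs).sub
      (hm.integrableOn_density le_rfl)
    refine this.congr (.of_forall fun z => ?_)
    simp only [claimDensity_eq, Pi.sub_apply]; ring
  have hint2 := (hm.integrableOn_exp_mul_expTail 1 hs).const_mul s
  have hd : ∀ z ∈ Ici (0 : ℝ), HasDerivAt (fun z => -(m.expTail 1 z * (Real.exp (-s * z) - 1)))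
      (m.claimDensity z * (Real.exp (-s * z) - 1) + s * (Real.exp (-s * z) * m.expTail 1 z)) z := by
    intro z _
    have h1 : HasDerivAt (fun z => Real.exp (-s * z) - 1) (Real.exp (-s * z) * (-s)) z := by
      simpa using (((hasDerivAt_id z).const_mul (-s)).exp).sub_const 1
    refine ((hm.expTail_one_hasDerivAt z).mul h1).neg.congr_deriv ?_
    ring
  have hlim : Tendsto (fun z => -(m.expTail 1 z * (Real.exp (-s * z) - 1))) atTop (𝓝 0) := by
    have h1 : Tendsto (fun z => Real.exp (-s * z) - 1) atTop (𝓝 (0 - 1)) := by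
      refine Tendsto.sub_const (Real.tendsto_exp_atBot.comp ?_) 1
      exact tendsto_id.const_mul_atTop_of_neg (by linarith)
    simpa using ((hm.expTail_tendsto 1).mul h1).neg
  have key := integral_Ioi_of_hasDerivAt_of_tendsto' hd (hint1.add hint2) hlim
  simp only [mul_zero, Real.exp_zero, sub_self, neg_zero] at key
  rw [integral_add hint1 hint2, integral_const_mul] at key
  rw [laplaceExponent, hm.integral_claimLaw]
  linear_combination m.lam * key

theorem laplaceExponent_continuousOn (hm : m.Admissible) :
    ContinuousOn m.laplaceExponent (Ici 0) := by
  have := hm.isProbabilityMeasure_claimLaw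
  unfold laplaceExponent
  refine ContinuousOn.add (by fun_prop) (ContinuousOn.mul continuousOn_const ?_)
  refine continuousOn_of_dominated (bound := fun _ => 1) ?_ ?_ (integrable_const _) ?_
  · intro s _
    exact Continuous.aestronglyMeasurable (by fun_prop)
  · intro s hs
    filter_upwards [hm.claimLaw_ae_pos] with z hz
    have h1 : Real.exp (-s * z) ≤ 1 := Real.exp_le_one_iff.2 (by nlinarith [mem_Ici.1 hs])
    rw [Real.norm_eq_abs, abs_le]
    constructor <;> linarith [Real.exp_pos (-s * z)]
  · exact .of_forall fun z => by fun_prop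

/-- From `e^{-sz} - 1 ≥ -1`. This crude bound both confines the roots of `κ = q` to `s ≤ (q+λ)/c`
and shows `κ ≥ q` at that point. -/
theorem laplaceExponent_ge (hm : m.Admissible) {s : ℝ} (hs : 0 ≤ s) :
    m.c * s - m.lam ≤ m.laplaceExponent s := by
  have := hm.isProbabilityMeasure_claimLaw
  have h : -1 ≤ ∫ z, (Real.exp (-s * z) - 1) ∂m.claimLaw := by
    have : ∫ _, (-1 : ℝ) ∂m.claimLaw ≤ ∫ z, (Real.exp (-s * z) - 1) ∂m.claimLaw := by
      refine integral_mono_ae (integrable_const _) ?_ (.of_forall fun z => ?_)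
      · refine Integrable.mono' (integrable_const 1)
          (Continuous.aestronglyMeasurable (by fun_prop)) ?_
        filter_upwards [hm.claimLaw_ae_pos] with z hz
        have h1 : Real.exp (-s * z) ≤ 1 := Real.exp_le_one_iff.2 (by nlinarith)
        rw [Real.norm_eq_abs, abs_le]
        constructor <;> linarith [Real.exp_pos (-s * z)]
      · simp only
        linarith [Real.exp_pos (-s * z)]
    simpa using this
  unfold laplaceExponent
  nlinarith [hm.lam_pos]

theorem laplaceExponent_zero (_ : m.Admissible) : m.laplaceExponent 0 = 0 := by
  simp [laplaceExponent]

theorem bigPhi_set_bddAbove (hm : m.Admissible) :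
    BddAbove {s : ℝ | 0 ≤ s ∧ m.laplaceExponent s = m.q} := by
  refine ⟨(m.q + m.lam) / m.c, fun s hs => ?_⟩
  rw [le_div_iff₀ hm.c_pos]
  linarith [hm.laplaceExponent_ge hs.1, hs.2]

theorem bigPhi_mem (hm : m.Admissible) :
    0 ≤ m.bigPhi ∧ m.laplaceExponent m.bigPhi = m.q := by
  have hcl : IsClosed {s : ℝ | 0 ≤ s ∧ m.laplaceExponent s = m.q} :=
    hm.laplaceExponent_continuousOn.preimage_isClosed_of_isClosed isClosed_Ici
      (isClosed_singleton (x := m.q))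
  -- A closed bounded set contains its supremum; nonemptiness is the intermediate value theorem
  -- between `κ(0) = 0` and `κ((q+λ)/c) ≥ q`.
  refine hcl.csSup_mem ?_ hm.bigPhi_set_bddAbove
  have h0 : (0 : ℝ) ≤ (m.q + m.lam) / m.c :=
    div_nonneg (add_nonneg hm.q_pos.le hm.lam_pos.le) hm.c_pos.le
  have h1 := hm.laplaceExponent_ge h0
  rw [mul_div_cancel₀ _ hm.c_pos.ne', add_sub_cancel_right] at h1
  obtain ⟨s, hs, hs'⟩ := intermediate_value_Icc h0
    (hm.laplaceExponent_continuousOn.mono Icc_subset_Ici_self)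
    (⟨by rw [hm.laplaceExponent_zero]; exact hm.q_pos.le, h1⟩ : m.q ∈ Icc _ _)
  exact ⟨s, hs.1, hs'⟩

theorem bigPhi_pos (hm : m.Admissible) : 0 < m.bigPhi := by
  refine lt_of_le_of_ne hm.bigPhi_mem.1 fun h => ?_
  have := hm.bigPhi_mem.2
  rw [← h, hm.laplaceExponent_zero] at this
  exact hm.q_pos.ne this

/-- This is `κ(Φ) = q` divided by `Φ`, after the integration by parts. It is the normalisation that
makes `u·1 = 1`. -/
theorem laplace_survival (hm : m.Admissible) :
    m.lam * ∫ z in Ioi 0, Real.exp (-m.bigPhi * z) * m.expTail 1 z = m.c - m.q / m.bigPhi := by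
  have h1 := hm.laplaceExponent_eq hm.bigPhi_pos
  rw [hm.bigPhi_mem.2] at h1
  rw [eq_sub_iff_add_eq, ← eq_sub_iff_add_eq', div_eq_iff hm.bigPhi_pos.ne']
  linear_combination h1

theorem laplace_survival_pos (hm : m.Admissible) : 0 < m.c - m.q / m.bigPhi := by
  rw [← hm.laplace_survival]
  refine mul_pos hm.lam_pos ?_
  rw [setIntegral_pos_iff_support_of_nonneg_ae _ (hm.integrableOn_exp_mul_expTail 1 hm.bigPhi_pos)]
  -- The integrand equals `1` at `0`, hence is positive on some `(0, ε)`, a set of positive measure.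
  · have hopen : IsOpen {z | 0 < Real.exp (-m.bigPhi * z) * m.expTail 1 z} :=
      isOpen_lt continuous_const (by fun_prop)
    obtain ⟨ε, hε, hball⟩ := Metric.isOpen_iff.1 hopen 0 (by simp [hm.expTail_one_zero])
    refine lt_of_lt_of_le ?_ (measure_mono (μ := volume) (s := Ioo 0 ε) fun z hz => ⟨?_, hz.1⟩)
    · simpa using hε
    · have : z ∈ Metric.ball (0 : ℝ) ε := by
        rw [Metric.mem_ball, Real.dist_eq, sub_zero, abs_of_pos hz.1]; exact hz.2
      exact ne_of_gt (hball this)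
  · refine (ae_restrict_iff' measurableSet_Ioi).2 (.of_forall fun z hz => ?_)
    exact mul_nonneg (Real.exp_pos _).le (hm.expTail_one_nonneg (le_of_lt hz))

/-- `∫₀^∞ (1 - e^{-Φz}) f(z) dz` in terms of `Φ`. -/
theorem lam_mul_integral_one_sub_exp (hm : m.Admissible) :
    m.lam * ∫ z in Ioi 0, m.claimDensity z * (1 - Real.exp (-m.bigPhi * z)) =
      m.c * m.bigPhi - m.q := by
  have h := hm.bigPhi_mem.2
  rw [laplaceExponent, hm.integral_claimLaw] at h
  have h2 : ∫ z in Ioi 0, m.claimDensity z * (1 - Real.exp (-m.bigPhi * z)) =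
      -∫ z in Ioi 0, m.claimDensity z * (Real.exp (-m.bigPhi * z) - 1) := by
    rw [← integral_neg]; congr 1; ext z; ring
  rw [h2]; linarith

theorem lam_mul_laplace_density (hm : m.Admissible) :
    m.lam * ∫ z in Ioi 0, Real.exp (-m.bigPhi * z) * m.claimDensity z =
      m.lam + m.q - m.c * m.bigPhi := by
  have h1 := hm.lam_mul_integral_one_sub_exp
  have h2 : ∫ z in Ioi 0, m.claimDensity z * (1 - Real.exp (-m.bigPhi * z)) =
      1 - ∫ z in Ioi 0, Real.exp (-m.bigPhi * z) * m.claimDensity z := by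
    have h3 := integral_sub (hm.integrableOn_density le_rfl)
      (hm.integrableOn_exp_mul_expTail ((-m.B) *ᵥ 1) hm.bigPhi_pos)
    rw [hm.integral_density le_rfl, hm.expTail_one_zero, ← claimDensity_eq] at h3
    rw [← h3]
    congr 1; ext z; ring
  rw [h2] at h1
  linarith

theorem setIntegral_le_Ioi {g : ℝ → ℝ} (hg : IntegrableOn g (Ioi 0)) (h0 : ∀ z, 0 < z → 0 ≤ g z)
    {x : ℝ} (hx : 0 ≤ x) : ∫ z in (0 : ℝ)..x, g z ≤ ∫ z in Ioi 0, g z := by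
  rw [intervalIntegral.integral_of_le hx]
  exact setIntegral_mono_set hg ((ae_restrict_iff' measurableSet_Ioi).2 (.of_forall h0))
    (Ioc_subset_Ioi_self.eventuallyLE)

/-- `∫₀ˣ z e^{-Φz} f(z) dz` is smaller than `c / λ`. -/
theorem lam_mul_partial_mean_lt (hm : m.Admissible) {x : ℝ} (hx : 0 ≤ x) :
    m.lam * ∫ z in (0 : ℝ)..x, z * (Real.exp (-m.bigPhi * z) * m.claimDensity z) < m.c := by
  have hΦ := hm.bigPhi_pos
  have hcont := hm.claimDensity_continuous
  have hint : IntegrableOn (fun z => m.claimDensity z * (1 - Real.exp (-m.bigPhi * z))) (Ioi 0) := by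
    refine ((hm.integrableOn_density le_rfl).sub
      (hm.integrableOn_exp_mul_expTail ((-m.B) *ᵥ 1) hΦ)).congr (.of_forall fun z => ?_)
    simp only [Pi.sub_apply, ← claimDensity_eq]; ring
  have h0 : ∀ z, 0 < z → 0 ≤ m.claimDensity z * (1 - Real.exp (-m.bigPhi * z)) := fun z hz => by
    refine mul_nonneg (hm.density_nonneg z hz.le) (sub_nonneg.2 (Real.exp_le_one_iff.2 ?_))
    nlinarith
  -- Pointwise `Φz e^{-Φz} ≤ 1 - e^{-Φz}`, from `1 + Φz ≤ e^{Φz}`. The right-hand side integrates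
  -- against `λ f` over the half-line to `cΦ - q`, and `q > 0` makes the final inequality strict.
  have h1 : m.bigPhi * ∫ z in (0 : ℝ)..x, z * (Real.exp (-m.bigPhi * z) * m.claimDensity z) ≤
      ∫ z in (0 : ℝ)..x, m.claimDensity z * (1 - Real.exp (-m.bigPhi * z)) := by
    rw [← intervalIntegral.integral_const_mul]
    refine intervalIntegral.integral_mono_on hx (Continuous.intervalIntegrable (by fun_prop) _ _)
      (Continuous.intervalIntegrable (by fun_prop) _ _) fun z hz => ?_
    have e1 : m.bigPhi * z * Real.exp (-m.bigPhi * z) ≤ 1 - Real.exp (-m.bigPhi * z) := by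
      have h2 := Real.add_one_le_exp (m.bigPhi * z)
      have h3 : Real.exp (-m.bigPhi * z) * Real.exp (m.bigPhi * z) = 1 := by
        rw [← Real.exp_add]; simp
      nlinarith [Real.exp_pos (-m.bigPhi * z)]
    have := mul_le_mul_of_nonneg_left e1 (hm.density_nonneg z hz.1)
    linarith
  have h2 := h1.trans (setIntegral_le_Ioi hint h0 hx)
  have h3 := mul_le_mul_of_nonneg_left h2 hm.lam_pos.le
  rw [hm.lam_mul_integral_one_sub_exp] at h3
  have h4 : m.bigPhi * (m.lam * ∫ z in (0 : ℝ)..x,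
      z * (Real.exp (-m.bigPhi * z) * m.claimDensity z)) < m.bigPhi * m.c := by
    linarith [hm.q_pos]
  exact lt_of_mul_lt_mul_left h4 hΦ.le

end Admissible

/-! ### Monotonicity and boundedness of the tilted scale function. -/

/-- The tilted scale function `e^{-Φx} w(x)`. -/
def tiltedScale (m : RiskModel n) (x : ℝ) : ℝ := Real.exp (-m.bigPhi * x) * m.scaleFun x

theorem scaleFun_eq_tiltedScale (m : RiskModel n) (x : ℝ) :
    m.scaleFun x = Real.exp (m.bigPhi * x) * m.tiltedScale x := by
  rw [tiltedScale, ← mul_assoc, ← Real.exp_add]; simp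

theorem tiltedScale_hasDerivAt (m : RiskModel n) (x : ℝ) :
    HasDerivAt m.tiltedScale
      (Real.exp (-m.bigPhi * x) * (m.scaleFun' x - m.bigPhi * m.scaleFun x)) x := by
  have h1 : HasDerivAt (fun z => Real.exp (-m.bigPhi * z))
      (Real.exp (-m.bigPhi * x) * (-m.bigPhi)) x := by
    simpa using ((hasDerivAt_id x).const_mul (-m.bigPhi)).exp
  refine (h1.mul (m.scaleFun_hasDerivAt x)).congr_deriv ?_
  ring

@[fun_prop]
theorem tiltedScale_continuous (m : RiskModel n) : Continuous m.tiltedScale := by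
  unfold tiltedScale; fun_prop

namespace Admissible

variable {m : RiskModel n}

theorem tiltedScale_nonneg (hm : m.Admissible) {x : ℝ} (hx : 0 ≤ x) : 0 ≤ m.tiltedScale x :=
  mul_nonneg (Real.exp_pos _).le (hm.scaleFun_pos hx).le

/-- The value `λ + q - cΦ` of the transform of `λ f` at `Φ` absorbs all terms without an integral.
What is left compares `g(x)`, weighted by the full mass of `e^{-Φz} f`, with the earlier values
`g(x-z)`, so `g' ≥ 0` is plausible as soon as `g` increases before `x`. -/
theorem c_mul_tiltedScale_deriv (hm : m.Admissible) (x : ℝ) :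
    m.c * (Real.exp (-m.bigPhi * x) * (m.scaleFun' x - m.bigPhi * m.scaleFun x)) =
      m.lam * ((∫ z in Ioi 0, Real.exp (-m.bigPhi * z) * m.claimDensity z) * m.tiltedScale x
        - ∫ z in (0 : ℝ)..x, Real.exp (-m.bigPhi * z) * m.claimDensity z *
            m.tiltedScale (x - z)) := by
  have h1 := hm.scaleFun'_eq x
  have h2 := hm.lam_mul_laplace_density
  have h3 : Real.exp (-m.bigPhi * x) * halfConv m.scaleFun m.claimDensity x =
      ∫ z in (0 : ℝ)..x, Real.exp (-m.bigPhi * z) * m.claimDensity z *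
            m.tiltedScale (x - z) := by
    unfold halfConv
    rw [← intervalIntegral.integral_const_mul]
    congr 1; ext z
    rw [tiltedScale, show -m.bigPhi * x = -m.bigPhi * z + -m.bigPhi * (x - z) by ring, Real.exp_add]
    ring
  rw [← h3, tiltedScale]
  linear_combination Real.exp (-m.bigPhi * x) * h1
    - Real.exp (-m.bigPhi * x) * m.scaleFun x * h2

/-- Monotonicity before `x` gives only `g'(x) ≥ 0`, too weak for a first-failure argument, so it is
perturbed. If `g' > -ε` on `[0,x)`, then `g(x-z) ≤ g(x) + εz`, hence `c g'(x) ≥ -ελ ∫₀ˣ z e^{-Φz}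
f(z) dz > -εc` by `lam_mul_partial_mean_lt`. Thus `g' > -ε` everywhere, for every `ε > 0`. -/
theorem tiltedScale_deriv_nonneg (hm : m.Admissible) {x : ℝ} (hx : 0 ≤ x) :
    0 ≤ Real.exp (-m.bigPhi * x) * (m.scaleFun' x - m.bigPhi * m.scaleFun x) := by
  set g' : ℝ → ℝ := fun x => Real.exp (-m.bigPhi * x) * (m.scaleFun' x - m.bigPhi * m.scaleFun x)
    with hg'
  have hcont := hm.claimDensity_continuous
  have hg'c : Continuous g' := by fun_prop
  suffices h : ∀ ε, 0 < ε → ∀ x, 0 ≤ x → 0 < g' x + ε by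
    refine le_of_forall_pos_lt_add fun ε hε => ?_
    exact h ε hε x hx
  intro ε hε x hx
  refine pos_of_pos_before (f := fun x => g' x + ε) (by fun_prop) (fun x hx h => ?_) hx
  set L := ∫ z in Ioi 0, Real.exp (-m.bigPhi * z) * m.claimDensity z
  have hincr : ∀ z ∈ Icc 0 x, m.tiltedScale (x - z) ≤ m.tiltedScale x + ε * z := by
    intro z hz
    have hmono : MonotoneOn (fun y => m.tiltedScale y + ε * y) (Icc 0 x) := by
      have hd : ∀ y, HasDerivAt (fun y => m.tiltedScale y + ε * y) (g' y + ε) y := fun y =>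
        ((m.tiltedScale_hasDerivAt y).add ((hasDerivAt_id y).const_mul ε)).congr_deriv
          (by simp [hg'])
      refine monotoneOn_of_deriv_nonneg (convex_Icc _ _) (by fun_prop)
        (fun y _ => (hd y).differentiableAt.differentiableWithinAt) fun y hy => ?_
      rw [interior_Icc] at hy
      rw [(hd y).deriv]
      exact (h y ⟨hy.1.le, hy.2⟩).le
    have := hmono (a := x - z) (b := x) ⟨by linarith [hz.2], by linarith [hz.1]⟩
      ⟨hx, le_rfl⟩ (by linarith [hz.1])
    simp only at this
    linarith
  have hintL : IntegrableOn (fun z => Real.exp (-m.bigPhi * z) * m.claimDensity z) (Ioi 0) :=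
    hm.integrableOn_exp_mul_expTail ((-m.B) *ᵥ 1) hm.bigPhi_pos
  have hfn : ∀ z, 0 ≤ z → 0 ≤ Real.exp (-m.bigPhi * z) * m.claimDensity z := fun z hz =>
    mul_nonneg (Real.exp_pos _).le (hm.density_nonneg z hz)
  have h1 : ∫ z in (0 : ℝ)..x, Real.exp (-m.bigPhi * z) * m.claimDensity z *
      m.tiltedScale (x - z) ≤ L * m.tiltedScale x +
        ε * ∫ z in (0 : ℝ)..x, z * (Real.exp (-m.bigPhi * z) * m.claimDensity z) := by
    have a1 : ∫ z in (0 : ℝ)..x, Real.exp (-m.bigPhi * z) * m.claimDensity z *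
        m.tiltedScale (x - z) ≤ ∫ z in (0 : ℝ)..x,
          (Real.exp (-m.bigPhi * z) * m.claimDensity z * m.tiltedScale x +
            ε * (z * (Real.exp (-m.bigPhi * z) * m.claimDensity z))) := by
      refine intervalIntegral.integral_mono_on hx (Continuous.intervalIntegrable (by fun_prop) _ _)
        (Continuous.intervalIntegrable (by fun_prop) _ _) fun z hz => ?_
      have := mul_le_mul_of_nonneg_left (hincr z hz) (hfn z hz.1)
      linarith
    rw [intervalIntegral.integral_add (Continuous.intervalIntegrable (by fun_prop) _ _)
      (Continuous.intervalIntegrable (by fun_prop) _ _), intervalIntegral.integral_mul_const,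
      intervalIntegral.integral_const_mul] at a1
    have a2 := mul_le_mul_of_nonneg_right
      (setIntegral_le_Ioi hintL (fun z hz => hfn z hz.le) hx) (hm.tiltedScale_nonneg hx)
    linarith
  have h2 := hm.c_mul_tiltedScale_deriv x
  have h3 := hm.lam_mul_partial_mean_lt hx
  have h4 : 0 < m.c * (g' x + ε) := by
    have b1 := mul_le_mul_of_nonneg_left h1 hm.lam_pos.le
    have b2 := mul_lt_mul_of_pos_left h3 hε
    simp only [hg']
    nlinarith
  exact pos_of_mul_pos_right h4 hm.c_pos.le

theorem tiltedScale_monotone (hm : m.Admissible) : MonotoneOn m.tiltedScale (Ici 0) := by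
  refine monotoneOn_of_deriv_nonneg (convex_Ici _) (by fun_prop)
    (fun y _ => (m.tiltedScale_hasDerivAt y).differentiableAt.differentiableWithinAt) fun y hy => ?_
  rw [interior_Ici] at hy
  rw [(m.tiltedScale_hasDerivAt y).deriv]
  exact hm.tiltedScale_deriv_nonneg (le_of_lt hy)

theorem scaleFun'_ge (hm : m.Admissible) {x : ℝ} (hx : 0 ≤ x) :
    m.bigPhi * m.scaleFun x ≤ m.scaleFun' x := by
  have := nonneg_of_mul_nonneg_right (hm.tiltedScale_deriv_nonneg hx) (Real.exp_pos _)
  linarith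

theorem scaleFun'_pos (hm : m.Admissible) {x : ℝ} (hx : 0 ≤ x) : 0 < m.scaleFun' x :=
  (mul_pos hm.bigPhi_pos (hm.scaleFun_pos hx)).trans_le (hm.scaleFun'_ge hx)

theorem scaleFun_sub_le (hm : m.Admissible) {x z : ℝ} (hz : 0 ≤ z) (hzx : z ≤ x) :
    m.scaleFun (x - z) ≤ Real.exp (-m.bigPhi * z) * m.scaleFun x := by
  have h := hm.tiltedScale_monotone (a := x - z) (b := x) (by simpa using hzx) (hz.trans hzx)
    (by linarith)
  rw [scaleFun_eq_tiltedScale, m.scaleFun_eq_tiltedScale x, ← mul_assoc, ← Real.exp_add,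
    show -m.bigPhi * z + m.bigPhi * x = m.bigPhi * (x - z) by ring]
  exact mul_le_mul_of_nonneg_left h (Real.exp_pos _).le

theorem halfConv_scaleFun_le (hm : m.Admissible) {p : ℝ → ℝ} (hp : Continuous p)
    (hp0 : ∀ z, 0 ≤ z → 0 ≤ p z)
    {x : ℝ} (hx : 0 ≤ x) :
    halfConv m.scaleFun p x ≤
      m.scaleFun x * ∫ z in (0 : ℝ)..x, Real.exp (-m.bigPhi * z) * p z := by
  unfold halfConv
  rw [← intervalIntegral.integral_const_mul]
  refine intervalIntegral.integral_mono_on hx (Continuous.intervalIntegrable (by fun_prop) _ _)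
      (Continuous.intervalIntegrable (by fun_prop) _ _) fun z hz => ?_
  have := mul_le_mul_of_nonneg_right (hm.scaleFun_sub_le hz.1 hz.2) (hp0 z hz.1)
  linarith

theorem halfConv_scaleFun_le_Ioi (hm : m.Admissible) {p : ℝ → ℝ} (hp : Continuous p)
    (hp0 : ∀ z, 0 ≤ z → 0 ≤ p z)
    (hpi : IntegrableOn (fun z => Real.exp (-m.bigPhi * z) * p z) (Ioi 0)) {x : ℝ} (hx : 0 ≤ x) :
    halfConv m.scaleFun p x ≤
      m.scaleFun x * ∫ z in Ioi 0, Real.exp (-m.bigPhi * z) * p z :=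
  (hm.halfConv_scaleFun_le hp hp0 hx).trans (mul_le_mul_of_nonneg_left
    (setIntegral_le_Ioi hpi (fun z hz => mul_nonneg (Real.exp_pos _).le (hp0 z hz.le)) hx)
    (hm.scaleFun_pos hx).le)

/-- Insert `w(x-z) ≤ e^{-Φz} w(x)` into the renewal equation. The `q` part contributes `(q/Φ)(1 -
e^{-Φx})` and the `λ` part at most `c - q/Φ`, so `c w ≤ 1 + w (c - (q/Φ) e^{-Φx})`, where `c w`
cancels. -/
theorem tiltedScale_le (hm : m.Admissible) {x : ℝ} (hx : 0 ≤ x) :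
    m.tiltedScale x ≤ m.bigPhi / m.q := by
  have hΦ := hm.bigPhi_pos
  have h1 := hm.c_mul_scaleFun_eq_halfConv x
  rw [halfConv_add_right (by fun_prop) (by fun_prop) (by fun_prop), halfConv_const_mul_right] at h1
  have h2 := hm.halfConv_scaleFun_le (p := fun _ => m.q) (by fun_prop) (fun _ _ => hm.q_pos.le) hx
  have h3 := hm.halfConv_scaleFun_le_Ioi (m.expTail_continuous 1)
    (fun z hz => hm.expTail_one_nonneg hz) (hm.integrableOn_exp_mul_expTail 1 hΦ) hx
  have h4 : m.bigPhi * ∫ z in (0 : ℝ)..x, Real.exp (-m.bigPhi * z) * m.q =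
      m.q * (1 - Real.exp (-m.bigPhi * x)) := by
    have hd : ∀ y, HasDerivAt (fun y => -m.q * Real.exp (-m.bigPhi * y))
        (m.bigPhi * (Real.exp (-m.bigPhi * y) * m.q)) y := fun y => by
      refine ((((hasDerivAt_id y).const_mul (-m.bigPhi)).exp).const_mul (-m.q)).congr_deriv ?_
      simp; ring
    have := intervalIntegral.integral_eq_sub_of_hasDerivAt (a := 0) (b := x) (fun y _ => hd y)
      (Continuous.intervalIntegrable (by fun_prop) _ _)
    rw [intervalIntegral.integral_const_mul] at this
    rw [this]; simp; ring
  have h5 := mul_le_mul_of_nonneg_left h3 hm.lam_pos.le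
  have h6 := hm.laplace_survival
  have h7 := hm.scaleFun_pos hx
  have h8 : m.bigPhi * (m.c * m.scaleFun x) ≤ m.bigPhi
      + m.scaleFun x * (m.q * (1 - Real.exp (-m.bigPhi * x)))
      + m.scaleFun x * (m.c * m.bigPhi - m.q) := by
    have e : m.lam * (m.scaleFun x * ∫ z in Ioi 0, Real.exp (-m.bigPhi * z) * m.expTail 1 z) =
      m.scaleFun x * (m.c - m.q / m.bigPhi) := by rw [← h6]; ring
    rw [e] at h5
    have e2 : m.bigPhi * (m.scaleFun x * (m.c - m.q / m.bigPhi)) =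
      m.scaleFun x * (m.c * m.bigPhi - m.q) := by field_simp
    rw [← h4, ← e2]
    have := mul_le_mul_of_nonneg_left (add_le_add (add_le_add_right h2 1) h5) hΦ.le
    rw [h1]
    linarith
  rw [le_div_iff₀ hm.q_pos, tiltedScale]
  linarith

end Admissible

end RiskModel


/-! ### Uniqueness of Laplace transforms. -/

/-- A continuous function whose Laplace transform vanishes on a half-line is zero. -/
theorem eq_zero_of_laplace_eq_zero {d : ℝ → ℝ} (hd : Continuous d) {s₀ : ℝ}
    (hi : ∀ s > s₀, IntegrableOn (fun x => Real.exp (-s * x) * d x) (Ioi 0))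
    (h0 : ∀ s > s₀, ∫ x in Ioi (0 : ℝ), Real.exp (-s * x) * d x = 0) {x : ℝ} (hx : 0 ≤ x) :
    d x = 0 := by
  -- The tilt makes the transform of `φ` available for all `t < 1`, a neighbourhood of `0`.
  set φ : ℝ → ℝ := fun x => Real.exp (-(s₀ + 1) * x) * d x with hφ
  set ρ : Measure ℝ := volume.restrict (Ioi 0) with hρ
  -- As `ENNReal.ofReal` truncates at `0`, `ν φ` and `ν (-φ)` have the positive and the negative
  -- part of `φ` as densities. The aim is to show that these two finite measures coincide.
  set ν : (ℝ → ℝ) → Measure ℝ := fun g => ρ.withDensity fun x => ENNReal.ofReal (g x) with hν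
  have hφc : Continuous φ := by fun_prop
  have hexp : ∀ t < 1, Integrable (fun x => Real.exp (t * x) * φ x) ρ := fun t ht => by
    refine (hi (s₀ + 1 - t) (by linarith)).congr (.of_forall fun x => ?_)
    simp only [hφ]; rw [← mul_assoc, ← Real.exp_add]; ring_nf
  have hexp0 : ∀ t < 1, ∫ x, Real.exp (t * x) * φ x ∂ρ = 0 := fun t ht => by
    rw [← h0 (s₀ + 1 - t) (by linarith)]
    congr 1; ext x
    simp only [hφ]; rw [← mul_assoc, ← Real.exp_add]; ring_nf
  have hpart : ∀ g : ℝ → ℝ, Continuous g → (∀ t < 1, Integrable (fun x => Real.exp (t * x) * g x) ρ)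
      → ∀ t < 1, Integrable (fun x => Real.exp (t * x)) (ν g) ∧
        mgf id (ν g) t = ∫ x, max (Real.exp (t * x) * g x) 0 ∂ρ := by
    intro g hg hgi t ht
    have e : ∀ x, Real.exp (t * x) * (ENNReal.ofReal (g x)).toReal =
        max (Real.exp (t * x) * g x) 0 := fun x => by
      rw [ENNReal.toReal_ofReal', mul_max_of_nonneg _ _ (Real.exp_pos _).le, mul_zero]
    constructor
    · rw [integrable_withDensity_iff hg.measurable.ennreal_ofReal (by simp)]
      simp_rw [e]
      exact (hgi t ht).pos_part
    · rw [mgf, integral_withDensity_eq_integral_toReal_smul hg.measurable.ennreal_ofReal (by simp)]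
      simp only [smul_eq_mul, id_eq]
      congr 1; ext x; rw [← e]; ring
  have hp := hpart φ hφc hexp
  have hn := hpart (fun x => -φ x) hφc.neg fun t ht => by simpa using (hexp t ht).neg
  have hmgf : ∀ t < 1, mgf id (ν φ) t = mgf id (ν fun x => -φ x) t := fun t ht => by
    rw [(hp t ht).2, (hn t ht).2, ← sub_eq_zero, ← integral_sub (hexp t ht).pos_part
      (by simpa using (hexp t ht).neg_part)]
    refine Eq.trans ?_ (hexp0 t ht)
    congr 1; ext x
    rcases le_total (Real.exp (t * x) * φ x) 0 with h | h
    · rw [max_eq_right h, max_eq_left (by simpa using h)]; ring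
    · rw [max_eq_left h, max_eq_right (by simpa using h)]; ring
  have hset : ∀ {g : ℝ → ℝ}, (∀ t < 1, Integrable (fun x => Real.exp (t * x)) (ν g) ∧
        mgf id (ν g) t = ∫ x, max (Real.exp (t * x) * g x) 0 ∂ρ) →
      {z : ℂ | z.re < 1} ⊆ {z | z.re ∈ interior (integrableExpSet id (ν g))} := by
    intro g hg z hz
    exact interior_maximal (fun t ht => (hg t ht).1) isOpen_Iio hz
  have hfin : ∀ {g : ℝ → ℝ}, (∀ t < 1, Integrable (fun x => Real.exp (t * x)) (ν g) ∧
        mgf id (ν g) t = ∫ x, max (Real.exp (t * x) * g x) 0 ∂ρ) → IsFiniteMeasure (ν g) := by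
    intro g hg
    have := (hg 0 zero_lt_one).1
    simp only [zero_mul, Real.exp_zero] at this
    exact (integrable_const_iff_isFiniteMeasure one_ne_zero).1 this
  have := hfin hp
  have := hfin hn
  -- Identity theorem: the transforms agree at the real points `-1/(k+1)`, which accumulate at `0`,
  -- hence on the half-plane `Re z < 1`. It contains the imaginary axis, where they are the
  -- characteristic functions.
  have hcomplex : EqOn (complexMGF id (ν φ)) (complexMGF id (ν fun x => -φ x))
      {z : ℂ | z.re < 1} := by
    refine AnalyticOnNhd.eqOn_of_preconnected_of_frequently_eq (z₀ := 0)
      (analyticOnNhd_complexMGF.mono (hset hp)) (analyticOnNhd_complexMGF.mono (hset hn))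
      (convex_halfSpace_re_lt 1).isPreconnected (by simp) ?_
    have htend : Tendsto (fun k : ℕ => (((-(1 / ((k : ℝ) + 1)) : ℝ)) : ℂ)) atTop (𝓝[≠] 0) := by
      refine tendsto_nhdsWithin_iff.2 ⟨?_, .of_forall fun k => ?_⟩
      · have := (tendsto_one_div_add_atTop_nhds_zero_nat (𝕜 := ℝ)).neg
        rw [neg_zero] at this
        exact_mod_cast (Complex.continuous_ofReal.tendsto 0).comp this
      · have : (0 : ℝ) < 1 / ((k : ℝ) + 1) := by positivity
        simp only [mem_compl_iff, mem_singleton_iff, Complex.ofReal_eq_zero]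
        linarith
    refine htend.frequently (.of_forall fun k => ?_)
    have : (0 : ℝ) < 1 / ((k : ℝ) + 1) := by positivity
    rw [complexMGF_ofReal, complexMGF_ofReal, hmgf _ (by linarith)]
  have hμ : ν φ = ν fun x => -φ x := by
    refine Measure.ext_of_charFun (funext fun t => ?_)
    rw [← complexMGF_id_mul_I, ← complexMGF_id_mul_I]
    exact hcomplex (by simp)
  have hae : (fun x => ENNReal.ofReal (φ x)) =ᵐ[ρ] fun x => ENNReal.ofReal (-φ x) := by
    refine (withDensity_eq_iff hφc.measurable.ennreal_ofReal.aemeasurable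
      hφc.neg.measurable.ennreal_ofReal.aemeasurable ?_).1 hμ
    have := measure_ne_top (ν φ) univ
    rwa [hν, withDensity_apply _ MeasurableSet.univ, Measure.restrict_univ] at this
  have hae0 : d =ᵐ[volume.restrict (Ici 0)] fun _ => (0 : ℝ) := by
    rw [restrict_Ioi_eq_restrict_Ici.symm]
    filter_upwards [hae] with y hy
    have hφ0 : φ y = 0 := by
      rcases le_total (φ y) 0 with h | h
      · rw [ENNReal.ofReal_of_nonpos h, eq_comm, ENNReal.ofReal_eq_zero] at hy
        linarith
      · rw [ENNReal.ofReal_of_nonpos (by linarith : -φ y ≤ 0), ENNReal.ofReal_eq_zero] at hy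
        linarith
    exact (mul_eq_zero.1 hφ0).resolve_left (Real.exp_pos _).ne'
  exact Measure.eqOn_of_ae_eq hae0 hd.continuousOn continuousOn_const
    (by rw [interior_Ici, closure_Ioi]) hx

/-! ### Laplace transform of the constructed function and identification of `W_q`. -/

namespace RiskModel

variable {n : ℕ}

namespace Admissible

variable {m : RiskModel n}

theorem integrableOn_exp_mul_scaleFun (hm : m.Admissible) {s : ℝ} (hs : m.bigPhi < s) :
    IntegrableOn (fun x => Real.exp (-s * x) * m.scaleFun x) (Ioi 0) := by
  refine Integrable.mono' ((exp_neg_integrableOn_Ioi 0 (sub_pos.2 hs)).mul_const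
    (m.bigPhi / m.q)) (Continuous.aestronglyMeasurable (by fun_prop)) ?_
  refine (ae_restrict_iff' measurableSet_Ioi).2 (.of_forall fun x hx => ?_)
  have hx' : (0 : ℝ) ≤ x := le_of_lt hx
  rw [Real.norm_eq_abs, scaleFun_eq_tiltedScale, ← mul_assoc, ← Real.exp_add, abs_mul,
    abs_of_pos (Real.exp_pos _), abs_of_nonneg (hm.tiltedScale_nonneg hx'),
    show -s * x + m.bigPhi * x = -(s - m.bigPhi) * x by ring]
  exact mul_le_mul_of_nonneg_left (hm.tiltedScale_le hx') (Real.exp_pos _).le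

/-- The transform turns `c w = 1 + w * (q + λ F̄)` into a linear equation for the transform of `w`;
multiplied by `s`, its coefficient is `κ(s) - q`. -/
theorem laplace_scaleFun (hm : m.Admissible) {s : ℝ} (hs : m.bigPhi < s) :
    ∫ x in Ioi 0, Real.exp (-s * x) * m.scaleFun x = 1 / (m.laplaceExponent s - m.q) := by
  have hs0 : 0 < s := hm.bigPhi_pos.trans hs
  have hi1 := exp_neg_integrableOn_Ioi 0 hs0
  have hiw := hm.integrableOn_exp_mul_scaleFun hs
  have hit := hm.integrableOn_exp_mul_expTail 1 hs0
  set p : ℝ → ℝ := fun y => m.q + m.lam * m.expTail 1 y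
  have hip : IntegrableOn (fun y => Real.exp (-s * y) * p y) (Ioi 0) := by
    refine ((hi1.const_mul m.q).add (hit.const_mul m.lam)).congr (.of_forall fun y => ?_)
    simp only [p, Pi.add_apply]; ring
  have hE : ∫ y in Ioi 0, Real.exp (-s * y) = 1 / s := by
    have := integral_exp_mul_Ioi (a := -s) (by linarith) 0
    simpa using this
  have hp : ∫ y in Ioi 0, Real.exp (-s * y) * p y =
      m.q / s + m.lam * ∫ y in Ioi 0, Real.exp (-s * y) * m.expTail 1 y := by
    have : (fun y => Real.exp (-s * y) * p y) = fun y =>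
        m.q * Real.exp (-s * y) + m.lam * (Real.exp (-s * y) * m.expTail 1 y) := by
      ext y; simp only [p]; ring
    rw [this, integral_add (hi1.const_mul m.q) (hit.const_mul m.lam), integral_const_mul,
      integral_const_mul, hE]; ring
  have hconv := integral_posConvolution hip hiw (ContinuousLinearMap.mul ℝ ℝ)
  have hpt : ∀ x, ∫ t in (0 : ℝ)..x, (ContinuousLinearMap.mul ℝ ℝ) (Real.exp (-s * t) * p t)
      (Real.exp (-s * (x - t)) * m.scaleFun (x - t)) =
      m.c * (Real.exp (-s * x) * m.scaleFun x) - Real.exp (-s * x) := fun x => by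
    have h1 := hm.c_mul_scaleFun_eq_halfConv x
    have h2 : ∫ t in (0 : ℝ)..x, (ContinuousLinearMap.mul ℝ ℝ) (Real.exp (-s * t) * p t)
      (Real.exp (-s * (x - t)) * m.scaleFun (x - t)) = Real.exp (-s * x) *
        halfConv m.scaleFun p x := by
      unfold halfConv
      rw [← intervalIntegral.integral_const_mul]
      congr 1; ext t
      rw [ContinuousLinearMap.mul_apply', show -s * x = -s * t + -s * (x - t) by ring,
        Real.exp_add]
      ring
    rw [h2]
    linear_combination -Real.exp (-s * x) * h1
  simp_rw [hpt] at hconv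
  rw [integral_sub (hiw.const_mul m.c) hi1, integral_const_mul, ContinuousLinearMap.mul_apply', hp,
    hE] at hconv
  rw [hm.laplaceExponent_eq hs0]
  refine eq_one_div_of_mul_eq_one_left ?_
  have hs' := hs0.ne'
  set I := ∫ y in Ioi 0, Real.exp (-s * y) * m.expTail 1 y
  set J := ∫ x in Ioi 0, Real.exp (-s * x) * m.scaleFun x
  have e := congrArg (fun r => s * r) hconv
  simp only [mul_sub, mul_one_div_cancel hs'] at e
  have e2 : s * ((m.q / s + m.lam * I) * J) = (m.q + s * (m.lam * I)) * J := by
    field_simp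
  rw [e2] at e
  linear_combination e

theorem isScaleFunction_indicator (hm : m.Admissible) :
    m.IsScaleFunction ((Ici 0).indicator m.scaleFun) where
  neg x hx := indicator_of_notMem (by simpa using hx) _
  cont := m.scaleFun_continuous.continuousOn.congr fun x hx => indicator_of_mem hx _
  integrable s hs := (hm.integrableOn_exp_mul_scaleFun hs).congr_fun (fun x hx => by
    simp only [indicator_of_mem (Ioi_subset_Ici_self hx)]) measurableSet_Ioi
  laplace s hs := by
    rw [← hm.laplace_scaleFun hs]
    exact setIntegral_congr_fun measurableSet_Ioi fun x hx => by
      simp only [indicator_of_mem (Ioi_subset_Ici_self hx)]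

theorem isScaleFunction_W (hm : m.Admissible) : m.IsScaleFunction m.W :=
  Classical.epsilon_spec ⟨_, hm.isScaleFunction_indicator⟩

/-- Two functions with the same transform on `(Φ_q, ∞)`. Composing with `max x 0` makes the
difference continuous on the whole line, although `W_q` jumps at `0`. -/
theorem W_eq_scaleFun (hm : m.Admissible) {x : ℝ} (hx : 0 ≤ x) : m.W x = m.scaleFun x := by
  have hW := hm.isScaleFunction_W
  set d : ℝ → ℝ := fun x => m.W (max x 0) - m.scaleFun (max x 0) with hd
  have hdc : Continuous d := by
    refine Continuous.sub ?_ (by fun_prop)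
    exact hW.cont.comp_continuous (by fun_prop) fun x => mem_Ici.2 (le_max_right _ _)
  have heq : ∀ s, ∀ x ∈ Ioi (0 : ℝ), Real.exp (-s * x) * m.W x - Real.exp (-s * x) * m.scaleFun x =
      Real.exp (-s * x) * d x := fun s x hx => by
    simp only [hd, max_eq_left (le_of_lt (mem_Ioi.1 hx)), mul_sub]
  have := eq_zero_of_laplace_eq_zero hdc (s₀ := m.bigPhi) (fun s hs => ?_) (fun s hs => ?_) hx
  · simp only [hd, max_eq_left hx] at this
    linarith
  · exact ((hW.integrable s hs).sub (hm.integrableOn_exp_mul_scaleFun hs)).congr_fun (heq s)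
      measurableSet_Ioi
  · rw [← setIntegral_congr_fun measurableSet_Ioi (heq s),
      integral_sub (hW.integrable s hs) (hm.integrableOn_exp_mul_scaleFun hs), hW.laplace s hs,
      hm.laplace_scaleFun hs, sub_self]

end Admissible

end RiskModel

/-! ### Closed forms of `C⃗`, `M(a)`, `G_a`, `S_a` and `u`. -/

namespace RiskModel

variable {n : ℕ}

/-- The derivative of `scaleVec`. -/
def scaleVec' (m : RiskModel n) (x : ℝ) : Fin n → ℝ := m.scaleFun x • m.β + m.scaleVec x ᵥ* m.B

/-- The second derivative of `scaleVec`. -/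
def scaleVec'' (m : RiskModel n) (x : ℝ) : Fin n → ℝ :=
  m.scaleFun' x • m.β + m.scaleVec' x ᵥ* m.B

theorem scaleVec'_hasDerivAt (m : RiskModel n) (x : ℝ) :
    HasDerivAt m.scaleVec' (m.scaleVec'' x) x := by
  refine ((m.scaleFun_hasDerivAt x).smul_const m.β).add ?_
  let L : (Fin n → ℝ) →ₗ[ℝ] (Fin n → ℝ) :=
    { toFun := fun v => v ᵥ* m.B
      map_add' := fun v w => Matrix.add_vecMul _ _ _
      map_smul' := fun r v => Matrix.smul_vecMul _ _ _ }
  exact (LinearMap.toContinuousLinearMap L).hasFDerivAt.comp_hasDerivAt x (m.scaleVec_hasDerivAt x)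

@[fun_prop]
theorem scaleVec'_continuous (m : RiskModel n) : Continuous m.scaleVec' :=
  continuous_iff_continuousAt.2 fun x => (m.scaleVec'_hasDerivAt x).continuousAt

theorem scaleVec''_continuous (m : RiskModel n) : Continuous m.scaleVec'' := by
  unfold scaleVec''; fun_prop

theorem scaleFun_contDiff (m : RiskModel n) : ContDiff ℝ 1 m.scaleFun := by
  refine contDiff_one_iff_deriv.2 ⟨fun x => (m.scaleFun_hasDerivAt x).differentiableAt, ?_⟩
  rw [show deriv m.scaleFun = m.scaleFun' from funext fun x => (m.scaleFun_hasDerivAt x).deriv]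
  exact m.scaleFun'_continuous

theorem scaleVec_contDiff (m : RiskModel n) : ContDiff ℝ 2 m.scaleVec := by
  rw [show (2 : WithTop ℕ∞) = 1 + 1 from rfl, contDiff_succ_iff_deriv]
  refine ⟨fun x => (m.scaleVec_hasDerivAt x).differentiableAt, by simp, ?_⟩
  rw [show deriv m.scaleVec = m.scaleVec' from funext fun x => (m.scaleVec_hasDerivAt x).deriv]
  refine contDiff_one_iff_deriv.2 ⟨fun x => (m.scaleVec'_hasDerivAt x).differentiableAt, ?_⟩
  rw [show deriv m.scaleVec' = m.scaleVec'' from funext fun x => (m.scaleVec'_hasDerivAt x).deriv]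
  exact m.scaleVec''_continuous

theorem scaleVec'_dotProduct (m : RiskModel n) (w : Fin n → ℝ) (x : ℝ) :
    m.scaleVec' x ⬝ᵥ w = m.scaleFun x * m.β ⬝ᵥ w + m.scaleVec x ⬝ᵥ (m.B *ᵥ w) := by
  rw [scaleVec', add_dotProduct, smul_dotProduct, smul_eq_mul, Matrix.dotProduct_mulVec]

theorem hasDerivAt_dotProduct_const {v : ℝ → Fin n → ℝ} {v' : Fin n → ℝ} {x : ℝ}
    (h : HasDerivAt v v' x) (w : Fin n → ℝ) : HasDerivAt (fun x => v x ⬝ᵥ w) (v' ⬝ᵥ w) x :=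
  HasDerivAt.fun_sum fun i _ => (hasDerivAt_pi.1 h i).mul_const (w i)

theorem vecMul_expB_apply (m : RiskModel n) (x : ℝ) (i : Fin n) :
    (m.β ᵥ* m.expB x) i = m.expTail (Pi.single i 1) x := by
  rw [expTail, Matrix.dotProduct_mulVec, dotProduct_single, mul_one]

theorem mulVec_one_apply (A : Matrix (Fin n) (Fin n) ℝ) (i : Fin n) :
    (A *ᵥ 1) i = ∑ j, A i j := by
  simp [Matrix.mulVec, dotProduct]

/-- Split `e^{(y+z)B} = e^{yB} e^{zB}` and integrate over `z` entry by entry. -/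
theorem partialMean_eq (m : RiskModel n) (a y : ℝ) :
    m.partialMean a y = m.expTail (m.matM a *ᵥ 1) y := by
  have hentry : ∀ i j, Continuous fun z => m.expB z i j := fun i j =>
    continuous_iff_continuousAt.2 fun z => (m.expB_apply_hasDerivAt i j z).continuousAt
  have h1 : ∀ z, z * m.claimDensity (y + z) =
      ∑ i, (m.β ᵥ* m.expB y) i * ∑ j, z * (m.expB z * (-m.B)) i j := fun z => by
    rw [claimDensity_eq, expTail_shift, Matrix.mulVec_mulVec, expTail_eq_sum, Finset.mul_sum]
    refine Finset.sum_congr rfl fun i _ => ?_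
    rw [← Finset.mul_sum, mulVec_one_apply]
    ring
  have hc : ∀ i j, Continuous fun z => z * (m.expB z * (-m.B)) i j := fun i j => by
    simp only [Matrix.mul_apply]
    fun_prop
  unfold partialMean
  simp_rw [h1]
  rw [intervalIntegral.integral_finsetSum fun i _ => Continuous.intervalIntegrable (by fun_prop) _ _,
    expTail_eq_sum]
  refine Finset.sum_congr rfl fun i _ => ?_
  rw [intervalIntegral.integral_const_mul,
    intervalIntegral.integral_finsetSum fun j _ => Continuous.intervalIntegrable (hc i j) _ _,
    mulVec_one_apply]
  rfl

theorem matM_eq (m : RiskModel n) (hB : IsUnit m.B) (a : ℝ) :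
    m.matM a = -m.B⁻¹ - m.expB a * (a • (1 : Matrix (Fin n) (Fin n) ℝ) - m.B⁻¹) := by
  have hdet : IsUnit m.B.det := (Matrix.isUnit_iff_isUnit_det _).1 hB
  ext i j
  -- The antiderivative of `z e^{zB}(-B)` is `-z e^{zB} + e^{zB} B⁻¹`.
  have hd : ∀ z, HasDerivAt (fun z => -(z * m.expB z i j) + (m.expB z * m.B⁻¹) i j)
      (z * (m.expB z * (-m.B)) i j) z := fun z => by
    have h1 : HasDerivAt (fun z => (m.expB z * m.B⁻¹) i j) (m.expB z i j) z := by
      have e : m.expB z i j = ∑ k, (m.expB z * m.B) i k * m.B⁻¹ k j := by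
        rw [← Matrix.mul_apply, Matrix.mul_assoc, Matrix.mul_nonsing_inv _ hdet, Matrix.mul_one]
      have e' : (fun z => (m.expB z * m.B⁻¹) i j) = fun z => ∑ k, m.expB z i k * m.B⁻¹ k j := rfl
      rw [e, e']
      exact HasDerivAt.fun_sum fun k _ => (m.expB_apply_hasDerivAt i k z).mul_const _
    refine (((hasDerivAt_id z).mul (m.expB_apply_hasDerivAt i j z)).neg.add h1).congr_deriv ?_
    simp only [id_eq, Matrix.mul_neg, Matrix.neg_apply]
    ring
  have hc : Continuous fun z => z * (m.expB z * (-m.B)) i j := by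
    have hentry : ∀ i j, Continuous fun z => m.expB z i j := fun i j =>
      continuous_iff_continuousAt.2 fun z => (m.expB_apply_hasDerivAt i j z).continuousAt
    simp only [Matrix.mul_apply]
    fun_prop
  have := intervalIntegral.integral_eq_sub_of_hasDerivAt (a := 0) (b := a) (fun z _ => hd z)
    (hc.intervalIntegrable _ _)
  simp only [matM, Matrix.of_apply, this, Matrix.sub_apply, Matrix.neg_apply, Matrix.mul_sub,
    Matrix.mul_smul, Matrix.mul_one, Matrix.smul_apply, smul_eq_mul, expB_zero, Matrix.one_mul]
  ring

namespace Admissible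

variable {m : RiskModel n}

theorem W_eqOn (hm : m.Admissible) : EqOn m.W m.scaleFun (Ici 0) := fun _ hx => hm.W_eq_scaleFun hx

theorem halfConv_W (hm : m.Admissible) {p p' : ℝ → ℝ} {x : ℝ} (hx : 0 ≤ x)
    (hp : ∀ y ∈ Icc 0 x, p y = p' y) :
    ∫ y in (0 : ℝ)..x, m.W (x - y) * p y = halfConv m.scaleFun p' x :=
  halfConv_congr hx (fun _ hy => hm.W_eq_scaleFun hy.1) hp

/-- Through this identity every property of `C⃗` and its derivatives is read off the linear system.
It is used on `[0, ∞)` only, so derivatives at `0` are one-sided. -/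
theorem vecC_eq (hm : m.Admissible) {x : ℝ} (hx : 0 ≤ x) : m.vecC x = m.lam • m.scaleVec x := by
  have hentry : ∀ i j, Continuous fun z => m.expB z i j := fun i j =>
    continuous_iff_continuousAt.2 fun z => (m.expB_apply_hasDerivAt i j z).continuousAt
  ext j
  have h1 : m.scaleVec x j = halfConv m.scaleFun (m.expTail (Pi.single j 1)) x := by
    rw [← scaleVec_dotProduct, dotProduct_single, mul_one]
  have h2 : m.vecC x j = ∑ i, m.β i * (m.lam * halfConv m.scaleFun (fun y => m.expB y i j) x) := by
    rw [vecC, Matrix.vecMul, dotProduct]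
    refine Finset.sum_congr rfl fun i _ => ?_
    rw [matC, Matrix.of_apply, hm.halfConv_W hx fun _ _ => rfl]
  have h3 : ∀ y, m.expTail (Pi.single j 1) y = ∑ i, m.β i * m.expB y i j := fun y => by
    rw [← vecMul_expB_apply]; rfl
  rw [h2, Pi.smul_apply, smul_eq_mul, h1]
  unfold halfConv
  simp_rw [h3, Finset.mul_sum]
  rw [intervalIntegral.integral_finsetSum fun i _ => Continuous.intervalIntegrable
    (by fun_prop) _ _, Finset.mul_sum]
  refine Finset.sum_congr rfl fun i _ => ?_
  rw [← mul_assoc, mul_comm (m.β i), mul_assoc, ← intervalIntegral.integral_const_mul]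
  congr 2; ext y; ring

theorem vecC_dotProduct (hm : m.Admissible) {x : ℝ} (hx : 0 ≤ x) (w : Fin n → ℝ) :
    m.vecC x ⬝ᵥ w = m.lam * (m.scaleVec x ⬝ᵥ w) := by
  rw [hm.vecC_eq hx, smul_dotProduct, smul_eq_mul]

theorem vecC'_eq (hm : m.Admissible) {x : ℝ} (hx : 0 ≤ x) : m.vecC' x = m.lam • m.scaleVec' x := by
  refine HasDerivWithinAt.derivWithin ?_ (uniqueDiffOn_Ici 0 x hx)
  exact ((m.scaleVec_hasDerivAt x).const_smul m.lam).hasDerivWithinAt.congr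
    (fun _ hy => hm.vecC_eq hy) (hm.vecC_eq hx)

theorem vecC'_dotProduct (hm : m.Admissible) {x : ℝ} (hx : 0 ≤ x) (w : Fin n → ℝ) :
    m.vecC' x ⬝ᵥ w = m.lam * (m.scaleVec' x ⬝ᵥ w) := by
  rw [hm.vecC'_eq hx, smul_dotProduct, smul_eq_mul]

theorem vecC'_hasDerivWithinAt (hm : m.Admissible) {x : ℝ} (hx : 0 ≤ x) :
    HasDerivWithinAt m.vecC' (m.lam • m.scaleVec'' x) (Ici 0) x :=
  ((m.scaleVec'_hasDerivAt x).const_smul m.lam).hasDerivWithinAt.congr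
    (fun _ hy => hm.vecC'_eq hy) (hm.vecC'_eq hx)

theorem vecC''_dotProduct (hm : m.Admissible) {x : ℝ} (hx : 0 ≤ x) (w : Fin n → ℝ) :
    m.vecC'' x ⬝ᵥ w = m.lam * (m.scaleVec'' x ⬝ᵥ w) := by
  rw [vecC'', (hm.vecC'_hasDerivWithinAt hx).derivWithin (uniqueDiffOn_Ici 0 x hx),
    smul_dotProduct, smul_eq_mul]

theorem W'_eq (hm : m.Admissible) {x : ℝ} (hx : 0 ≤ x) : m.W' x = m.scaleFun' x := by
  refine HasDerivWithinAt.derivWithin ?_ (uniqueDiffOn_Ici 0 x hx)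
  exact (m.scaleFun_hasDerivAt x).hasDerivWithinAt.congr hm.W_eqOn (hm.W_eqOn hx)

theorem Z_eq (hm : m.Admissible) {x : ℝ} (hx : 0 ≤ x) : m.Z x = m.scaleZ x := by
  rw [Z, scaleZ]
  congr 2
  refine intervalIntegral.integral_congr fun y hy => ?_
  rw [uIcc_of_le hx] at hy
  exact hm.W_eq_scaleFun hy.1

theorem G_eq (hm : m.Admissible) (a : ℝ) {x : ℝ} (hx : 0 ≤ x) :
    m.G a x = m.lam * (m.scaleVec x ⬝ᵥ (m.matM a *ᵥ 1)) := by
  rw [G, hm.halfConv_W hx fun y _ => m.partialMean_eq a y, scaleVec_dotProduct]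

theorem S_eq (hm : m.Admissible) {a : ℝ} (ha : 0 ≤ a) {x : ℝ} (hx : 0 ≤ x) :
    m.S a x = m.scaleZ x + m.lam * (m.scaleVec x ⬝ᵥ (m.expB a *ᵥ 1)) := by
  rw [S, hm.Z_eq hx, hm.halfConv_W hx (p' := m.expTail (m.expB a *ᵥ 1)), scaleVec_dotProduct]
  intro y hy
  rw [← expTail_shift, add_comm, hm.survival_eq (add_nonneg hy.1 ha)]

theorem G_derivWithin (hm : m.Admissible) (a : ℝ) {x : ℝ} (hx : 0 ≤ x) :
    derivWithin (m.G a) (Ici 0) x = m.lam * (m.scaleVec' x ⬝ᵥ (m.matM a *ᵥ 1)) := by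
  refine HasDerivWithinAt.derivWithin ?_ (uniqueDiffOn_Ici 0 x hx)
  exact ((hasDerivAt_dotProduct_const (m.scaleVec_hasDerivAt x) _).const_mul
    m.lam).hasDerivWithinAt.congr (fun _ hy => hm.G_eq a hy) (hm.G_eq a hx)

theorem S_derivWithin (hm : m.Admissible) {a : ℝ} (ha : 0 ≤ a) {x : ℝ} (hx : 0 ≤ x) :
    derivWithin (m.S a) (Ici 0) x =
      m.q * m.scaleFun x + m.lam * (m.scaleVec' x ⬝ᵥ (m.expB a *ᵥ 1)) := by
  refine HasDerivWithinAt.derivWithin ?_ (uniqueDiffOn_Ici 0 x hx)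
  exact ((m.scaleZ_hasDerivAt x).add ((hasDerivAt_dotProduct_const (m.scaleVec_hasDerivAt x)
    _).const_mul m.lam)).hasDerivWithinAt.congr (fun _ hy => hm.S_eq ha hy) (hm.S_eq ha hx)

/-- After integration by parts the second term involves only `F̄(a+·) ≥ 0` and `w' > 0`, while `q w
> 0`. -/
theorem S_deriv_pos (hm : m.Admissible) {a : ℝ} (ha : 0 ≤ a) {x : ℝ} (hx : 0 ≤ x) :
    0 < m.q * m.scaleFun x + m.lam * (m.scaleVec' x ⬝ᵥ (m.expB a *ᵥ 1)) := by
  have h1 := mul_pos hm.q_pos (hm.scaleFun_pos hx)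
  have hp : ∀ y, 0 ≤ y → 0 ≤ m.expTail (m.expB a *ᵥ 1) y := fun y hy => by
    rw [← expTail_shift]; exact hm.expTail_one_nonneg (add_nonneg hy ha)
  have h2 : 0 ≤ m.scaleVec' x ⬝ᵥ (m.expB a *ᵥ 1) := by
    rw [scaleVec'_dotProduct, hm.scaleVec_deriv_ibp]
    refine add_nonneg (mul_nonneg (one_div_nonneg.2 hm.c_pos.le) (hp x hx)) ?_
    exact halfConv_nonneg hx (fun y hy => (hm.scaleFun'_pos hy.1).le) fun y hy => hp y hy.1.le
  exact add_pos_of_pos_of_nonneg h1 (mul_nonneg hm.lam_pos.le h2)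

theorem vecU_dotProduct (hm : m.Admissible) (w : Fin n → ℝ) :
    m.vecU ⬝ᵥ w = m.lam / (m.c - m.q / m.bigPhi) *
      ∫ z in Ioi 0, Real.exp (-m.bigPhi * z) * m.expTail w z := by
  have h1 : ∀ z, Real.exp (-m.bigPhi * z) * m.expTail w z =
      ∑ i, Real.exp (-m.bigPhi * z) * (m.β ᵥ* m.expB z) i * w i := fun z => by
    rw [expTail_eq_sum, Finset.mul_sum]
    simp_rw [mul_assoc]
  simp_rw [h1]
  have hint : ∀ i, IntegrableOn (fun z => Real.exp (-m.bigPhi * z) * (m.β ᵥ* m.expB z) i)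
      (Ioi 0) := fun i => by
    simp_rw [vecMul_expB_apply]
    exact hm.integrableOn_exp_mul_expTail _ hm.bigPhi_pos
  rw [integral_finsetSum _ fun i _ => (hint i).mul_const (w i), Finset.mul_sum]
  refine Finset.sum_congr rfl fun i _ => ?_
  rw [integral_mul_const, vecU]
  ring

theorem vecU_mul (hm : m.Admissible) (w : Fin n → ℝ) :
    (m.c - m.q / m.bigPhi) * (m.vecU ⬝ᵥ w) =
      m.lam * ∫ z in Ioi 0, Real.exp (-m.bigPhi * z) * m.expTail w z := by
  rw [hm.vecU_dotProduct, ← mul_assoc, mul_div_cancel₀ _ hm.laplace_survival_pos.ne']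

theorem vecU_dotProduct_one (hm : m.Admissible) : m.vecU ⬝ᵥ 1 = 1 := by
  have := hm.vecU_mul 1
  rw [hm.laplace_survival] at this
  exact mul_left_cancel₀ hm.laplace_survival_pos.ne' (this.trans (mul_one _).symm)

end Admissible

/-! ### The candidate for the ruin transform. -/

/-- The discounted probability `Ψ_q(x, y)` of ruin with a deficit above `y`, in terms of the scale
function. -/
def ruinFun (m : RiskModel n) (y x : ℝ) : ℝ :=
  (m.c - m.q / m.bigPhi) * (m.vecU ⬝ᵥ (m.expB y *ᵥ 1)) * m.scaleFun x
    - m.lam * (m.scaleVec x ⬝ᵥ (m.expB y *ᵥ 1))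

/-- The derivative of `ruinFun`. -/
def ruinFun' (m : RiskModel n) (y x : ℝ) : ℝ :=
  (m.c - m.q / m.bigPhi) * (m.vecU ⬝ᵥ (m.expB y *ᵥ 1)) * m.scaleFun' x
    - m.lam * (m.scaleVec' x ⬝ᵥ (m.expB y *ᵥ 1))

theorem ruinFun_hasDerivAt (m : RiskModel n) (y x : ℝ) :
    HasDerivAt (m.ruinFun y) (m.ruinFun' y x) x :=
  ((m.scaleFun_hasDerivAt x).const_mul _).sub
    ((hasDerivAt_dotProduct_const (m.scaleVec_hasDerivAt x) _).const_mul _)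

@[fun_prop]
theorem ruinFun_continuous (m : RiskModel n) (y : ℝ) : Continuous (m.ruinFun y) :=
  continuous_iff_continuousAt.2 fun x => (m.ruinFun_hasDerivAt y x).continuousAt

namespace Admissible

variable {m : RiskModel n}

theorem scaleVec'_eq (hm : m.Admissible) (w : Fin n → ℝ) {x : ℝ} (hx : 0 ≤ x) :
    m.c * (m.scaleVec' x ⬝ᵥ w) = m.expTail w x + (m.lam + m.q) * (m.scaleVec x ⬝ᵥ w)
        - m.lam * halfConv m.claimDensity (fun y => m.scaleVec y ⬝ᵥ w) x := by
  rw [scaleVec'_dotProduct, hm.scaleVec_renewal w hx]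

/-- A linear combination of the equations of `w` and of `v·(e^{yB}1)`. Only the latter has a source,
and that is the probability that a claim leads from `x` below `-y`. -/
theorem ruinFun_ode (hm : m.Admissible) (y : ℝ) {x : ℝ} (hx : 0 ≤ x) :
    m.c * m.ruinFun' y x = (m.lam + m.q) * m.ruinFun y x
      - m.lam * (halfConv m.claimDensity (m.ruinFun y) x + m.expTail 1 (x + y)) := by
  set K := (m.c - m.q / m.bigPhi) * (m.vecU ⬝ᵥ (m.expB y *ᵥ 1)) with hK
  have hf := hm.claimDensity_continuous
  have h1 : halfConv m.claimDensity (m.ruinFun y) x =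
      K * halfConv m.claimDensity m.scaleFun x +
        (-m.lam) * halfConv m.claimDensity (fun z => m.scaleVec z ⬝ᵥ (m.expB y *ᵥ 1)) x := by
    rw [← halfConv_const_mul_right, ← halfConv_const_mul_right, ← halfConv_add_right hf
      (by fun_prop) (by fun_prop)]
    congr 1; ext z; rw [ruinFun, ← hK]; ring
  have h2 := hm.scaleFun'_eq x
  have h3 := hm.scaleVec'_eq (m.expB y *ᵥ 1) hx
  rw [h1, ruinFun, ruinFun', ← hK, expTail_shift]
  rw [halfConv_comm] at h2
  linear_combination K * h2 - m.lam * h3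

/-- By `w(x-z) ≤ e^{-Φz} w(x)` the convolution is at most `w(x)` times the full Laplace integral at
`Φ`, which is the coefficient carried by `u`. -/
theorem halfConv_scaleFun_expTail_le (hm : m.Admissible) (w : Fin n → ℝ)
    (hw : ∀ z, 0 ≤ z → 0 ≤ m.expTail w z) {x : ℝ} (hx : 0 ≤ x) :
    0 ≤ (m.c - m.q / m.bigPhi) * (m.vecU ⬝ᵥ w) * m.scaleFun x - m.lam * (m.scaleVec x ⬝ᵥ w) := by
  have h := mul_le_mul_of_nonneg_left (hm.halfConv_scaleFun_le_Ioi (m.expTail_continuous w) hw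
    (hm.integrableOn_exp_mul_expTail w hm.bigPhi_pos) hx) hm.lam_pos.le
  rw [← scaleVec_dotProduct] at h
  rw [hm.vecU_mul]
  linarith

theorem ruinFun_nonneg (hm : m.Admissible) {y x : ℝ} (hy : 0 ≤ y) (hx : 0 ≤ x) :
    0 ≤ m.ruinFun y x :=
  hm.halfConv_scaleFun_expTail_le _ (fun z hz => by
    rw [← expTail_shift]; exact hm.expTail_one_nonneg (add_nonneg hz hy)) hx

/-- As survival decreases, the preceding positivity applied to `1 - e^{yB}1` reduces the claim to `y
= 0`. There the function is `Z - (q/Φ) w`, which is nonincreasing because `w' ≥ Φ w`, and at most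
`1` at `0`. -/
theorem ruinFun_le_one (hm : m.Admissible) {y x : ℝ} (hy : 0 ≤ y) (hx : 0 ≤ x) :
    m.ruinFun y x ≤ 1 := by
  have h1 := hm.halfConv_scaleFun_expTail_le (1 - m.expB y *ᵥ 1) (fun z hz => by
    rw [expTail_sub, ← expTail_shift, sub_nonneg]
    exact hm.expTail_one_antitone hz (add_nonneg hz hy) (by simpa using hy)) hx
  rw [dotProduct_sub, dotProduct_sub, hm.vecU_dotProduct_one] at h1
  have h2 := hm.c_mul_scaleFun x
  have h3 : m.scaleZ x - m.q / m.bigPhi * m.scaleFun x ≤ 1 := by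
    have hd : ∀ x, HasDerivAt (fun x => m.scaleZ x - m.q / m.bigPhi * m.scaleFun x)
        (m.q * m.scaleFun x - m.q / m.bigPhi * m.scaleFun' x) x := fun x =>
      (m.scaleZ_hasDerivAt x).sub ((m.scaleFun_hasDerivAt x).const_mul _)
    have hanti : AntitoneOn (fun x => m.scaleZ x - m.q / m.bigPhi * m.scaleFun x) (Ici 0) := by
      refine antitoneOn_of_deriv_nonpos (convex_Ici 0) (by fun_prop)
        (fun x _ => (hd x).differentiableAt.differentiableWithinAt) fun x hx => ?_
      rw [interior_Ici] at hx
      rw [(hd x).deriv]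
      have h4 := mul_le_mul_of_nonneg_left (hm.scaleFun'_ge (le_of_lt hx))
        (div_nonneg hm.q_pos.le hm.bigPhi_pos.le)
      rw [← mul_assoc, div_mul_cancel₀ _ hm.bigPhi_pos.ne'] at h4
      linarith
    have := hanti self_mem_Ici hx hx
    have h5 : 0 ≤ m.q / m.bigPhi * m.scaleFun 0 :=
      mul_nonneg (div_nonneg hm.q_pos.le hm.bigPhi_pos.le) (hm.scaleFun_pos le_rfl).le
    simp only [scaleZ_zero] at this
    linarith
  unfold ruinFun
  linarith

end Admissible

end RiskModel


/-! ### Discounted rewards along a chain driven by the claim epochs. -/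

theorem expMeasure_eq_withDensity_restrict (r : ℝ) :
    expMeasure r = (volume.restrict (Ioi (0 : ℝ))).withDensity
      fun t => ENNReal.ofReal (r * Real.exp (-r * t)) := by
  rw [← withDensity_indicator measurableSet_Ioi]
  refine withDensity_congr_ae ?_
  have h0 : ∀ᵐ t : ℝ ∂volume, t ≠ 0 := by simp [ae_iff]
  filter_upwards [h0] with t ht
  rcases lt_or_gt_of_ne ht with h | h
  · rw [indicator_of_notMem (by simpa using h.le)]
    exact exponentialPDF_of_neg h
  · rw [indicator_of_mem (by exact h), ← neg_mul_eq_neg_mul]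
    exact exponentialPDF_of_nonneg h.le

theorem expMeasure_ae_pos (r : ℝ) : ∀ᵐ t ∂expMeasure r, 0 < t := by
  rw [expMeasure_eq_withDensity_restrict]
  exact (withDensity_absolutelyContinuous _ _).ae_le (ae_restrict_mem measurableSet_Ioi)

theorem integral_expMeasure {r : ℝ} (hr : 0 < r) (φ : ℝ → ℝ) :
    ∫ t, φ t ∂expMeasure r = ∫ t in Ioi 0, r * Real.exp (-r * t) * φ t := by
  rw [expMeasure_eq_withDensity_restrict,
    integral_withDensity_eq_integral_toReal_smul (by fun_prop) (by simp)]
  refine setIntegral_congr_fun measurableSet_Ioi fun t _ => ?_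
  simp only [smul_eq_mul]
  rw [ENNReal.toReal_ofReal (by positivity)]

theorem integral_exp_expMeasure {r s : ℝ} (hr : 0 < r) (hs : 0 < s) :
    ∫ t, Real.exp (-s * t) ∂expMeasure r = r / (r + s) := by
  rw [integral_expMeasure hr]
  have h1 : ∀ t, r * Real.exp (-r * t) * Real.exp (-s * t) = r * Real.exp (-(r + s) * t) :=
    fun t => by rw [mul_assoc, ← Real.exp_add]; ring_nf
  simp_rw [h1]
  rw [integral_const_mul, integral_exp_mul_Ioi (by linarith)]
  rw [mul_zero, Real.exp_zero, neg_div_neg_eq, mul_one_div]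

/-- Summability and integrability of a series of integrable functions with summable norms. -/
theorem summable_and_integrable_tsum {Ω : Type*} [MeasurableSpace Ω] {P : Measure Ω}
    {F : ℕ → Ω → ℝ} (hF : ∀ i, Integrable (F i) P) (hs : Summable fun i => ∫ ω, ‖F i ω‖ ∂P) :
    (∀ᵐ ω ∂P, Summable fun i => F i ω) ∧ Integrable (fun ω => ∑' i, F i ω) P := by
  have hfin : ∫⁻ ω, ∑' i, ‖F i ω‖ₑ ∂P ≠ ⊤ := by
    rw [lintegral_tsum fun i => (hF i).1.enorm]
    have (i : ℕ) : ∫⁻ a, ‖F i a‖ₑ ∂P = ENNReal.ofReal (∫ a, ‖F i a‖ ∂P) := by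
      rw [ofReal_integral_norm_eq_lintegral_enorm (hF i)]
    simp_rw [this]
    exact hs.tsum_ofReal_ne_top
  have hsum : ∀ᵐ ω ∂P, Summable fun i => F i ω := by
    filter_upwards [ae_lt_top' (AEMeasurable.tsum fun i => (hF i).1.enorm) hfin] with ω hω
    refine Summable.of_norm ?_
    have : Summable fun i => ‖F i ω‖₊ := ENNReal.tsum_coe_ne_top_iff_summable.1 hω.ne
    exact NNReal.summable_coe.2 this
  refine ⟨hsum, ?_, ?_⟩
  · refine aestronglyMeasurable_of_tendsto_ae atTop
      (f := fun N ω => ∑ i ∈ Finset.range N, F i ω)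
      (fun N => Finset.aestronglyMeasurable_fun_sum _ fun i _ => (hF i).1) ?_
    filter_upwards [hsum] with ω hω
    exact hω.hasSum.tendsto_sum_nat
  · refine lt_of_le_of_lt (lintegral_mono fun ω => ?_) hfin.lt_top
    exact enorm_tsum_le_tsum_enorm

namespace RiskModel

variable {n : ℕ} {Ω : Type*}

/-- The controlled chain `Y_{j+1} = θ(Y_j, τ_j, ξ_j)` started from `y₀`. -/
def chain (θ : ℝ → ℝ → ℝ → ℝ) (τ ξ : ℕ → Ω → ℝ) (y₀ : ℝ) : ℕ → Ω → ℝ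
  | 0, _ => y₀
  | j + 1, ω => θ (chain θ τ ξ y₀ j ω) (τ j ω) (ξ j ω)

/-- The σ-algebra generated by the first `j` interarrival times and the first `j` claims. -/
abbrev past (τ ξ : ℕ → Ω → ℝ) (j : ℕ) : MeasurableSpace Ω :=
  ⨆ i ∈ {i : ℕ ⊕ ℕ | Sum.elim id id i < j},
    MeasurableSpace.comap (Sum.elim τ ξ i) (inferInstance : MeasurableSpace ℝ)

theorem past_mono (τ ξ : ℕ → Ω → ℝ) {i j : ℕ} (h : i ≤ j) : past τ ξ i ≤ past τ ξ j :=
  biSup_mono fun _ hk => lt_of_lt_of_le hk h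

theorem measurable_past (τ ξ : ℕ → Ω → ℝ) {i : ℕ ⊕ ℕ} {j : ℕ} (h : Sum.elim id id i < j) :
    Measurable[past τ ξ j] (Sum.elim τ ξ i) :=
  measurable_iff_comap_le.2 (le_iSup₂_of_le (f := fun i (_ : i ∈ {i : ℕ ⊕ ℕ |
    Sum.elim id id i < j}) => MeasurableSpace.comap (Sum.elim τ ξ i) inferInstance) i h le_rfl)

theorem arrival_measurable_past (τ ξ : ℕ → Ω → ℝ) (j : ℕ) :
    Measurable[past τ ξ j] (arrival τ j) := by
  refine Finset.measurable_fun_sum (m := past τ ξ j) _ fun i hi => ?_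
  exact measurable_past τ ξ (i := Sum.inl i) (Finset.mem_range.1 hi)

theorem chain_measurable_past {θ : ℝ → ℝ → ℝ → ℝ}
    (hθ : Measurable fun p : ℝ × ℝ × ℝ => θ p.1 p.2.1 p.2.2) (τ ξ : ℕ → Ω → ℝ) (y₀ : ℝ) (j : ℕ) :
    Measurable[past τ ξ j] (chain θ τ ξ y₀ j) := by
  induction j with
  | zero => exact measurable_const
  | succ j ih =>
    have h1 : Measurable[past τ ξ (j + 1)] (chain θ τ ξ y₀ j) :=
      ih.mono (past_mono τ ξ j.le_succ) le_rfl
    have h2 : Measurable[past τ ξ (j + 1)] (τ j) :=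
      measurable_past τ ξ (i := Sum.inl j) j.lt_succ_self
    have h3 : Measurable[past τ ξ (j + 1)] (ξ j) :=
      measurable_past τ ξ (i := Sum.inr j) j.lt_succ_self
    exact hθ.comp (h1.prodMk (h2.prodMk h3))

theorem arrival_succ (τ : ℕ → Ω → ℝ) (j : ℕ) (ω : Ω) :
    arrival τ (j + 1) ω = arrival τ j ω + τ j ω := Finset.sum_range_succ _ _

theorem arrival_nonneg {τ : ℕ → Ω → ℝ} {ω : Ω} (h : ∀ j, 0 < τ j ω) (j : ℕ) :
    0 ≤ arrival τ j ω := Finset.sum_nonneg fun i _ => (h i).le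

variable [MeasurableSpace Ω] {P : Measure Ω} {τ ξ : ℕ → Ω → ℝ} {m : RiskModel n}

namespace IsClaimModel

theorem measurable_elim (hX : m.IsClaimModel P τ ξ) (i : ℕ ⊕ ℕ) :
    Measurable (Sum.elim τ ξ i) := by
  cases i
  · exact hX.measurable_τ _
  · exact hX.measurable_ξ _

theorem past_le (hX : m.IsClaimModel P τ ξ) (j : ℕ) :
    past τ ξ j ≤ (inferInstance : MeasurableSpace Ω) :=
  iSup₂_le fun i _ => measurable_iff_comap_le.1 (hX.measurable_elim i)

theorem measurable_arrival (hX : m.IsClaimModel P τ ξ) (j : ℕ) : Measurable (arrival τ j) :=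
  (arrival_measurable_past τ ξ j).mono (hX.past_le j) le_rfl

theorem measurable_chain (hX : m.IsClaimModel P τ ξ) {θ : ℝ → ℝ → ℝ → ℝ}
    (hθ : Measurable fun p : ℝ × ℝ × ℝ => θ p.1 p.2.1 p.2.2) (y₀ : ℝ) (j : ℕ) :
    Measurable (chain θ τ ξ y₀ j) :=
  (chain_measurable_past hθ τ ξ y₀ j).mono (hX.past_le j) le_rfl

theorem τ_pos (hX : m.IsClaimModel P τ ξ) : ∀ᵐ ω ∂P, ∀ j, 0 < τ j ω := by
  refine ae_all_iff.2 fun j => ?_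
  refine ae_of_ae_map (hX.measurable_τ j).aemeasurable (p := fun t => 0 < t) ?_
  rw [hX.law_τ j]
  exact expMeasure_ae_pos _

/-- The next interarrival time and claim are independent of the past. -/
theorem map_past_prod [IsProbabilityMeasure P] (hX : m.IsClaimModel P τ ξ)
    {Y : Ω → ℝ × ℝ} {j : ℕ} (hY : Measurable[past τ ξ j] Y) :
    P.map (fun ω => (Y ω, (τ j ω, ξ j ω))) =
      (P.map Y).prod ((expMeasure m.lam).prod m.claimLaw) := by
  have hY' : Measurable Y := hY.mono (hX.past_le j) le_rfl
  have hind : Y ⟂ᵢ[P] (fun ω => (τ j ω, ξ j ω)) := by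
    rw [IndepFun_iff_Indep]
    -- The past uses the variables with index below `j`; the new waiting time and claim have index
    -- `j`.
    have hdisj : Disjoint {i : ℕ ⊕ ℕ | Sum.elim id id i < j} {Sum.inl j, Sum.inr j} := by
      rw [Set.disjoint_left]
      rintro i hi (rfl | rfl) <;> simp at hi
    have h0 := indep_iSup_of_disjoint
      (fun i => measurable_iff_comap_le.1 (hX.measurable_elim i)) hX.indep.iIndep hdisj
    refine indep_of_indep_of_le_left (indep_of_indep_of_le_right h0 ?_)
      (measurable_iff_comap_le.1 hY)
    refine measurable_iff_comap_le.1 ?_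
    set M := ⨆ i ∈ ({Sum.inl j, Sum.inr j} : Set (ℕ ⊕ ℕ)),
      MeasurableSpace.comap (Sum.elim τ ξ i) (inferInstance : MeasurableSpace ℝ)
    have h1 : Measurable[M] (τ j) := measurable_iff_comap_le.2
      (le_iSup₂_of_le (f := fun i (_ : i ∈ ({Sum.inl j, Sum.inr j} : Set (ℕ ⊕ ℕ))) =>
        MeasurableSpace.comap (Sum.elim τ ξ i) inferInstance) (Sum.inl j) (by simp) le_rfl)
    have h2 : Measurable[M] (ξ j) := measurable_iff_comap_le.2
      (le_iSup₂_of_le (f := fun i (_ : i ∈ ({Sum.inl j, Sum.inr j} : Set (ℕ ⊕ ℕ))) =>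
        MeasurableSpace.comap (Sum.elim τ ξ i) inferInstance) (Sum.inr j) (by simp) le_rfl)
    exact h1.prodMk h2
  have hτξ : τ j ⟂ᵢ[P] ξ j := hX.indep.indepFun (i := Sum.inl j) (j := Sum.inr j) (by simp)
  rw [(indepFun_iff_map_prod_eq_prod_map_map hY'.aemeasurable
    ((hX.measurable_τ j).prodMk (hX.measurable_ξ j)).aemeasurable).1 hind,
    (indepFun_iff_map_prod_eq_prod_map_map (hX.measurable_τ j).aemeasurable
    (hX.measurable_ξ j).aemeasurable).1 hτξ, hX.law_τ, hX.law_ξ]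

end IsClaimModel

section Telescoping

variable {θ r : ℝ → ℝ → ℝ → ℝ} {K : ℝ}

/-- One step of the chain: integrate out the next interarrival time and the next claim. -/
theorem integral_discounted_step [IsProbabilityMeasure P] (hm : m.Admissible)
    (hX : m.IsClaimModel P τ ξ) (hθ : Measurable fun p : ℝ × ℝ × ℝ => θ p.1 p.2.1 p.2.2)
    (hr : Measurable fun p : ℝ × ℝ × ℝ => r p.1 p.2.1 p.2.2)
    (hK : ∀ y t z, 0 ≤ t → |r y t z| ≤ K) (y₀ : ℝ) (j : ℕ) :
    Integrable (fun ω => Real.exp (-m.q * arrival τ j ω) *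
        r (chain θ τ ξ y₀ j ω) (τ j ω) (ξ j ω)) P ∧
      ∫ ω, Real.exp (-m.q * arrival τ j ω) * r (chain θ τ ξ y₀ j ω) (τ j ω) (ξ j ω) ∂P =
        ∫ ω, Real.exp (-m.q * arrival τ j ω) *
          (∫ t, ∫ z, r (chain θ τ ξ y₀ j ω) t z ∂m.claimLaw ∂expMeasure m.lam) ∂P := by
  have := hm.isProbabilityMeasure_claimLaw
  have := isProbabilityMeasure_expMeasure hm.lam_pos
  have hTm := hX.measurable_arrival j
  have hYm := hX.measurable_chain hθ y₀ j
  have hτm := hX.measurable_τ j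
  have hξm := hX.measurable_ξ j
  have hr1 : Measurable fun ω => r (chain θ τ ξ y₀ j ω) (τ j ω) (ξ j ω) :=
    hr.comp (hYm.prodMk (hτm.prodMk hξm))
  have hint : Integrable (fun ω => Real.exp (-m.q * arrival τ j ω) *
        r (chain θ τ ξ y₀ j ω) (τ j ω) (ξ j ω)) P := by
    refine Integrable.mono' (integrable_const K)
      (Measurable.aestronglyMeasurable (by fun_prop)) ?_
    filter_upwards [hX.τ_pos] with ω hω
    rw [Real.norm_eq_abs, abs_mul, abs_of_pos (Real.exp_pos _)]
    have h1 : Real.exp (-m.q * arrival τ j ω) ≤ 1 := Real.exp_le_one_iff.2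
      (by nlinarith [arrival_nonneg hω j, hm.q_pos])
    have h2 := hK (chain θ τ ξ y₀ j ω) (τ j ω) (ξ j ω) (hω j).le
    nlinarith [abs_nonneg (r (chain θ τ ξ y₀ j ω) (τ j ω) (ξ j ω)), Real.exp_pos (-m.q * arrival τ j ω)]
  refine ⟨hint, ?_⟩
  -- Discount and state are functions of the past, so the joint law with the next step is a product
  -- and Fubini integrates that step out.
  set Y : Ω → ℝ × ℝ := fun ω => (arrival τ j ω, chain θ τ ξ y₀ j ω) with hYdef
  have hY : Measurable[past τ ξ j] Y :=
    (arrival_measurable_past τ ξ j).prodMk (chain_measurable_past hθ τ ξ y₀ j)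
  have hY' : Measurable Y := hTm.prodMk hYm
  have hmap := hX.map_past_prod hY
  set g : (ℝ × ℝ) × (ℝ × ℝ) → ℝ := fun p => Real.exp (-m.q * p.1.1) * r p.1.2 p.2.1 p.2.2 with hg
  have hgm : Measurable g := by
    refine Measurable.mul (by fun_prop) ?_
    exact hr.comp (f := fun p : (ℝ × ℝ) × (ℝ × ℝ) => (p.1.2, p.2.1, p.2.2)) (by fun_prop)
  have hJm : Measurable fun ω => (Y ω, (τ j ω, ξ j ω)) := hY'.prodMk (hτm.prodMk hξm)
  have hgi : Integrable g ((P.map Y).prod ((expMeasure m.lam).prod m.claimLaw)) := by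
    rw [← hmap, integrable_map_measure hgm.aestronglyMeasurable hJm.aemeasurable]
    exact hint
  have e1 : ∫ ω, Real.exp (-m.q * arrival τ j ω) * r (chain θ τ ξ y₀ j ω) (τ j ω) (ξ j ω) ∂P =
      ∫ p, g p ∂(P.map Y).prod ((expMeasure m.lam).prod m.claimLaw) := by
    rw [← hmap, integral_map hJm.aemeasurable hgm.aestronglyMeasurable]
  have := Measure.isProbabilityMeasure_map (μ := P) hY'.aemeasurable
  rw [e1, integral_prod _ hgi, integral_map hY'.aemeasurable
    hgi.aestronglyMeasurable.integral_prod_right']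
  refine integral_congr_ae (.of_forall fun ω => ?_)
  simp only [hg, hYdef]
  rw [integral_const_mul]
  congr 1
  refine integral_prod (fun p : ℝ × ℝ => r (chain θ τ ξ y₀ j ω) p.1 p.2) ?_
  refine Integrable.mono' (integrable_const K) (Measurable.aestronglyMeasurable
    (hr.comp (f := fun p : ℝ × ℝ => (chain θ τ ξ y₀ j ω, p.1, p.2)) (by fun_prop))) ?_
  have hpos : ∀ᵐ p ∂(expMeasure m.lam).prod m.claimLaw, 0 < p.1 :=
    Measure.quasiMeasurePreserving_fst.ae (expMeasure_ae_pos m.lam)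
  filter_upwards [hpos] with p hp
  exact hK _ _ _ hp.le

theorem integral_exp_arrival [IsProbabilityMeasure P] (hm : m.Admissible)
    (hX : m.IsClaimModel P τ ξ) (j : ℕ) :
    Integrable (fun ω => Real.exp (-m.q * arrival τ j ω)) P ∧
    ∫ ω, Real.exp (-m.q * arrival τ j ω) ∂P = (m.lam / (m.lam + m.q)) ^ j := by
  have := hm.isProbabilityMeasure_claimLaw
  -- A chain that never moves: reward `1` gives integrability, and reward `e^{-qt}` below gives the
  -- recursion with factor `λ/(λ+q)`.
  have hconst := fun j => (integral_discounted_step (θ := fun y _ _ => y) (r := fun _ _ _ => 1)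
    (K := 1) hm hX (by fun_prop) (by fun_prop) (fun _ _ _ _ => by simp) 0 j).1
  simp only [mul_one] at hconst
  refine ⟨hconst j, ?_⟩
  induction j with
  | zero => simp [arrival]
  | succ j ih =>
    have h := (integral_discounted_step (θ := fun y _ _ => y)
      (r := fun _ t _ => Real.exp (-m.q * t))
      (K := 1) hm hX (by fun_prop) (by fun_prop) (fun _ t _ ht => by
        rw [abs_of_pos (Real.exp_pos _), Real.exp_le_one_iff]; nlinarith [hm.q_pos]) 0 j).2
    simp only [integral_const, probReal_univ, one_smul] at h
    rw [integral_exp_expMeasure hm.lam_pos hm.q_pos, integral_mul_const, ih] at h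
    rw [pow_succ, ← h]
    congr 1; ext ω
    rw [arrival_succ, ← Real.exp_add]; ring_nf

theorem summable_discount (hm : m.Admissible) :
    Summable fun j : ℕ => (m.lam / (m.lam + m.q)) ^ j :=
  summable_geometric_of_lt_one (div_nonneg hm.lam_pos.le (add_nonneg hm.lam_pos.le hm.q_pos.le))
    ((div_lt_one (add_pos hm.lam_pos hm.q_pos)).2 (by linarith [hm.q_pos]))

theorem ae_summable_exp_arrival [IsProbabilityMeasure P] (hm : m.Admissible)
    (hX : m.IsClaimModel P τ ξ) :
    ∀ᵐ ω ∂P, Summable fun j => Real.exp (-m.q * arrival τ j ω) := by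
  refine (summable_and_integrable_tsum (fun j => (integral_exp_arrival hm hX j).1) ?_).1
  simp_rw [Real.norm_eq_abs, abs_of_pos (Real.exp_pos _), (integral_exp_arrival hm hX _).2]
  exact summable_discount hm

/-- The terms of the a.s. convergent series `∑ e^{-qT_j}` tend to `0`. -/
theorem ae_tendsto_arrival [IsProbabilityMeasure P] (hm : m.Admissible)
    (hX : m.IsClaimModel P τ ξ) :
    ∀ᵐ ω ∂P, Tendsto (fun j => arrival τ j ω) atTop atTop := by
  filter_upwards [ae_summable_exp_arrival hm hX] with ω hω
  have h := hω.tendsto_atTop_zero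
  have h2 : Tendsto (fun j => -m.q * arrival τ j ω) atTop atBot :=
    Real.tendsto_exp_comp_nhds_zero.1 h
  have h3 := h2.const_mul_atBot_of_neg (r := -(1 / m.q)) (by
    have := hm.q_pos; simp [this])
  refine h3.congr fun j => ?_
  have := hm.q_pos.ne'
  field_simp

/-- The value of a discounted sum of rewards along the chain is the bounded solution of the
one-step equation. -/
theorem integral_tsum_discounted_rewards [IsProbabilityMeasure P] (hm : m.Admissible)
    (hX : m.IsClaimModel P τ ξ) {H : ℝ → ℝ}
    (hθ : Measurable fun p : ℝ × ℝ × ℝ => θ p.1 p.2.1 p.2.2)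
    (hr : Measurable fun p : ℝ × ℝ × ℝ => r p.1 p.2.1 p.2.2) (hH : Measurable H)
    (hrK : ∀ y t z, 0 ≤ t → |r y t z| ≤ K) (hHK : ∀ y, |H y| ≤ K)
    (hstep : ∀ y, ∫ t, ∫ z, (r y t z + Real.exp (-m.q * t) * H (θ y t z))
      ∂m.claimLaw ∂expMeasure m.lam = H y) (y₀ : ℝ) :
    Integrable (fun ω => ∑' j, Real.exp (-m.q * arrival τ j ω) *
        r (chain θ τ ξ y₀ j ω) (τ j ω) (ξ j ω)) P ∧
      ∫ ω, ∑' j, Real.exp (-m.q * arrival τ j ω) *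
        r (chain θ τ ξ y₀ j ω) (τ j ω) (ξ j ω) ∂P = H y₀ := by
  have hq := hm.q_pos
  set F : ℕ → Ω → ℝ := fun j ω => Real.exp (-m.q * arrival τ j ω) *
        r (chain θ τ ξ y₀ j ω) (τ j ω) (ξ j ω) with hF
  have hFi : ∀ j, Integrable (F j) P := fun j =>
    (integral_discounted_step hm hX hθ hr hrK y₀ j).1
  have hHi : ∀ j, Integrable (fun ω => Real.exp (-m.q * arrival τ j ω) *
      H (chain θ τ ξ y₀ j ω)) P := fun j =>
    (integral_discounted_step (r := fun y _ _ => H y) hm hX hθ (hH.comp measurable_fst)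
      (fun y _ _ _ => hHK y) y₀ j).1
  have hK0 : 0 ≤ K := (abs_nonneg _).trans (hHK 0)
  have hsum : Summable fun j => ∫ ω, ‖F j ω‖ ∂P := by
    refine Summable.of_nonneg_of_le (fun j => integral_nonneg fun _ => norm_nonneg _)
      (fun j => ?_) ((summable_discount hm).mul_right K)
    rw [← (integral_exp_arrival hm hX j).2, ← integral_mul_const]
    refine integral_mono_ae (hFi j).norm ((integral_exp_arrival hm hX j).1.mul_const K) ?_
    filter_upwards [hX.τ_pos] with ω hω
    simp only [hF, norm_mul, Real.norm_eq_abs, abs_of_pos (Real.exp_pos _)]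
    exact mul_le_mul_of_nonneg_left (hrK _ _ _ (hω j).le) (Real.exp_pos _).le
  refine ⟨(summable_and_integrable_tsum hFi hsum).2, ?_⟩
  -- The one-step equation makes each expected reward a difference of consecutive discounted values
  -- of `H`, so the sums telescope.
  have hstep' : ∀ j, ∫ ω, F j ω ∂P = ∫ ω, Real.exp (-m.q * arrival τ j ω) *
      H (chain θ τ ξ y₀ j ω) ∂P - ∫ ω, Real.exp (-m.q * arrival τ (j + 1) ω) *
      H (chain θ τ ξ y₀ (j + 1) ω) ∂P := fun j => by
    have h := (integral_discounted_step (K := K + K) (θ := θ)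
      (r := fun y t z => r y t z + Real.exp (-m.q * t) * H (θ y t z)) hm hX hθ
      (hr.add (Measurable.mul (by fun_prop) (hH.comp hθ))) (fun y t z ht => by
        refine (abs_add_le _ _).trans (add_le_add (hrK y t z ht) ?_)
        rw [abs_mul, abs_of_pos (Real.exp_pos _)]
        have h1 : Real.exp (-m.q * t) ≤ 1 := Real.exp_le_one_iff.2 (by nlinarith)
        have h2 := hHK (θ y t z)
        nlinarith [abs_nonneg (H (θ y t z)), Real.exp_pos (-m.q * t)]) y₀ j).2
    simp_rw [hstep] at h
    rw [← h, eq_sub_iff_add_eq, ← integral_add (hFi j) (hHi (j + 1))]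
    congr 1; ext ω
    simp only [hF, chain, arrival_succ]
    rw [show -m.q * (arrival τ j ω + τ j ω) = -m.q * arrival τ j ω + -m.q * τ j ω by ring,
      Real.exp_add]
    ring
  have hhas := hasSum_integral_of_summable_integral_norm hFi hsum
  have htend := hhas.tendsto_sum_nat
  have hpartial : ∀ N, ∑ j ∈ Finset.range N, ∫ ω, F j ω ∂P = H y₀ -
      ∫ ω, Real.exp (-m.q * arrival τ N ω) * H (chain θ τ ξ y₀ N ω) ∂P := fun N => by
    simp_rw [hstep']
    rw [Finset.sum_range_sub']
    simp [arrival, chain]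
  simp_rw [hpartial] at htend
  -- The remainder is at most `K (λ/(λ+q))^N`; this is where boundedness of `H` singles out the
  -- right solution.
  have hzero : Tendsto (fun N => ∫ ω, Real.exp (-m.q * arrival τ N ω) *
      H (chain θ τ ξ y₀ N ω) ∂P) atTop (𝓝 0) := by
    refine squeeze_zero_norm (a := fun N => (m.lam / (m.lam + m.q)) ^ N * K) (fun N => ?_) ?_
    · rw [← (integral_exp_arrival hm hX N).2, ← integral_mul_const]
      refine norm_integral_le_of_norm_le ((integral_exp_arrival hm hX N).1.mul_const K)
        (.of_forall fun ω => ?_)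
      rw [norm_mul, Real.norm_eq_abs, Real.norm_eq_abs, abs_of_pos (Real.exp_pos _)]
      exact mul_le_mul_of_nonneg_left (hHK _) (Real.exp_pos _).le
    · simpa using (summable_discount hm).tendsto_atTop_zero.mul_const K
  have := tendsto_nhds_unique htend (tendsto_const_nhds.sub hzero)
  rw [sub_zero] at this
  exact this

end Telescoping

end RiskModel

/-! ### The ruin transform. -/

namespace RiskModel

variable {n : ℕ} {Ω : Type*}

namespace Admissible

variable {m : RiskModel n}

theorem integral_claimLaw_indicator (hm : m.Admissible) (g : ℝ → ℝ) {w : ℝ} (hw : 0 ≤ w) :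
    ∫ z, (Ici 0).indicator g (w - z) ∂m.claimLaw = halfConv m.claimDensity g w := by
  rw [hm.integral_claimLaw, halfConv_comm, halfConv, intervalIntegral.integral_of_le hw,
    ← integral_indicator measurableSet_Ioi, ← integral_indicator measurableSet_Ioc]
  congr 1; ext z
  simp only [indicator, mem_Ioi, mem_Ioc, mem_Ici, sub_nonneg]
  by_cases h1 : 0 < z <;> by_cases h2 : z ≤ w <;> simp [h1, h2, mul_comm]

theorem integrable_claimLaw_indicator (hm : m.Admissible) {g : ℝ → ℝ} (hg : Continuous g) {w : ℝ} :
    Integrable (fun z => (Ici 0).indicator g (w - z)) m.claimLaw := by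
  have := hm.isProbabilityMeasure_claimLaw
  obtain ⟨K, hK⟩ := (isCompact_Icc (a := (0 : ℝ)) (b := w)).exists_bound_of_continuousOn
    hg.continuousOn
  refine Integrable.mono' (integrable_const |K|) ?_ ?_
  · exact ((hg.measurable.indicator measurableSet_Ici).comp
      (measurable_const.sub measurable_id)).aestronglyMeasurable
  · filter_upwards [hm.claimLaw_ae_pos] with z hz
    by_cases h : z ≤ w
    · rw [indicator_of_mem (by simpa using h)]
      exact (hK _ ⟨by linarith, by linarith⟩).trans (le_abs_self K)
    · rw [indicator_of_notMem (by simpa using h), norm_zero]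
      exact abs_nonneg K

end Admissible

/-- The uncontrolled surplus stopped at its first negative value after a claim. -/
def ruinStep (m : RiskModel n) (u t z : ℝ) : ℝ := if u < 0 then u else u + m.c * t - z

/-- The discount factor collected when the next claim ruins with a deficit above `y`. -/
def ruinReward (m : RiskModel n) (y u t z : ℝ) : ℝ :=
  if u < 0 then 0 else if u + m.c * t - z < -y then Real.exp (-m.q * t) else 0

namespace Admissible

variable {m : RiskModel n}

/-- With the claim integrated out, `ruinFun_ode` makes the integrand in the waiting time `t` the
derivative of `-e^{-(λ+q)t} ruinFun(u+ct)`. It is nonnegative, so it is integrable, and the boundary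
term at infinity vanishes because `ruinFun` lies in `[0,1]`. A negative state is absorbing and worth
`0`. -/
theorem ruin_one_step (hm : m.Admissible) {y : ℝ} (hy : 0 ≤ y) (u : ℝ) :
    ∫ t, ∫ z, (m.ruinReward y u t z +
        Real.exp (-m.q * t) * (Ici 0).indicator (m.ruinFun y) (m.ruinStep u t z))
      ∂m.claimLaw ∂expMeasure m.lam = (Ici 0).indicator (m.ruinFun y) u := by
  have := hm.isProbabilityMeasure_claimLaw
  have hc := hm.c_pos
  have hf := hm.claimDensity_continuous
  rcases lt_or_ge u 0 with hu | hu
  · simp [ruinReward, ruinStep, hu]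
  rw [indicator_of_mem (by exact hu), integral_expMeasure hm.lam_pos]
  have hinner : ∀ t, 0 < t → ∫ z, (m.ruinReward y u t z +
        Real.exp (-m.q * t) * (Ici 0).indicator (m.ruinFun y) (m.ruinStep u t z))
      ∂m.claimLaw = Real.exp (-m.q * t) * (m.expTail 1 (u + m.c * t + y) +
        halfConv m.claimDensity (m.ruinFun y) (u + m.c * t)) := by
    intro t ht
    have hw : 0 ≤ u + m.c * t := by positivity
    have h1 : ∀ z, m.ruinReward y u t z +
        Real.exp (-m.q * t) * (Ici 0).indicator (m.ruinFun y) (m.ruinStep u t z) =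
        Real.exp (-m.q * t) * ((Ioi (u + m.c * t + y)).indicator (fun _ => (1 : ℝ)) z +
          (Ici 0).indicator (m.ruinFun y) (u + m.c * t - z)) := fun z => by
      rw [ruinReward, ruinStep, if_neg (not_lt.2 hu), if_neg (not_lt.2 hu), mul_add]
      congr 1
      by_cases h : u + m.c * t - z < -y
      · rw [if_pos h, indicator_of_mem (by simp only [mem_Ioi]; linarith), mul_one]
      · rw [if_neg h, indicator_of_notMem (by simp only [mem_Ioi]; linarith), mul_zero]
    simp_rw [h1]
    rw [integral_const_mul, integral_add ((integrable_const _).indicator measurableSet_Ioi)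
      (hm.integrable_claimLaw_indicator (by fun_prop)), integral_indicator_const _ measurableSet_Ioi,
      hm.integral_claimLaw_indicator _ hw, smul_eq_mul, mul_one]
    congr 2
    exact hm.survival_eq (add_nonneg hw hy)
  have hderiv : ∀ t ∈ Ici (0 : ℝ), HasDerivAt
      (fun t => -(Real.exp (-(m.lam + m.q) * t) * m.ruinFun y (u + m.c * t)))
      (m.lam * Real.exp (-m.lam * t) * (Real.exp (-m.q * t) * (m.expTail 1 (u + m.c * t + y) +
        halfConv m.claimDensity (m.ruinFun y) (u + m.c * t)))) t := by
    intro t ht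
    have hw : 0 ≤ u + m.c * t := add_nonneg hu (mul_nonneg hc.le ht)
    have h1 : HasDerivAt (fun t => Real.exp (-(m.lam + m.q) * t))
        (Real.exp (-(m.lam + m.q) * t) * (-(m.lam + m.q))) t := by
      simpa using ((hasDerivAt_id t).const_mul (-(m.lam + m.q))).exp
    have h2 : HasDerivAt (fun t => m.ruinFun y (u + m.c * t)) (m.ruinFun' y (u + m.c * t) * m.c) t := by
      have h0 : HasDerivAt (fun t => u + m.c * t) m.c t := by
        simpa using ((hasDerivAt_id t).const_mul m.c).const_add u
      exact HasDerivAt.comp (h := fun t => u + m.c * t) t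
        (m.ruinFun_hasDerivAt y (u + m.c * t)) h0
    refine (h1.mul h2).neg.congr_deriv ?_
    have h3 := hm.ruinFun_ode y hw
    rw [show -(m.lam + m.q) * t = -m.lam * t + -m.q * t by ring, Real.exp_add]
    linear_combination -(Real.exp (-m.lam * t) * Real.exp (-m.q * t)) * h3
  have hnonneg : ∀ t ∈ Ioi (0 : ℝ), 0 ≤ m.lam * Real.exp (-m.lam * t) *
      (Real.exp (-m.q * t) * (m.expTail 1 (u + m.c * t + y) +
        halfConv m.claimDensity (m.ruinFun y) (u + m.c * t))) := by
    intro t ht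
    have hw : 0 ≤ u + m.c * t := add_nonneg hu (mul_nonneg hc.le (le_of_lt ht))
    have h1 := hm.expTail_one_nonneg (add_nonneg hw hy)
    have h2 : 0 ≤ halfConv m.claimDensity (m.ruinFun y) (u + m.c * t) :=
      halfConv_nonneg hw (fun z hz => hm.density_nonneg z hz.1)
        fun z hz => hm.ruinFun_nonneg hy hz.1.le
    have := hm.lam_pos
    positivity
  have hlim : Tendsto (fun t => -(Real.exp (-(m.lam + m.q) * t) * m.ruinFun y (u + m.c * t)))
      atTop (𝓝 (-0)) := by
    refine Tendsto.neg ?_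
    have h1 : Tendsto (fun t : ℝ => Real.exp (-(m.lam + m.q) * t)) atTop (𝓝 0) :=
      Real.tendsto_exp_atBot.comp (tendsto_id.const_mul_atTop_of_neg
        (by linarith [hm.lam_pos, hm.q_pos]))
    refine squeeze_zero' ?_ ?_ h1
    · filter_upwards [eventually_ge_atTop 0] with t ht
      exact mul_nonneg (Real.exp_pos _).le (hm.ruinFun_nonneg hy (by positivity))
    · filter_upwards [eventually_ge_atTop 0] with t ht
      exact mul_le_of_le_one_right (Real.exp_pos _).le (hm.ruinFun_le_one hy (by positivity))
  have key := integral_Ioi_of_hasDerivAt_of_nonneg' hderiv hnonneg hlim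
  rw [setIntegral_congr_fun measurableSet_Ioi fun t ht => by rw [hinner t ht], key]
  simp

end Admissible

/-! ### Paths of the surplus -/

theorem arrival_zero (τ : ℕ → Ω → ℝ) (ω : Ω) : arrival τ 0 ω = 0 := by simp [arrival]

theorem arrival_strictMono {τ : ℕ → Ω → ℝ} {ω : Ω} (h : ∀ j, 0 < τ j ω) :
    StrictMono fun j => arrival τ j ω :=
  strictMono_nat_of_lt_succ fun j => by rw [arrival_succ]; linarith [h j]

theorem exists_arrival_le_lt {τ : ℕ → Ω → ℝ} {ω : Ω}
    (hT : Tendsto (fun j => arrival τ j ω) atTop atTop) {t : ℝ} (ht : 0 ≤ t) :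
    ∃ j, arrival τ j ω ≤ t ∧ t < arrival τ (j + 1) ω := by
  classical
  have hex : ∃ j, t < arrival τ j ω := (hT.eventually_gt_atTop t).exists
  have h1 := Nat.find_spec hex
  obtain ⟨j, hj⟩ : ∃ j, Nat.find hex = j + 1 := Nat.exists_eq_succ_of_ne_zero fun h0 => by
    rw [h0, arrival_zero] at h1; linarith
  rw [hj] at h1
  exact ⟨j, not_lt.1 (Nat.find_min hex (m := j) (by omega)), h1⟩

/-- The uncontrolled surplus right after the claim number `j`. -/
def claimSurplus (m : RiskModel n) (τ ξ : ℕ → Ω → ℝ) (x : ℝ) (j : ℕ) (ω : Ω) : ℝ :=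
  x + m.c * arrival τ j ω - ∑ i ∈ Finset.range j, ξ i ω

theorem claimSurplus_succ (m : RiskModel n) (τ ξ : ℕ → Ω → ℝ) (x : ℝ) (j : ℕ) (ω : Ω) :
    m.claimSurplus τ ξ x (j + 1) ω = m.claimSurplus τ ξ x j ω + m.c * τ j ω - ξ j ω := by
  rw [claimSurplus, claimSurplus, arrival_succ, Finset.sum_range_succ]; ring

theorem surplus_eq (m : RiskModel n) {τ ξ : ℕ → Ω → ℝ} {ω : Ω} (h : ∀ j, 0 < τ j ω) (x : ℝ)
    {t : ℝ} {j : ℕ} (h1 : arrival τ j ω ≤ t) (h2 : t < arrival τ (j + 1) ω) :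
    m.surplus τ ξ x t ω = m.claimSurplus τ ξ x j ω + m.c * (t - arrival τ j ω) := by
  have hmono := arrival_strictMono h
  rw [surplus, tsum_eq_sum (s := Finset.range j)]
  · rw [claimSurplus, Finset.sum_congr rfl fun i hi => indicator_of_mem (s := {s : ℝ |
      arrival τ (i + 1) ω ≤ s}) ?_ _]
    · ring
    · exact (hmono.monotone (Nat.succ_le_of_lt (Finset.mem_range.1 hi))).trans h1
  · intro i hi
    refine indicator_of_notMem (fun hmem => ?_) _
    rw [Finset.mem_range, not_lt] at hi
    exact absurd ((hmono.monotone (Nat.succ_le_succ hi)).trans hmem) (not_le.2 h2)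

theorem surplus_arrival (m : RiskModel n) {τ ξ : ℕ → Ω → ℝ} {ω : Ω} (h : ∀ j, 0 < τ j ω) (x : ℝ)
    (j : ℕ) : m.surplus τ ξ x (arrival τ j ω) ω = m.claimSurplus τ ξ x j ω := by
  rw [m.surplus_eq h x le_rfl (arrival_strictMono h j.lt_succ_self), sub_self, mul_zero, add_zero]

theorem chain_ruinStep_of_le (m : RiskModel n) {τ ξ : ℕ → Ω → ℝ} {ω : Ω} (x : ℝ) {N : ℕ}
    (hN : ∀ i < N, 0 ≤ m.claimSurplus τ ξ x i ω) {j : ℕ} (hj : j ≤ N) :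
    chain m.ruinStep τ ξ x j ω = m.claimSurplus τ ξ x j ω := by
  induction j with
  | zero => simp [chain, claimSurplus, arrival]
  | succ j ih =>
    rw [chain, ih (by omega), ruinStep, if_neg (not_lt.2 (hN j (by omega))), claimSurplus_succ]

theorem chain_ruinStep_of_ge (m : RiskModel n) {τ ξ : ℕ → Ω → ℝ} {ω : Ω} (x : ℝ) {N : ℕ}
    (hN : chain m.ruinStep τ ξ x N ω < 0) {j : ℕ} (hj : N ≤ j) :
    chain m.ruinStep τ ξ x j ω < 0 := by
  induction j, hj using Nat.le_induction with
  | base => exact hN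
  | succ j hj ih => rw [chain, ruinStep, if_pos ih]; exact ih

/-- The surplus increases between claims, so it can first become negative only at a claim. Hence at
most one reward is nonzero, the one collected by the ruinous claim. -/
theorem ruin_indicator_eq_tsum {m : RiskModel n} (hm : m.Admissible) {τ ξ : ℕ → Ω → ℝ} {ω : Ω}
    (hτ : ∀ j, 0 < τ j ω) (hT : Tendsto (fun j => arrival τ j ω) atTop atTop) {x y : ℝ}
    (hx : 0 ≤ x) (hy : 0 ≤ y) :
    {ω' : Ω | (∃ t : ℝ, 0 ≤ t ∧ m.surplus τ ξ x t ω' < 0) ∧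
      m.surplus τ ξ x (m.ruinTime τ ξ x ω') ω' < -y}.indicator
        (fun ω' => Real.exp (-m.q * m.ruinTime τ ξ x ω')) ω =
      ∑' j, Real.exp (-m.q * arrival τ j ω) *
        m.ruinReward y (chain m.ruinStep τ ξ x j ω) (τ j ω) (ξ j ω) := by
  classical
  have hlow : ∀ t, 0 ≤ t → ∃ j, arrival τ j ω ≤ t ∧
      m.claimSurplus τ ξ x j ω ≤ m.surplus τ ξ x t ω := fun t ht => by
    obtain ⟨j, h1, h2⟩ := exists_arrival_le_lt hT ht
    refine ⟨j, h1, ?_⟩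
    rw [m.surplus_eq hτ x h1 h2]
    have := mul_nonneg hm.c_pos.le (sub_nonneg.2 h1)
    linarith
  by_cases hex : ∃ j, m.claimSurplus τ ξ x j ω < 0
  · have hspec := Nat.find_spec hex
    have hmin : ∀ i < Nat.find hex, 0 ≤ m.claimSurplus τ ξ x i ω := fun i hi =>
      not_lt.1 (Nat.find_min hex hi)
    -- Since `x ≥ 0`, ruin is not at time `0`. The ruinous claim has number `M + 1`, and its reward
    -- is the term with index `M`.
    obtain ⟨M, hM⟩ : ∃ M, Nat.find hex = M + 1 := Nat.exists_eq_succ_of_ne_zero fun h0 => by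
      rw [h0] at hspec
      simp only [claimSurplus, arrival_zero, Finset.range_zero, Finset.sum_empty] at hspec
      linarith
    rw [hM] at hspec hmin
    have hleast : IsLeast {t : ℝ | 0 ≤ t ∧ m.surplus τ ξ x t ω < 0} (arrival τ (M + 1) ω) := by
      refine ⟨⟨arrival_nonneg hτ _, by rwa [m.surplus_arrival hτ]⟩, fun t ht => ?_⟩
      obtain ⟨j, h1, h2⟩ := hlow t ht.1
      have hj : M + 1 ≤ j := by
        by_contra hlt
        exact absurd (hmin j (not_le.1 hlt)) (not_le.2 (h2.trans_lt ht.2))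
      exact ((arrival_strictMono hτ).monotone hj).trans h1
    have hruin : m.ruinTime τ ξ x ω = arrival τ (M + 1) ω := hleast.csInf_eq
    have hchM : chain m.ruinStep τ ξ x M ω = m.claimSurplus τ ξ x M ω :=
      m.chain_ruinStep_of_le x hmin (by omega)
    have hchM1 : chain m.ruinStep τ ξ x (M + 1) ω = m.claimSurplus τ ξ x (M + 1) ω :=
      m.chain_ruinStep_of_le x hmin le_rfl
    rw [tsum_eq_single M]
    · rw [ruinReward, hchM, if_neg (not_lt.2 (hmin M (by omega))), ← claimSurplus_succ]
      by_cases hlt : m.claimSurplus τ ξ x (M + 1) ω < -y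
      · rw [indicator_of_mem, if_pos hlt, hruin, arrival_succ, ← Real.exp_add]
        · ring_nf
        · exact ⟨⟨_, hleast.1⟩, by rwa [hruin, m.surplus_arrival hτ]⟩
      · rw [indicator_of_notMem, if_neg hlt, mul_zero]
        intro hmem
        have := hmem.2
        rw [hruin, m.surplus_arrival hτ] at this
        exact hlt this
    · intro j hj
      rcases lt_or_gt_of_ne hj with h | h
      · rw [ruinReward, m.chain_ruinStep_of_le x hmin (by omega), ← claimSurplus_succ,
          if_neg (not_lt.2 (hmin j (by omega))), if_neg, mul_zero]
        have := hmin (j + 1) (by omega)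
        linarith
      · rw [ruinReward, if_pos (m.chain_ruinStep_of_ge x (N := M + 1) (by rwa [hchM1]) (by omega)),
          mul_zero]
  · push Not at hex
    rw [indicator_of_notMem]
    · refine ((tsum_congr fun j => ?_).trans tsum_zero).symm
      rw [ruinReward, m.chain_ruinStep_of_le x (N := j) (fun i _ => hex i) le_rfl,
        ← claimSurplus_succ, if_neg (not_lt.2 (hex j)), if_neg, mul_zero]
      have := hex (j + 1)
      linarith
    · rintro ⟨⟨t, ht, hlt⟩, -⟩
      obtain ⟨j, -, h2⟩ := hlow t ht
      exact absurd (hex j) (not_le.2 (h2.trans_lt hlt))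

variable [MeasurableSpace Ω] {P : Measure Ω} {τ ξ : ℕ → Ω → ℝ} {m : RiskModel n}

theorem ruinTransform_eq_ruinFun [IsProbabilityMeasure P] (hm : m.Admissible)
    (hX : m.IsClaimModel P τ ξ) {x y : ℝ} (hx : 0 ≤ x) (hy : 0 ≤ y) :
    m.ruinTransform P τ ξ x y = m.ruinFun y x := by
  have hstep : Measurable fun p : ℝ × ℝ × ℝ => m.ruinStep p.1 p.2.1 p.2.2 := by
    unfold ruinStep
    exact Measurable.ite (measurableSet_lt (by fun_prop) (by fun_prop)) (by fun_prop) (by fun_prop)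
  have hrew : Measurable fun p : ℝ × ℝ × ℝ => m.ruinReward y p.1 p.2.1 p.2.2 := by
    unfold ruinReward
    exact Measurable.ite (measurableSet_lt (by fun_prop) (by fun_prop)) (by fun_prop)
      (Measurable.ite (measurableSet_lt (by fun_prop) (by fun_prop)) (by fun_prop) (by fun_prop))
  have key := integral_tsum_discounted_rewards (K := 1) hm hX hstep hrew
    ((m.ruinFun_continuous y).measurable.indicator measurableSet_Ici) (fun u t z ht => ?_)
    (fun u => ?_) (hm.ruin_one_step hy) x
  · rw [indicator_of_mem (by exact hx)] at key
    rw [ruinTransform, ← key.2]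
    refine integral_congr_ae ?_
    filter_upwards [hX.τ_pos, ae_tendsto_arrival hm hX] with ω h1 h2
    exact ruin_indicator_eq_tsum hm h1 h2 hx hy
  · have h1 : Real.exp (-m.q * t) ≤ 1 := Real.exp_le_one_iff.2 (by nlinarith [hm.q_pos])
    unfold ruinReward
    split_ifs
    · simp
    · rwa [abs_of_pos (Real.exp_pos _)]
    · simp
  · by_cases hu : 0 ≤ u
    · rw [indicator_of_mem (by exact hu), abs_of_nonneg (hm.ruinFun_nonneg hy hu)]
      exact hm.ruinFun_le_one hy hu
    · rw [indicator_of_notMem (by exact hu), abs_zero]; exact zero_le_one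

end RiskModel

/-! ### The value of the `(-a, 0, b)` policy. -/

namespace RiskModel

variable {n : ℕ}

/-- The value at the reserve `0` of the `(-a, 0, b)` policy, in terms of the scale function. -/
def policyValueZero (m : RiskModel n) (k a b : ℝ) : ℝ :=
  (1 - k * (m.lam * (m.scaleVec' b ⬝ᵥ (m.matM a *ᵥ 1)))) /
    (m.q * m.scaleFun b + m.lam * (m.scaleVec' b ⬝ᵥ (m.expB a *ᵥ 1)))

/-- The value function `k G_a + J_0 S_a` of the `(-a, 0, b)` policy on `[0, b]`. -/
def policyValue (m : RiskModel n) (k a b x : ℝ) : ℝ :=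
  k * (m.lam * (m.scaleVec x ⬝ᵥ (m.matM a *ᵥ 1))) + m.policyValueZero k a b *
    (m.scaleZ x + m.lam * (m.scaleVec x ⬝ᵥ (m.expB a *ᵥ 1)))

/-- The derivative of `policyValue`. -/
def policyValue' (m : RiskModel n) (k a b x : ℝ) : ℝ :=
  k * (m.lam * (m.scaleVec' x ⬝ᵥ (m.matM a *ᵥ 1))) + m.policyValueZero k a b *
    (m.q * m.scaleFun x + m.lam * (m.scaleVec' x ⬝ᵥ (m.expB a *ᵥ 1)))

theorem policyValue_hasDerivAt (m : RiskModel n) (k a b x : ℝ) :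
    HasDerivAt (m.policyValue k a b) (m.policyValue' k a b x) x :=
  (((hasDerivAt_dotProduct_const (m.scaleVec_hasDerivAt x) _).const_mul _).const_mul _).add
    (((m.scaleZ_hasDerivAt x).add
      ((hasDerivAt_dotProduct_const (m.scaleVec_hasDerivAt x) _).const_mul _)).const_mul _)

@[fun_prop]
theorem policyValue_continuous (m : RiskModel n) (k a b : ℝ) : Continuous (m.policyValue k a b) :=
  continuous_iff_continuousAt.2 fun x => (m.policyValue_hasDerivAt k a b x).continuousAt

@[fun_prop]
theorem policyValue'_continuous (m : RiskModel n) (k a b : ℝ) :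
    Continuous (m.policyValue' k a b) := by
  have h : ∀ w : Fin n → ℝ, Continuous fun x => m.scaleVec' x ⬝ᵥ w := fun w =>
    continuous_iff_continuousAt.2 fun x =>
      (hasDerivAt_dotProduct_const (m.scaleVec'_hasDerivAt x) w).continuousAt
  unfold policyValue'
  fun_prop

theorem policyValue_zero (m : RiskModel n) (k a b : ℝ) :
    m.policyValue k a b 0 = m.policyValueZero k a b := by
  simp [policyValue, scaleVec_zero, scaleZ_zero]

namespace Admissible

variable {m : RiskModel n}

/-- This boundary condition is what determines `policyValueZero`. -/
theorem policyValue'_barrier (hm : m.Admissible) (k : ℝ) {a b : ℝ} (ha : 0 ≤ a) (hb : 0 ≤ b) :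
    m.policyValue' k a b b = 1 := by
  rw [policyValue', policyValueZero, div_mul_cancel₀ _ (hm.S_deriv_pos ha hb).ne']
  ring

theorem halfConv_density_add (hm : m.Admissible) {g h : ℝ → ℝ} (hg : Continuous g)
    (hh : Continuous h) (r s x : ℝ) :
    halfConv m.claimDensity (fun y => r * g y + s * h y) x =
      r * halfConv m.claimDensity g x + s * halfConv m.claimDensity h x := by
  have hf := hm.claimDensity_continuous
  rw [halfConv_add_right hf (by fun_prop) (by fun_prop), halfConv_const_mul_right,
    halfConv_const_mul_right]

/-- Combine the equations of `w` and `v·1` through `Z = c w - λ v·1`. -/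
theorem scaleZ_ode (hm : m.Admissible) {x : ℝ} (hx : 0 ≤ x) :
    m.c * (m.q * m.scaleFun x) = (m.lam + m.q) * m.scaleZ x
      - m.lam * (halfConv m.claimDensity m.scaleZ x + m.expTail 1 x) := by
  have hc := hm.c_pos.ne'
  have h1 : m.scaleZ = fun y => m.c * m.scaleFun y + (-m.lam) * (m.scaleVec y ⬝ᵥ 1) := by
    ext y; linarith [hm.c_mul_scaleFun y]
  have h2 : halfConv m.claimDensity m.scaleZ x = m.c * halfConv m.claimDensity m.scaleFun x +
      (-m.lam) * halfConv m.claimDensity (fun y => m.scaleVec y ⬝ᵥ 1) x := by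
    rw [← hm.halfConv_density_add (by fun_prop) (by fun_prop), ← h1]
  have h3 := hm.scaleFun'_eq x
  rw [halfConv_comm] at h3
  have h4 := hm.scaleVec'_eq 1 hx
  have h5 : m.q * m.scaleFun x = m.c * m.scaleFun' x - m.lam * (m.scaleVec' x ⬝ᵥ 1) := by
    rw [scaleVec'_dotProduct, hm.β_sum, scaleFun']
    field_simp
    ring
  have h6 := hm.c_mul_scaleFun x
  rw [h2]
  linear_combination m.c * h5 + m.c * h3 - m.lam * h4 + (m.lam + m.q) * h6

/-- The sources of `Z`, `v·(e^{aB}1)` and `v·(M(a)1)` assemble into the effect of a claim in `(x,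
x+a]`: the reserve restarts from `0`, with value `V0`, at an expected injection cost `k m_a(x)`. -/
theorem policyValue_ode (hm : m.Admissible) (k a b : ℝ) {x : ℝ} (hx : 0 ≤ x) :
    m.c * m.policyValue' k a b x = (m.lam + m.q) * m.policyValue k a b x
      - m.lam * (halfConv m.claimDensity (m.policyValue k a b) x
        + m.policyValueZero k a b * (m.expTail 1 x - m.expTail 1 (x + a))
        - k * m.partialMean a x) := by
  set V0 := m.policyValueZero k a b with hV0
  have h1 : m.policyValue k a b = fun y => (k * m.lam) * (m.scaleVec y ⬝ᵥ (m.matM a *ᵥ 1)) +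
      V0 * (1 * m.scaleZ y + m.lam * (m.scaleVec y ⬝ᵥ (m.expB a *ᵥ 1))) := by
    ext y; rw [policyValue, ← hV0]; ring
  have h2 : halfConv m.claimDensity (m.policyValue k a b) x =
      (k * m.lam) * halfConv m.claimDensity (fun y => m.scaleVec y ⬝ᵥ (m.matM a *ᵥ 1)) x +
      V0 * (1 * halfConv m.claimDensity m.scaleZ x +
        m.lam * halfConv m.claimDensity (fun y => m.scaleVec y ⬝ᵥ (m.expB a *ᵥ 1)) x) := by
    rw [h1, hm.halfConv_density_add (by fun_prop) (by fun_prop),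
      hm.halfConv_density_add (by fun_prop) (by fun_prop)]
  rw [h2, partialMean_eq, policyValue', policyValue, ← hV0, expTail_shift m 1]
  linear_combination (k * m.lam) * hm.scaleVec'_eq (m.matM a *ᵥ 1) hx + V0 * hm.scaleZ_ode hx +
    (V0 * m.lam) * hm.scaleVec'_eq (m.expB a *ᵥ 1) hx

end Admissible

/-- The reserve after an intervention at the level `y`. -/
def refl (b y : ℝ) : ℝ := max 0 (min b y)

theorem refl_nonneg (b y : ℝ) : 0 ≤ refl b y := le_max_left _ _

theorem refl_le {b : ℝ} (hb : 0 ≤ b) (y : ℝ) : refl b y ≤ b := max_le hb (min_le_left _ _)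

theorem refl_of_mem {b y : ℝ} (hy : y ∈ Icc 0 b) : refl b y = y := by
  rw [refl, min_eq_right hy.2, max_eq_right hy.1]

theorem refl_of_nonpos {b y : ℝ} (hb : 0 ≤ b) (hy : y ≤ 0) : refl b y = 0 := by
  rw [refl, min_eq_right (hy.trans hb), max_eq_left hy]

/-- The next level of the controlled reserve; a level below `-a` is absorbing. -/
def policyStep (m : RiskModel n) (a b y t z : ℝ) : ℝ :=
  if y < -a then y else min b (refl b y + m.c * t) - z

/-- The discounted dividends until the next claim, minus the cost of the injection at the level
`y`. -/
def policyReward (m : RiskModel n) (k a b y t : ℝ) : ℝ :=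
  if y < -a then 0 else
    m.c / m.q * (Real.exp (-m.q * min ((b - refl b y) / m.c) t) - Real.exp (-m.q * t))
      - k * max (-y) 0

/-- The value of the policy at the level `y` (without a lump dividend). -/
def levelValue (m : RiskModel n) (k a b y : ℝ) : ℝ :=
  if y < -a then 0 else m.policyValue k a b (refl b y) - k * max (-y) 0

namespace Admissible

variable {m : RiskModel n}

/-- Split by claim size: up to `w` no intervention, in `(w, w+a]` an injection up to `0`, beyond
that bankruptcy with value `0`. -/
theorem integral_levelValue_claimLaw (hm : m.Admissible) (k : ℝ) {a b : ℝ} (ha : 0 ≤ a)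
    {w : ℝ} (hw : w ∈ Icc 0 b) :
    Integrable (fun z => m.levelValue k a b (w - z)) m.claimLaw ∧
    ∫ z, m.levelValue k a b (w - z) ∂m.claimLaw =
      halfConv m.claimDensity (m.policyValue k a b) w
        + m.policyValueZero k a b * (m.expTail 1 w - m.expTail 1 (w + a))
        - k * m.partialMean a w := by
  have := hm.isProbabilityMeasure_claimLaw
  have hf := hm.claimDensity_continuous
  set V0 := m.policyValueZero k a b with hV0
  have hb : 0 ≤ b := hw.1.trans hw.2
  have h1 : (fun z => m.levelValue k a b (w - z)) =ᵐ[m.claimLaw] fun z =>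
      (Ici 0).indicator (m.policyValue k a b) (w - z) +
        (Ioc w (w + a)).indicator (fun z => V0 + k * (w - z)) z := by
    filter_upwards [hm.claimLaw_ae_pos] with z hz
    rcases le_or_gt z w with h | h
    · rw [indicator_of_mem (by simpa using h), indicator_of_notMem (by simp [h]), levelValue,
        if_neg (by linarith), refl_of_mem ⟨by linarith, by linarith [hw.2]⟩,
        max_eq_right (by linarith)]
      ring
    · rw [indicator_of_notMem (by simpa using h), levelValue]
      by_cases h' : z ≤ w + a
      · rw [if_neg (by linarith), indicator_of_mem (show z ∈ Ioc w (w + a) from ⟨h, h'⟩), refl_of_nonpos hb (by linarith),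
          policyValue_zero, max_eq_left (by linarith)]
        ring
      · rw [if_pos (by linarith), indicator_of_notMem (fun hmem => h' hmem.2)]
        ring
  have hi1 := hm.integrable_claimLaw_indicator (m.policyValue_continuous k a b) (w := w)
  have hi2 : Integrable ((Ioc w (w + a)).indicator fun z => V0 + k * (w - z)) m.claimLaw := by
    rw [integrable_indicator_iff measurableSet_Ioc]
    exact (Continuous.continuousOn (by fun_prop) |>.integrableOn_compact
      isCompact_Icc).mono_set Ioc_subset_Icc_self
  refine ⟨(hi1.add hi2).congr h1.symm, ?_⟩
  rw [integral_congr_ae h1, integral_add hi1 hi2, hm.integral_claimLaw_indicator _ hw.1, add_sub_assoc]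
  congr 1
  have h2 : ∫ z, (Ioc w (w + a)).indicator (fun z => V0 + k * (w - z)) z ∂m.claimLaw =
      ∫ z in w..(w + a), m.claimDensity z * (V0 + k * (w - z)) := by
    rw [hm.integral_claimLaw, intervalIntegral.integral_of_le (by linarith),
      ← integral_indicator measurableSet_Ioi, ← integral_indicator measurableSet_Ioc]
    congr 1; ext z
    by_cases h : z ∈ Ioc w (w + a)
    · rw [indicator_of_mem (by exact hw.1.trans_lt h.1), indicator_of_mem h, indicator_of_mem h]
    · rw [indicator_of_notMem h]
      simp only [indicator, mem_Ioi, h, if_false, mul_zero, ite_self]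
  have h3 := intervalIntegral.integral_comp_add_left
    (fun z => m.claimDensity z * (V0 + k * (w - z))) w (a := 0) (b := a)
  rw [add_zero] at h3
  have h4 : ∫ z in (0 : ℝ)..a, m.claimDensity (w + z) = m.expTail 1 w - m.expTail 1 (w + a) := by
    have := intervalIntegral.integral_eq_sub_of_hasDerivAt (a := 0) (b := a)
      (f := fun z => -m.expTail 1 (w + z)) (f' := fun z => m.claimDensity (w + z)) (fun z _ => by
        have := (hm.expTail_one_hasDerivAt (w + z)).comp_const_add w z
        exact this.fun_neg.congr_deriv (by ring)) (Continuous.intervalIntegrable (by fun_prop) _ _)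
    rw [this, add_zero]; ring
  rw [h2, ← h3, ← h4, partialMean, ← intervalIntegral.integral_const_mul,
    ← intervalIntegral.integral_const_mul, ← intervalIntegral.integral_sub
      (Continuous.intervalIntegrable (by fun_prop) _ _)
      (Continuous.intervalIntegrable (by fun_prop) _ _)]
  congr 1; ext z; ring

/-- The barrier is reached after `h = (b-R)/c`. Before `h` the integrand is the derivative of
`-e^{-(λ+q)t} V(R+ct)`. After `h` the reserve stays at `b`, where `V' = 1`, and the integrand is a
sum of two exponentials whose integral `e^{-(λ+q)h} V(b)` restores the missing boundary term. -/
theorem integral_exp_first_period (hm : m.Admissible) (k : ℝ) {a b : ℝ} (ha : 0 ≤ a)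
    (hb : 0 ≤ b) {R : ℝ} (hR : R ∈ Icc 0 b) :
    ∫ t in Ioi 0, m.lam * Real.exp (-m.lam * t) *
      (m.c / m.q * (Real.exp (-m.q * min ((b - R) / m.c) t) - Real.exp (-m.q * t)) +
        Real.exp (-m.q * t) * (((m.lam + m.q) * m.policyValue k a b (min b (R + m.c * t)) -
          m.c * m.policyValue' k a b (min b (R + m.c * t))) / m.lam)) =
      m.policyValue k a b R := by
  have hc := hm.c_pos
  have hlam := hm.lam_pos
  have hq := hm.q_pos
  set V := m.policyValue k a b with hV
  set V' := m.policyValue' k a b with hV'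
  set h := (b - R) / m.c with hh
  have hh0 : 0 ≤ h := div_nonneg (sub_nonneg.2 hR.2) hc.le
  have hRh : R + m.c * h = b := by rw [hh]; field_simp; ring
  set g : ℝ → ℝ := fun t => m.lam * Real.exp (-m.lam * t) *
      (m.c / m.q * (Real.exp (-m.q * min h t) - Real.exp (-m.q * t)) +
        Real.exp (-m.q * t) * (((m.lam + m.q) * V (min b (R + m.c * t)) -
          m.c * V' (min b (R + m.c * t))) / m.lam)) with hg
  have hgc : Continuous g := by fun_prop
  have hs : m.lam + m.q > 0 := by positivity
  set A := m.lam * (m.c / m.q) * Real.exp (-m.q * h) with hA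
  set D := (m.lam + m.q) * V b - m.c - m.lam * (m.c / m.q) with hD
  have hg2 : ∀ t ∈ Ioi h, g t = A * Real.exp (-m.lam * t) + D * Real.exp (-(m.lam + m.q) * t) := by
    intro t ht
    have e1 : b ≤ R + m.c * t := by
      have := mul_le_mul_of_nonneg_left (le_of_lt (mem_Ioi.1 ht)) hc.le
      linarith
    simp only [hg]
    rw [min_eq_left (le_of_lt (mem_Ioi.1 ht)), min_eq_left e1, hV',
      hm.policyValue'_barrier k ha hb, show -(m.lam + m.q) * t = -m.lam * t + -m.q * t by ring,
      Real.exp_add, hA, hD]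
    field_simp
    ring
  have hi1 := exp_neg_integrableOn_Ioi h hlam
  have hi2 := exp_neg_integrableOn_Ioi h hs
  have hgi2 : IntegrableOn g (Ioi h) :=
    IntegrableOn.congr_fun ((hi1.const_mul A).add (hi2.const_mul D))
      (fun t ht => (hg2 t ht).symm) measurableSet_Ioi
  have hI2 : ∫ t in Ioi h, g t = Real.exp (-(m.lam + m.q) * h) * V b := by
    rw [setIntegral_congr_fun measurableSet_Ioi hg2, integral_add (hi1.const_mul A)
      (hi2.const_mul D), integral_const_mul, integral_const_mul,
      integral_exp_mul_Ioi (by linarith), integral_exp_mul_Ioi (by linarith), hA, hD,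
      show -(m.lam + m.q) * h = -m.lam * h + -m.q * h by ring, Real.exp_add]
    field_simp
    ring
  have hI1 : ∫ t in Ioc 0 h, g t = V R - Real.exp (-(m.lam + m.q) * h) * V b := by
    rw [← intervalIntegral.integral_of_le hh0]
    have hd : ∀ t ∈ uIcc 0 h, HasDerivAt (fun t => -(Real.exp (-(m.lam + m.q) * t) * V (R + m.c * t)))
        (g t) t := by
      intro t ht
      rw [uIcc_of_le hh0] at ht
      have e1 : R + m.c * t ≤ b := by
        have := mul_le_mul_of_nonneg_left ht.2 hc.le
        linarith
      have h1 : HasDerivAt (fun t => Real.exp (-(m.lam + m.q) * t))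
          (Real.exp (-(m.lam + m.q) * t) * (-(m.lam + m.q))) t := by
        simpa using ((hasDerivAt_id t).const_mul (-(m.lam + m.q))).exp
      have h0 : HasDerivAt (fun t => R + m.c * t) m.c t := by
        simpa using ((hasDerivAt_id t).const_mul m.c).const_add R
      have h2 : HasDerivAt (fun t => V (R + m.c * t)) (V' (R + m.c * t) * m.c) t :=
        HasDerivAt.comp (h := fun t => R + m.c * t) t
          (m.policyValue_hasDerivAt k a b (R + m.c * t)) h0
      refine (h1.mul h2).neg.congr_deriv ?_
      simp only [hg]
      rw [min_eq_right ht.2, min_eq_right e1, sub_self, mul_zero, zero_add,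
        show -(m.lam + m.q) * t = -m.lam * t + -m.q * t by ring, Real.exp_add]
      field_simp
      ring
    rw [intervalIntegral.integral_eq_sub_of_hasDerivAt hd (hgc.intervalIntegrable _ _), hRh]
    simp; ring
  rw [← Ioc_union_Ioi_eq_Ioi hh0, setIntegral_union (Ioc_disjoint_Ioi le_rfl) measurableSet_Ioi
    (hgc.integrableOn_Ioc) hgi2, hI1, hI2]
  ring

/-- Integrating over the claim produces exactly the bracket of `policyValue_ode`, so it can be
replaced by `((λ+q)V - cV')/λ` at the reserve before the claim. The integral over the waiting time
is then `integral_exp_first_period`. -/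
theorem policy_one_step (hm : m.Admissible) (k : ℝ) {a b : ℝ} (ha : 0 ≤ a) (hb : 0 ≤ b) (y : ℝ) :
    ∫ t, ∫ z, (m.policyReward k a b y t +
        Real.exp (-m.q * t) * m.levelValue k a b (m.policyStep a b y t z))
      ∂m.claimLaw ∂expMeasure m.lam = m.levelValue k a b y := by
  have := hm.isProbabilityMeasure_claimLaw
  have := isProbabilityMeasure_expMeasure hm.lam_pos
  have hc := hm.c_pos
  have hq := hm.q_pos
  have hlam := hm.lam_pos
  by_cases hy : y < -a
  · simp [policyReward, policyStep, levelValue, hy]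
  set R := refl b y with hRdef
  have hR : R ∈ Icc 0 b := ⟨refl_nonneg b y, refl_le hb y⟩
  set Q : ℝ → ℝ := fun t =>
    (m.c / m.q * (Real.exp (-m.q * min ((b - R) / m.c) t) - Real.exp (-m.q * t)) +
        Real.exp (-m.q * t) * (((m.lam + m.q) * m.policyValue k a b (min b (R + m.c * t)) -
          m.c * m.policyValue' k a b (min b (R + m.c * t))) / m.lam)) with hQ
  have hinner : ∀ t, 0 < t → ∫ z, (m.policyReward k a b y t +
        Real.exp (-m.q * t) * m.levelValue k a b (m.policyStep a b y t z))
      ∂m.claimLaw = Q t + (-(k * max (-y) 0)) := by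
    intro t ht
    have hw : min b (R + m.c * t) ∈ Icc 0 b :=
      ⟨le_min hb (add_nonneg hR.1 (by positivity)), min_le_left _ _⟩
    obtain ⟨hi, he⟩ := hm.integral_levelValue_claimLaw k ha hw
    have hode := hm.policyValue_ode k a b hw.1
    simp only [policyStep, if_neg hy, ← hRdef]
    rw [integral_add (integrable_const _) (hi.const_mul _), integral_const_mul, he, integral_const,
      probReal_univ, one_smul, policyReward, if_neg hy, ← hRdef, hQ]
    simp only
    have : ((m.lam + m.q) * m.policyValue k a b (min b (R + m.c * t)) -
          m.c * m.policyValue' k a b (min b (R + m.c * t))) / m.lam =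
        halfConv m.claimDensity (m.policyValue k a b) (min b (R + m.c * t))
        + m.policyValueZero k a b * (m.expTail 1 (min b (R + m.c * t))
          - m.expTail 1 (min b (R + m.c * t) + a))
        - k * m.partialMean a (min b (R + m.c * t)) := by
      rw [div_eq_iff hlam.ne']
      linarith
    rw [this]
    ring
  have hae : (fun t => ∫ z, (m.policyReward k a b y t +
        Real.exp (-m.q * t) * m.levelValue k a b (m.policyStep a b y t z)) ∂m.claimLaw)
      =ᵐ[expMeasure m.lam] fun t => Q t + (-(k * max (-y) 0)) := by
    filter_upwards [expMeasure_ae_pos m.lam] with t ht using hinner t ht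
  have hQc : Continuous Q := by fun_prop
  have hQi : Integrable Q (expMeasure m.lam) := by
    obtain ⟨K, hK⟩ := (isCompact_Icc (a := (0 : ℝ)) (b := b)).exists_bound_of_continuousOn
      (f := fun w => ((m.lam + m.q) * m.policyValue k a b w -
          m.c * m.policyValue' k a b w) / m.lam) (Continuous.continuousOn (by fun_prop))
    refine Integrable.mono' (integrable_const (m.c / m.q + K)) hQc.aestronglyMeasurable ?_
    filter_upwards [expMeasure_ae_pos m.lam] with t ht
    refine (norm_add_le _ _).trans (add_le_add ?_ ?_)
    · have h1 : Real.exp (-m.q * min ((b - R) / m.c) t) ≤ 1 := Real.exp_le_one_iff.2 (by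
        have : 0 ≤ min ((b - R) / m.c) t := le_min (div_nonneg (sub_nonneg.2 hR.2) hc.le) ht.le
        nlinarith)
      have h2 : Real.exp (-m.q * t) ≤ Real.exp (-m.q * min ((b - R) / m.c) t) :=
        Real.exp_le_exp.2 (by nlinarith [min_le_right ((b - R) / m.c) t])
      have h3 : 0 ≤ m.c / m.q := by positivity
      rw [Real.norm_eq_abs, abs_of_nonneg (mul_nonneg h3 (sub_nonneg.2 h2))]
      exact mul_le_of_le_one_right h3 (by linarith [Real.exp_pos (-m.q * t)])
    · rw [norm_mul, Real.norm_eq_abs, abs_of_pos (Real.exp_pos _)]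
      have h1 : Real.exp (-m.q * t) ≤ 1 := Real.exp_le_one_iff.2 (by nlinarith)
      have h2 := hK (min b (R + m.c * t))
        ⟨le_min hb (add_nonneg hR.1 (by positivity)), min_le_left _ _⟩
      exact (mul_le_of_le_one_left (norm_nonneg _) h1).trans h2
  rw [integral_congr_ae hae, integral_add hQi (integrable_const _), integral_const, probReal_univ,
    one_smul, integral_expMeasure hlam, hQ, hm.integral_exp_first_period k ha hb hR, levelValue,
    if_neg hy, ← hRdef]
  ring

theorem abs_policyReward_le (hm : m.Admissible) {k a b : ℝ} (hk : 0 ≤ k) (ha : 0 ≤ a) (hb : 0 ≤ b)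
    (y : ℝ) {t : ℝ} (ht : 0 ≤ t) : |m.policyReward k a b y t| ≤ m.c / m.q + k * a := by
  have hc := hm.c_pos
  have hq := hm.q_pos
  have h3 : 0 ≤ m.c / m.q := by positivity
  unfold policyReward
  split_ifs with hy
  · rw [abs_zero]; positivity
  have h1 : Real.exp (-m.q * min ((b - refl b y) / m.c) t) ≤ 1 := Real.exp_le_one_iff.2 (by
    have : 0 ≤ min ((b - refl b y) / m.c) t :=
      le_min (div_nonneg (sub_nonneg.2 (refl_le hb y)) hc.le) ht
    nlinarith)
  have h2 : Real.exp (-m.q * t) ≤ Real.exp (-m.q * min ((b - refl b y) / m.c) t) :=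
    Real.exp_le_exp.2 (by nlinarith [min_le_right ((b - refl b y) / m.c) t])
  have h4 : max (-y) 0 ≤ a := max_le (by linarith) ha
  have h5 : 0 ≤ max (-y) 0 := le_max_right _ _
  refine (abs_sub _ _).trans (add_le_add ?_ ?_)
  · rw [abs_of_nonneg (mul_nonneg h3 (sub_nonneg.2 h2))]
    exact mul_le_of_le_one_right h3 (by linarith [Real.exp_pos (-m.q * t)])
  · rw [abs_of_nonneg (by positivity)]
    exact mul_le_mul_of_nonneg_left h4 hk

end Admissible

theorem exists_abs_levelValue_le (m : RiskModel n) {k a b : ℝ} (hk : 0 ≤ k) (ha : 0 ≤ a)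
    (hb : 0 ≤ b) : ∃ K, ∀ y, |m.levelValue k a b y| ≤ K := by
  obtain ⟨K, hK⟩ := (isCompact_Icc (a := (0 : ℝ)) (b := b)).exists_bound_of_continuousOn
    (m.policyValue_continuous k a b).continuousOn
  have hK0 : 0 ≤ K := (norm_nonneg _).trans (hK 0 ⟨le_rfl, hb⟩)
  refine ⟨K + k * a, fun y => ?_⟩
  unfold levelValue
  split_ifs with hy
  · rw [abs_zero]; positivity
  have h4 : max (-y) 0 ≤ a := max_le (by linarith) ha
  have h5 : 0 ≤ max (-y) 0 := le_max_right _ _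
  refine (abs_sub _ _).trans (add_le_add (hK _ ⟨refl_nonneg b y, refl_le hb y⟩) ?_)
  rw [abs_of_nonneg (by positivity)]
  exact mul_le_mul_of_nonneg_left h4 hk

end RiskModel

/-! ### The profit along a path as a discounted sum of rewards. -/

namespace RiskModel

variable {n : ℕ} {Ω : Type*}

/-- `level` continues after bankruptcy, whereas the chain freezes below `-a`. The history-dependent
event `Alive` is thereby visible in the current state of the chain. -/
theorem chain_policyStep (m : RiskModel n) (a b : ℝ) (τ ξ : ℕ → Ω → ℝ) (x : ℝ) (ω : Ω) (j : ℕ) :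
    (m.Alive a b τ ξ x j ω → chain (m.policyStep a b) τ ξ x j ω = m.level b τ ξ x j ω) ∧
      (¬ m.Alive a b τ ξ x j ω → chain (m.policyStep a b) τ ξ x j ω < -a) := by
  induction j with
  | zero =>
    refine ⟨fun _ => rfl, fun h => ?_⟩
    simp only [Alive, Nat.le_zero, forall_eq, not_le] at h
    exact h
  | succ j ih =>
    have hsucc : m.Alive a b τ ξ x (j + 1) ω ↔
        m.Alive a b τ ξ x j ω ∧ -a ≤ m.level b τ ξ x (j + 1) ω := by
      constructor
      · exact fun h => ⟨fun i hi => h i (by omega), h _ le_rfl⟩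
      · rintro ⟨h1, h2⟩ i hi
        rcases Nat.lt_or_eq_of_le hi with h | h
        · exact h1 i (by omega)
        · rw [h]; exact h2
    by_cases hj : m.Alive a b τ ξ x j ω
    · have hch : chain (m.policyStep a b) τ ξ x (j + 1) ω = m.level b τ ξ x (j + 1) ω := by
        rw [chain, ih.1 hj, policyStep, if_neg (not_lt.2 (hj j le_rfl))]; rfl
      refine ⟨fun _ => hch, fun h => ?_⟩
      rw [hch]
      exact not_le.1 fun h' => h (hsucc.2 ⟨hj, h'⟩)
    · refine ⟨fun h => absurd (hsucc.1 h).1 hj, fun _ => ?_⟩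
      rw [chain, policyStep, if_pos (ih.2 hj)]
      exact ih.2 hj

theorem integrableOn_exp_of_subset_Ici {q : ℝ} (hq : 0 < q) {s : Set ℝ} (hs : s ⊆ Ici 0) :
    IntegrableOn (fun t => Real.exp (-q * t)) s := by
  have : IntegrableOn (fun t => Real.exp (-q * t)) (Ici 0) := by
    rw [integrableOn_Ici_iff_integrableOn_Ioi]
    exact exp_neg_integrableOn_Ioi 0 hq
  exact this.mono_set hs

theorem integral_exp_Ico {q : ℝ} (hq : 0 < q) {u v : ℝ} (huv : u ≤ v) :
    ∫ t in Ico u v, Real.exp (-q * t) = (Real.exp (-q * u) - Real.exp (-q * v)) / q := by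
  rw [integral_Ico_eq_integral_Ioo, ← integral_Ioc_eq_integral_Ioo,
    ← intervalIntegral.integral_of_le huv]
  have hd : ∀ t ∈ uIcc u v, HasDerivAt (fun t => -Real.exp (-q * t) / q) (Real.exp (-q * t)) t := by
    intro t _
    refine ((((hasDerivAt_id t).const_mul (-q)).exp).neg.div_const q).congr_deriv ?_
    simp only [id_eq]
    field_simp
  rw [intervalIntegral.integral_eq_sub_of_hasDerivAt hd
    (Continuous.intervalIntegrable (by fun_prop) _ _)]
  ring

/-- The lump dividend paid at time `0`. -/
def lumpDividend (a b x : ℝ) : ℝ := if -a ≤ x then max (x - b) 0 else 0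

open Classical in
/-- The part of `barrierTimes` between the claims number `j` and `j + 1`. -/
def barrierPiece (m : RiskModel n) (a b : ℝ) (τ ξ : ℕ → Ω → ℝ) (x : ℝ) (ω : Ω) (j : ℕ) : Set ℝ :=
  if m.Alive a b τ ξ x j ω then
    -- The minimum makes the interval empty when the claim arrives before the barrier is reached.
    Ico (arrival τ j ω + min ((b - m.reserve b τ ξ x j ω) / m.c) (τ j ω)) (arrival τ (j + 1) ω)
  else ∅

theorem reserve_eq_refl (m : RiskModel n) (b : ℝ) (τ ξ : ℕ → Ω → ℝ) (x : ℝ) (j : ℕ) (ω : Ω) :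
    m.reserve b τ ξ x j ω = refl b (m.level b τ ξ x j ω) := rfl

namespace Admissible

variable {m : RiskModel n} {a b : ℝ} {τ ξ : ℕ → Ω → ℝ} {ω : Ω}

theorem barrierPiece_subset (hm : m.Admissible) (hb : 0 ≤ b) (hτ : ∀ j, 0 < τ j ω)
    (x : ℝ) (j : ℕ) :
    m.barrierPiece a b τ ξ x ω j ⊆ Ico (arrival τ j ω) (arrival τ (j + 1) ω) := by
  unfold barrierPiece
  split_ifs
  · refine Ico_subset_Ico_left (le_add_of_nonneg_right (le_min ?_ (hτ j).le))
    exact div_nonneg (sub_nonneg.2 (refl_le hb _)) hm.c_pos.le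
  · exact empty_subset _

theorem barrierTimes_eq (hm : m.Admissible) (hb : 0 ≤ b) (hτ : ∀ j, 0 < τ j ω) (x : ℝ) :
    m.barrierTimes a b τ ξ x ω = ⋃ j, m.barrierPiece a b τ ξ x ω j := by
  ext t
  simp only [barrierTimes, mem_iUnion, mem_ofPred_eq]
  refine exists_congr fun j => ?_
  have hR := refl_le hb (m.level b τ ξ x j ω)
  rw [← reserve_eq_refl] at hR
  have hc := hm.c_pos
  have hτj := hτ j
  have hiff : min b (m.reserve b τ ξ x j ω + m.c * (t - arrival τ j ω)) = b ↔
      (b - m.reserve b τ ξ x j ω) / m.c ≤ t - arrival τ j ω := by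
    rw [min_eq_left_iff, div_le_iff₀ hc]
    constructor <;> intro h <;> linarith
  rw [hiff, barrierPiece]
  by_cases hA : m.Alive a b τ ξ x j ω
  · have hh : 0 ≤ (b - m.reserve b τ ξ x j ω) / m.c := div_nonneg (sub_nonneg.2 hR) hc.le
    have hs := arrival_succ τ j ω
    simp only [hA, true_and, if_true, mem_Ico]
    constructor
    · rintro ⟨h1, h2, h3⟩
      exact ⟨by linarith [min_le_left ((b - m.reserve b τ ξ x j ω) / m.c) (τ j ω)], h2⟩
    · rintro ⟨h1, h2⟩
      have h3 : (b - m.reserve b τ ξ x j ω) / m.c ≤ t - arrival τ j ω := by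
        rcases le_total ((b - m.reserve b τ ξ x j ω) / m.c) (τ j ω) with h | h
        · rw [min_eq_left h] at h1; linarith
        · rw [min_eq_right h] at h1; linarith
      exact ⟨by linarith, h2, h3⟩
  · simp [hA]

/-- Setting `k = 0` in `policyReward` isolates the dividends of one period. -/
theorem integral_barrierPiece (hm : m.Admissible) (x : ℝ) (j : ℕ) :
    m.c * ∫ t in m.barrierPiece a b τ ξ x ω j, Real.exp (-m.q * t) =
      Real.exp (-m.q * arrival τ j ω) *
        m.policyReward 0 a b (chain (m.policyStep a b) τ ξ x j ω) (τ j ω) := by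
  obtain ⟨h1, h2⟩ := m.chain_policyStep a b τ ξ x ω j
  unfold barrierPiece
  by_cases hA : m.Alive a b τ ξ x j ω
  · rw [if_pos hA, h1 hA, policyReward, if_neg (not_lt.2 (hA j le_rfl)), ← reserve_eq_refl]
    rw [integral_exp_Ico hm.q_pos, arrival_succ, mul_add, Real.exp_add, mul_add, Real.exp_add]
    · ring
    · rw [arrival_succ]
      gcongr
      exact min_le_right _ _
  · rw [if_neg hA, policyReward, if_pos (h2 hA)]
    simp

theorem dividends_integral (hm : m.Admissible) (hb : 0 ≤ b) (hτ : ∀ j, 0 < τ j ω)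
    (x : ℝ) :
    Integrable (fun t => Real.exp (-m.q * t)) (m.dividends a b τ ξ x ω) ∧
    HasSum (fun j => Real.exp (-m.q * arrival τ j ω) *
        m.policyReward 0 a b (chain (m.policyStep a b) τ ξ x j ω) (τ j ω))
      (∫ t, Real.exp (-m.q * t) ∂(m.dividends a b τ ξ x ω) - lumpDividend a b x) := by
  have hsub : m.barrierTimes a b τ ξ x ω ⊆ Ici 0 := by
    rw [hm.barrierTimes_eq hb hτ]
    refine iUnion_subset fun j => (hm.barrierPiece_subset hb hτ x j).trans fun t ht => ?_
    exact (arrival_nonneg hτ j).trans ht.1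
  have hint := integrableOn_exp_of_subset_Ici hm.q_pos hsub
  have hi2 := hint.smul_measure (c := ENNReal.ofReal m.c) ENNReal.ofReal_ne_top
  have hi1 : Integrable (fun t => Real.exp (-m.q * t))
      (if -a ≤ x then ENNReal.ofReal (x - b) • Measure.dirac (0 : ℝ) else 0) := by
    split_ifs
    · exact (integrable_dirac (by simp)).smul_measure ENNReal.ofReal_ne_top
    · exact integrable_zero_measure
  have hpair : Pairwise (Function.onFun Disjoint fun j => m.barrierPiece a b τ ξ x ω j) := by
    refine (Monotone.pairwise_disjoint_on_Ico_succ (arrival_strictMono hτ).monotone).mono ?_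
    intro i j hij
    exact hij.mono (hm.barrierPiece_subset hb hτ x i) (hm.barrierPiece_subset hb hτ x j)
  have hmeas : ∀ j, MeasurableSet (m.barrierPiece a b τ ξ x ω j) := fun j => by
    unfold barrierPiece
    split_ifs
    · exact measurableSet_Ico
    · exact MeasurableSet.empty
  have hsum := hasSum_integral_iUnion hmeas hpair (by rwa [← hm.barrierTimes_eq hb hτ])
  have hsum2 := hsum.mul_left m.c
  simp_rw [hm.integral_barrierPiece] at hsum2
  unfold dividends
  refine ⟨hi1.add_measure hi2, ?_⟩
  have hlump : ∫ t, Real.exp (-m.q * t)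
      ∂(if -a ≤ x then ENNReal.ofReal (x - b) • Measure.dirac (0 : ℝ) else 0) =
      lumpDividend a b x := by
    rw [lumpDividend]
    split_ifs
    · rw [integral_smul_measure, integral_dirac, ENNReal.toReal_ofReal']; simp
    · simp
  rw [integral_add_measure hi1 hi2, integral_smul_measure, hlump, hm.barrierTimes_eq hb hτ,
    ENNReal.toReal_ofReal hm.c_pos.le, smul_eq_mul, add_sub_cancel_left]
  exact hsum2

/-- Each injection is at most `a`, so `a ∑ e^{-qT_j}` dominates the sum over the atoms. -/
theorem injections_integral (_ : m.Admissible) (ha : 0 ≤ a)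
    (hs : Summable fun j => Real.exp (-m.q * arrival τ j ω)) (x : ℝ) :
    Integrable (fun t => Real.exp (-m.q * t)) (m.injections a b τ ξ x ω) ∧
    HasSum (fun j => Real.exp (-m.q * arrival τ j ω) *
        (if chain (m.policyStep a b) τ ξ x j ω < -a then 0 else
          max (-chain (m.policyStep a b) τ ξ x j ω) 0))
      (∫ t, Real.exp (-m.q * t) ∂(m.injections a b τ ξ x ω)) := by
  classical
  set Y := fun j => chain (m.policyStep a b) τ ξ x j ω with hY
  set w : ℕ → ℝ := fun j => if Y j < -a then 0 else max (-Y j) 0 with hw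
  have hw0 : ∀ j, 0 ≤ w j := fun j => by
    simp only [hw]; split_ifs
    exacts [le_rfl, le_max_right _ _]
  have hwa : ∀ j, w j ≤ a := fun j => by
    simp only [hw]; split_ifs with h
    exacts [ha, max_le (by linarith) ha]
  have hmeas : m.injections a b τ ξ x ω =
      Measure.sum fun j => ENNReal.ofReal (w j) • Measure.dirac (arrival τ j ω) := by
    unfold injections
    congr 1
    ext1 j
    obtain ⟨h1, h2⟩ := m.chain_policyStep a b τ ξ x ω j
    by_cases hA : m.Alive a b τ ξ x j ω
    · rw [if_pos hA]
      simp only [hw, hY]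
      rw [h1 hA, if_neg (not_lt.2 (hA j le_rfl))]
      congr 1
      rcases le_total 0 (-m.level b τ ξ x j ω) with h | h
      · rw [max_eq_left h]
      · rw [max_eq_right h, ENNReal.ofReal_of_nonpos h, ENNReal.ofReal_zero]
    · rw [if_neg hA]
      simp only [hw, hY]
      rw [if_pos (h2 hA)]
      simp
  have hsum : Summable fun j => (ENNReal.ofReal (w j)).toReal *
      ‖Real.exp (-m.q * arrival τ j ω)‖ := by
    refine Summable.of_nonneg_of_le (fun j => by positivity) (fun j => ?_) (hs.mul_left a)
    rw [ENNReal.toReal_ofReal (hw0 j), Real.norm_eq_abs, abs_of_pos (Real.exp_pos _)]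
    exact mul_le_mul_of_nonneg_right (hwa j) (Real.exp_pos _).le
  rw [hmeas]
  refine ⟨integrable_sum_dirac (fun _ => ENNReal.ofReal_ne_top) hsum, ?_⟩
  have := hasSum_integral_sum_dirac (f := fun t => Real.exp (-m.q * t))
    (x := fun j => arrival τ j ω) (c := fun j => ENNReal.ofReal (w j))
    (fun _ => ENNReal.ofReal_ne_top) hsum
  refine this.congr_fun fun j => ?_
  rw [ENNReal.toReal_ofReal (hw0 j), smul_eq_mul, mul_comm]

theorem profit_eq (hm : m.Admissible) (ha : 0 ≤ a) (hb : 0 ≤ b) (k : ℝ) (hτ : ∀ j, 0 < τ j ω)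
    (hs : Summable fun j => Real.exp (-m.q * arrival τ j ω)) (x : ℝ) :
    m.profit k a b τ ξ x ω = lumpDividend a b x +
      ∑' j, Real.exp (-m.q * arrival τ j ω) *
        m.policyReward k a b (chain (m.policyStep a b) τ ξ x j ω) (τ j ω) := by
  have h1 := (hm.dividends_integral (a := a) (ξ := ξ) hb hτ x).2
  have h2 := (hm.injections_integral (b := b) (ξ := ξ) ha hs x).2
  have h3 := h1.sub (h2.mul_left k)
  have h4 : ∀ j, Real.exp (-m.q * arrival τ j ω) *
        m.policyReward 0 a b (chain (m.policyStep a b) τ ξ x j ω) (τ j ω) -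
      k * (Real.exp (-m.q * arrival τ j ω) *
        (if chain (m.policyStep a b) τ ξ x j ω < -a then 0 else
          max (-chain (m.policyStep a b) τ ξ x j ω) 0)) =
      Real.exp (-m.q * arrival τ j ω) *
        m.policyReward k a b (chain (m.policyStep a b) τ ξ x j ω) (τ j ω) := fun j => by
    unfold policyReward
    split_ifs <;> ring
  simp_rw [h4] at h3
  rw [h3.tsum_eq, profit]
  ring

end Admissible

variable [MeasurableSpace Ω] {P : Measure Ω} {τ ξ : ℕ → Ω → ℝ} {m : RiskModel n} {k a b : ℝ}

/-- The profit is integrable, and `J` is the lump dividend plus the value of the level. -/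
theorem profit_integrable_and_J_eq [IsProbabilityMeasure P] (hm : m.Admissible)
    (hX : m.IsClaimModel P τ ξ) (hk : 0 ≤ k) (ha : 0 ≤ a) (hb : 0 ≤ b) (x : ℝ) :
    Integrable (m.profit k a b τ ξ x) P ∧
      m.J P τ ξ k a b x = lumpDividend a b x + m.levelValue k a b x := by
  have hrefl : Measurable (refl b) := by unfold refl; fun_prop
  have hstep : Measurable fun p : ℝ × ℝ × ℝ => m.policyStep a b p.1 p.2.1 p.2.2 := by
    unfold policyStep
    exact Measurable.ite (measurableSet_lt (by fun_prop) (by fun_prop)) (by fun_prop) (by fun_prop)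
  have hrew : Measurable fun p : ℝ × ℝ × ℝ => m.policyReward k a b p.1 p.2.1 := by
    unfold policyReward
    exact Measurable.ite (measurableSet_lt (by fun_prop) (by fun_prop)) (by fun_prop) (by fun_prop)
  have hval : Measurable (m.levelValue k a b) := by
    unfold levelValue
    exact Measurable.ite (measurableSet_lt (by fun_prop) (by fun_prop)) (by fun_prop)
      (((m.policyValue_continuous k a b).measurable.comp hrefl).sub (by fun_prop))
  obtain ⟨K, hK⟩ := m.exists_abs_levelValue_le hk ha hb
  have key := integral_tsum_discounted_rewards (K := max (m.c / m.q + k * a) K)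
    (r := fun y t _ => m.policyReward k a b y t) hm hX hstep hrew hval
    (fun y t _ ht => (hm.abs_policyReward_le hk ha hb y ht).trans (le_max_left _ _))
    (fun y => (hK y).trans (le_max_right _ _)) (hm.policy_one_step k ha hb) x
  have hae : m.profit k a b τ ξ x =ᵐ[P] fun ω => lumpDividend a b x +
      ∑' j, Real.exp (-m.q * arrival τ j ω) *
        m.policyReward k a b (chain (m.policyStep a b) τ ξ x j ω) (τ j ω) := by
    filter_upwards [hX.τ_pos, ae_summable_exp_arrival hm hX] with ω h1 h2
    exact hm.profit_eq ha hb k h1 h2 x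
  refine ⟨((integrable_const _).add key.1).congr hae.symm, ?_⟩
  rw [J, integral_congr_ae hae, integral_add (integrable_const _) key.1, key.2]
  simp

theorem J_of_mem [IsProbabilityMeasure P] (hm : m.Admissible)
    (hX : m.IsClaimModel P τ ξ) (hk : 0 ≤ k) (ha : 0 ≤ a) (hb : 0 ≤ b) {x : ℝ}
    (hx : x ∈ Icc 0 b) : m.J P τ ξ k a b x = m.policyValue k a b x := by
  rw [(profit_integrable_and_J_eq hm hX hk ha hb x).2, lumpDividend, levelValue,
    if_pos (by linarith [hx.1]), if_neg (by linarith [hx.1]), refl_of_mem hx,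
    max_eq_right (by linarith [hx.2]), max_eq_right (by linarith [hx.1])]
  ring

theorem J_zero [IsProbabilityMeasure P] (hm : m.Admissible)
    (hX : m.IsClaimModel P τ ξ) (hk : 0 ≤ k) (ha : 0 ≤ a) (hb : 0 ≤ b) :
    m.J P τ ξ k a b 0 = m.policyValueZero k a b := by
  rw [J_of_mem hm hX hk ha hb ⟨le_rfl, hb⟩, policyValue_zero]

theorem J_of_nonpos [IsProbabilityMeasure P] (hm : m.Admissible)
    (hX : m.IsClaimModel P τ ξ) (hk : 0 ≤ k) (ha : 0 ≤ a) (hb : 0 ≤ b) {x : ℝ}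
    (hx : x ∈ Icc (-a) 0) : m.J P τ ξ k a b x = k * x + m.J P τ ξ k a b 0 := by
  rw [J_zero hm hX hk ha hb, (profit_integrable_and_J_eq hm hX hk ha hb x).2, lumpDividend,
    levelValue, if_pos hx.1, if_neg (not_lt.2 hx.1), refl_of_nonpos hb hx.2, policyValue_zero,
    max_eq_right (by linarith [hx.2]), max_eq_left (by linarith [hx.2])]
  ring

theorem J_of_lt [IsProbabilityMeasure P] (hm : m.Admissible)
    (hX : m.IsClaimModel P τ ξ) (hk : 0 ≤ k) (ha : 0 ≤ a) (hb : 0 ≤ b) {x : ℝ}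
    (hx : x < -a) : m.J P τ ξ k a b x = 0 := by
  rw [(profit_integrable_and_J_eq hm hX hk ha hb x).2, lumpDividend, levelValue,
    if_neg (not_le.2 hx), if_pos hx, add_zero]

end RiskModel

/-! ### Dependence on the barrier, and the theorem. -/

namespace RiskModel

/-- The quotient rule, with the quotient itself substituted back so that a single power of the
denominator remains. -/
theorem policyValueZero_hasDerivAt {n : ℕ} (m : RiskModel n) (k : ℝ) {a b : ℝ}
    (h : m.q * m.scaleFun b + m.lam * (m.scaleVec' b ⬝ᵥ (m.expB a *ᵥ 1)) ≠ 0) :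
    HasDerivAt (m.policyValueZero k a)
      ((-(k * (m.lam * (m.scaleVec'' b ⬝ᵥ (m.matM a *ᵥ 1)))) - m.policyValueZero k a b *
        (m.q * m.scaleFun' b + m.lam * (m.scaleVec'' b ⬝ᵥ (m.expB a *ᵥ 1)))) /
        (m.q * m.scaleFun b + m.lam * (m.scaleVec' b ⬝ᵥ (m.expB a *ᵥ 1)))) b := by
  have hC : ∀ w, HasDerivAt (fun b => m.lam * (m.scaleVec' b ⬝ᵥ w))
      (m.lam * (m.scaleVec'' b ⬝ᵥ w)) b := fun w =>
    (hasDerivAt_dotProduct_const (m.scaleVec'_hasDerivAt b) w).const_mul m.lam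
  refine ((((hC (m.matM a *ᵥ 1)).const_mul k).const_sub 1).div
    (((m.scaleFun_hasDerivAt b).const_mul m.q).add (hC (m.expB a *ᵥ 1))) h).congr_deriv ?_
  rw [policyValueZero]
  simp only [Pi.add_apply]
  field_simp

end RiskModel

end

theorem mainTheorem5 {n : ℕ} (m : RiskModel n) (hm : m.Admissible)
    {Ω : Type*} [MeasurableSpace Ω] (P : Measure Ω) [IsProbabilityMeasure P]
    (τ ξ : ℕ → Ω → ℝ) (hX : m.IsClaimModel P τ ξ)
    (k : ℝ) (hk : 1 ≤ k) (a : ℝ) (ha : 0 ≤ a) (b : ℝ) (hb : 0 ≤ b) :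
    -- the scale function and the root `Φ_q`
    m.IsScaleFunction m.W ∧ (0 < m.bigPhi ∧ m.laplaceExponent m.bigPhi = m.q) ∧
    -- the survival function and the mean function of the claims
    (∀ x, 0 ≤ x → m.survival x = m.β ⬝ᵥ (m.expB x *ᵥ 1)) ∧
    m.matM a = -m.B⁻¹ - m.expB a * (a • (1 : Matrix (Fin n) (Fin n) ℝ) - m.B⁻¹) ∧
    (∀ y, 0 ≤ y → m.partialMean a y = m.β ⬝ᵥ (m.expB y *ᵥ (m.matM a *ᵥ 1))) ∧
    -- the representations of `C⃗`
    (m.vecU ⬝ᵥ 1 = 1 ∧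
      ∃ vecΨ vecZ : ℝ → Fin n → ℝ, ∀ x, 0 ≤ x →
        (∀ y, 0 ≤ y → m.ruinTransform P τ ξ x y = vecΨ x ⬝ᵥ (m.expB y *ᵥ 1)) ∧
        vecZ x = vecΨ x + (m.W x * (m.q / m.bigPhi)) • m.vecU ∧
        m.Z x = vecZ x ⬝ᵥ 1 ∧
        m.vecC x = (m.c * m.W x) • m.vecU - vecZ x ∧
        m.vecC x = ((m.c - m.q / m.bigPhi) * m.W x) • m.vecU - vecΨ x) ∧
    -- matrix forms of `G_a` and of `R_a = S_a - Z_q`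
    (∀ x, 0 ≤ x → m.G a x = m.vecC x ⬝ᵥ (m.matM a *ᵥ 1) ∧
      m.S a x - m.Z x = m.vecC x ⬝ᵥ (m.expB a *ᵥ 1)) ∧
    -- the derivatives below exist, and the value is well defined
    (ContDiffOn ℝ 1 m.W (Ici 0) ∧ ContDiffOn ℝ 2 m.vecC (Ici 0)) ∧
    (∀ x, (∀ᵐ ω ∂P,
        Integrable (fun t : ℝ => Real.exp (-m.q * t)) (m.dividends a b τ ξ x ω) ∧
        Integrable (fun t : ℝ => Real.exp (-m.q * t)) (m.injections a b τ ξ x ω)) ∧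
      Integrable (m.profit k a b τ ξ x) P) ∧
    -- structure of the value function
    (∀ x ∈ Icc 0 b,
      m.J P τ ξ k a b x = k * m.G a x + m.J P τ ξ k a b 0 * m.S a x ∧
      m.J P τ ξ k a b x =
        k * m.G a x + (1 - k * derivWithin (m.G a) (Ici 0) b) /
          derivWithin (m.S a) (Ici 0) b * m.S a x) ∧
    (∀ x ∈ Icc (-a) 0, m.J P τ ξ k a b x = k * x + m.J P τ ξ k a b 0) ∧
    (∀ x < -a, m.J P τ ξ k a b x = 0) ∧
    -- the formula for `J_0`
    (derivWithin (m.S a) (Ici 0) b = m.q * m.W b + m.vecC' b ⬝ᵥ (m.expB a *ᵥ 1) ∧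
      0 < m.q * m.W b + m.vecC' b ⬝ᵥ (m.expB a *ᵥ 1) ∧
      m.J P τ ξ k a b 0 =
        (1 - k * (m.vecC' b ⬝ᵥ (m.matM a *ᵥ 1))) /
          (m.q * m.W b + m.vecC' b ⬝ᵥ (m.expB a *ᵥ 1))) ∧
    -- the optimality equation in `b`, for fixed `a`
    (DifferentiableWithinAt ℝ (fun b' => m.J P τ ξ k a b' 0) (Ici 0) b ∧
      (derivWithin (fun b' => m.J P τ ξ k a b' 0) (Ici 0) b = 0 ↔
        m.J P τ ξ k a b 0 * (m.q * m.W' b + m.vecC'' b ⬝ᵥ (m.expB a *ᵥ 1)) =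
          -(k * (m.vecC'' b ⬝ᵥ (m.matM a *ᵥ 1)))) ∧
      (m.q * m.W' b + m.vecC'' b ⬝ᵥ (m.expB a *ᵥ 1) ≠ 0 →
        (derivWithin (fun b' => m.J P τ ξ k a b' 0) (Ici 0) b = 0 ↔
          m.J P τ ξ k a b 0 =
            -(k * (m.vecC'' b ⬝ᵥ (m.matM a *ᵥ 1))) /
              (m.q * m.W' b + m.vecC'' b ⬝ᵥ (m.expB a *ᵥ 1))))) := by
  have hk0 : 0 ≤ k := zero_le_one.trans hk
  have hJ0 : ∀ b', 0 ≤ b' → m.J P τ ξ k a b' 0 = m.policyValueZero k a b' :=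
    fun b' hb' => RiskModel.J_zero hm hX hk0 ha hb'
  have hW := hm.W_eq_scaleFun hb
  have hSpos : 0 < m.q * m.W b + m.vecC' b ⬝ᵥ (m.expB a *ᵥ 1) := by
    rw [hW, hm.vecC'_dotProduct hb]; exact hm.S_deriv_pos ha hb
  have hS : derivWithin (m.S a) (Ici 0) b = m.q * m.W b + m.vecC' b ⬝ᵥ (m.expB a *ᵥ 1) := by
    rw [hm.S_derivWithin ha hb, hW, hm.vecC'_dotProduct hb]
  have hderiv : HasDerivWithinAt (fun b' => m.J P τ ξ k a b' 0)
      ((-(k * (m.vecC'' b ⬝ᵥ (m.matM a *ᵥ 1))) - m.J P τ ξ k a b 0 *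
        (m.q * m.W' b + m.vecC'' b ⬝ᵥ (m.expB a *ᵥ 1))) /
        (m.q * m.W b + m.vecC' b ⬝ᵥ (m.expB a *ᵥ 1))) (Ici 0) b := by
    rw [hJ0 b hb, hm.vecC''_dotProduct hb, hm.vecC''_dotProduct hb, hm.vecC'_dotProduct hb, hW,
      hm.W'_eq hb]
    exact (m.policyValueZero_hasDerivAt k (hm.S_deriv_pos ha hb).ne').hasDerivWithinAt.congr
      hJ0 (hJ0 b hb)
  -- The denominator `S_a'(b)` is positive, so only the numerator can vanish.
  have hiff : derivWithin (fun b' => m.J P τ ξ k a b' 0) (Ici 0) b = 0 ↔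
      m.J P τ ξ k a b 0 * (m.q * m.W' b + m.vecC'' b ⬝ᵥ (m.expB a *ᵥ 1)) =
        -(k * (m.vecC'' b ⬝ᵥ (m.matM a *ᵥ 1))) := by
    rw [hderiv.derivWithin (uniqueDiffOn_Ici 0 b hb), div_eq_zero_iff, or_iff_left hSpos.ne',
      sub_eq_zero, eq_comm]
  have hvalue : ∀ x ∈ Icc 0 b, m.J P τ ξ k a b x = k * m.G a x +
      m.policyValueZero k a b * m.S a x := fun x hx => by
    rw [RiskModel.J_of_mem hm hX hk0 ha hb hx, hm.G_eq a hx.1, hm.S_eq ha hx.1,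
      RiskModel.policyValue]
  refine ⟨hm.isScaleFunction_W, ⟨hm.bigPhi_pos, hm.bigPhi_mem.2⟩, fun x hx => hm.survival_eq hx,
    m.matM_eq hm.B_unit a, fun y _ => m.partialMean_eq a y, ⟨hm.vecU_dotProduct_one, ?_⟩, ?_,
    ⟨?_, ?_⟩, fun x => ⟨?_, (RiskModel.profit_integrable_and_J_eq hm hX hk0 ha hb x).1⟩,
    fun x hx => ⟨?_, ?_⟩, fun x hx => RiskModel.J_of_nonpos hm hX hk0 ha hb hx,
    fun x hx => RiskModel.J_of_lt hm hX hk0 ha hb hx, ⟨hS, hSpos, ?_⟩,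
    hderiv.differentiableWithinAt, hiff, fun hne => ?_⟩
  -- The two vectors are defined by solving the representations of `C⃗` for them; the content is
  -- that they then reproduce `Ψ_q` and `Z_q`.
  · refine ⟨fun x => ((m.c - m.q / m.bigPhi) * m.W x) • m.vecU - m.vecC x,
      fun x => (m.c * m.W x) • m.vecU - m.vecC x, fun x hx => ⟨fun y hy => ?_, ?_, ?_, ?_, ?_⟩⟩
    · rw [RiskModel.ruinTransform_eq_ruinFun hm hX hx hy, RiskModel.ruinFun, sub_dotProduct,
        smul_dotProduct, hm.vecC_dotProduct hx, hm.W_eq_scaleFun hx, smul_eq_mul]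
      ring
    · ext i
      simp only [Pi.sub_apply, Pi.add_apply, Pi.smul_apply, smul_eq_mul]
      ring
    · rw [sub_dotProduct, smul_dotProduct, hm.vecU_dotProduct_one, hm.vecC_dotProduct hx,
        hm.W_eq_scaleFun hx, hm.Z_eq hx, hm.c_mul_scaleFun, smul_eq_mul]
      ring
    · rw [sub_sub_cancel]
    · rw [sub_sub_cancel]
  · intro x hx
    rw [hm.G_eq a hx, hm.S_eq ha hx, hm.Z_eq hx, hm.vecC_dotProduct hx, hm.vecC_dotProduct hx]
    exact ⟨rfl, add_sub_cancel_left _ _⟩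
  · exact m.scaleFun_contDiff.contDiffOn.congr hm.W_eqOn
  · exact (m.scaleVec_contDiff.const_smul m.lam).contDiffOn.congr fun x hx => hm.vecC_eq hx
  · filter_upwards [hX.τ_pos, RiskModel.ae_summable_exp_arrival hm hX] with ω h1 h2
    exact ⟨(hm.dividends_integral hb h1 x).1, (hm.injections_integral ha h2 x).1⟩
  · rw [hvalue x hx, hJ0 b hb]
  · rw [hvalue x hx, hm.G_derivWithin a hb, hm.S_derivWithin ha hb, RiskModel.policyValueZero]
  · rw [hJ0 b hb, RiskModel.policyValueZero, hm.vecC'_dotProduct hb, hm.vecC'_dotProduct hb, hW]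
  · rw [hiff, eq_div_iff hne]
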